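/- All algebras are over $\mathbb{C}$. Let $\Lambda$ be a lattice, i.e. a free abelian group of finite rank. For an abelian group $Q$, let $\mathcal{G}'(Q)$ be the class of all $Q$-graded Lie algebras $\mathcal{L}=\bigoplus_{\lambda\in Q}\mathcal{L}_\lambda$ that are simple graded (i.e. $[\mathcal{L},\mathcal{L}]\neq 0$ and the only graded ideals of $\mathcal{L}$ are $0$ and $\mathcal{L}$) and satisfy: $\dim\mathcal{L}_\lambda\le 1$ for all $\lambda\in Q$; $\dim\mathcal{L}_0=1$; and the support $\operatorname{Supp}\mathcal{L}=\{\lambda\in Q : \mathcal{L}_\lambda\neq 0\}$ generates the group $Q$. For $\mathcal{L}\in\mathcal{G}'(\Lambda)$ fix a nonzero $L_0\in\mathcal{L}_0$ and let $l:\operatorname{Supp}\mathcal{L}\to\mathbb{C}$ be the function with $[L_0,x]=l(\lambda)\,x$ for all $x\in\mathcal{L}_\lambda$; $\mathcal{L}$ is called integrable if $l$ is bounded. The centroid $C(\mathcal{L})$ is the algebra of all linear maps $\psi:\mathcal{L}\to\mathcal{L}$ with $\psi([a,b])=[\psi(a),b]=[a,\psi(b)]$ for all $a,b\in\mathcal{L}$,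 and its support is the set of all $\mu\in\Lambda$ such that $C(\mathcal{L})$ contains a nonzero map $\psi$ with $\psi(\mathcal{L}_\lambda)\subset\mathcal{L}_{\lambda+\mu}$ for all $\lambda\in\Lambda$. For a homomorphism of abelian groups $\pi:Q\to P$ and a $P$-graded Lie algebra $\mathfrak{g}$, let $\pi^*\mathfrak{g}=\bigoplus_{\lambda\in Q}\mathfrak{g}_{\pi(\lambda)}\otimes e^\lambda$, a subalgebra of $\mathfrak{g}\otimes\mathbb{C}[Q]$ (where $\mathbb{C}[Q]$ is the group algebra with basis $(e^\lambda)_{\lambda\in Q}$), graded by $Q$ with component of degree $\lambda$ equal to $\mathfrak{g}_{\pi(\lambda)}\otimes e^\lambda$. **Theorem.** Let $\mathcal{L}$ be an integrable Lie algebra in the class $\mathcal{G}'(\Lambda)$, and let $M$ be the support of $C(\mathcal{L})$. Then $M$ is a subgroup of $\Lambda$ and, with $\pi:\Lambda\to\Lambda/M$ the natural projection, there exists a Lie algebra $\mathfrak{g}\in\mathcal{G}'(\Lambda/M)$ such that (i) $\mathfrak{g}$ is finite dimensional and simple (as a non-graded Lie algebra), and (ii) $\mathcal{L}\simeq\pi^*\mathfrak{g}$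 as $\Lambda$-graded Lie algebras. -/

import Mathlib

open scoped TensorProduct

universe u v w

namespace GradedLie

section Gradings

variable {M : Type u} [AddCommGroup M] {L : Type v} [LieRing L] [LieAlgebra ℂ L]

/-- The family `A` is a grading of the complex Lie algebra `L` by the abelian group `M`:
`L` is the (internal) direct sum of the `A m`, and `[A l, A m] ⊆ A (l + m)`. -/
structure IsLieGrading (A : M → Submodule ℂ L) : Prop extends SetLike.GradedBracket A where
  isInternal : open scoped Classical in DirectSum.IsInternal A

/-- The support of a graded vector space: the degrees of the nonzero homogeneous components. -/
def support (A : M → Submodule ℂ L) : Set M := {m | A m ≠ ⊥}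

/-- An ideal is graded if it is the sum of its intersections with the homogeneous components. -/
def IsGradedIdeal (A : M → Submodule ℂ L) (I : LieIdeal ℂ L) : Prop :=
  I.toSubmodule = ⨆ m, I.toSubmodule ⊓ A m

/-- `L` is simple graded: its bracket is nonzero, and its only graded ideals are `0` and `L`. -/
structure IsSimpleGraded (A : M → Submodule ℂ L) : Prop where
  non_abelian : ¬ IsLieAbelian L
  eq_bot_or_eq_top : ∀ I : LieIdeal ℂ L, IsGradedIdeal A I → I = ⊥ ∨ I = ⊤

/-- The class `𝒢'(M)`: simple graded Lie algebras with homogeneous components of dimension at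
most one, with component of degree `0` of dimension one, and whose support generates `M`. -/
structure IsClassG' (A : M → Submodule ℂ L) : Prop where
  grading : IsLieGrading A
  simple : IsSimpleGraded A
  rank_le_one : ∀ m, Module.rank ℂ (A m) ≤ 1
  rank_zero : Module.rank ℂ (A 0) = 1
  closure_support : AddSubgroup.closure (support A) = ⊤

/-- `l : Supp L → ℂ` is the function with `[L₀, x] = l(m) x` for all `m` and all `x` of
degree `m`. -/
def IsWeightFunction (A : M → Submodule ℂ L) (L₀ : L) (l : support A → ℂ) : Prop :=
  ∀ (m : support A), ∀ x ∈ A m, ⁅L₀, x⁆ = l m • x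

/-- Integrability: the function `l` attached to a nonzero element `L₀` of degree `0` is bounded.
For `L` in the class `𝒢'(M)`, the function `l` exists and is unique once `L₀` is fixed, and
another choice of `L₀` multiplies it by a nonzero scalar. -/
def IsIntegrable (A : M → Submodule ℂ L) : Prop :=
  ∃ L₀ ∈ A 0, L₀ ≠ 0 ∧ ∃ l : support A → ℂ,
    IsWeightFunction A L₀ l ∧ Bornology.IsBounded (Set.range l)

variable (L) in
/-- The centroid of `L`: the algebra of the linear maps `ψ : L → L` with
`ψ[a, b] = [ψ a, b]` and `ψ[a, b] = [a, ψ b]`. -/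
def centroid : Subalgebra ℂ (Module.End ℂ L) where
  carrier := {ψ | ∀ a b : L, ψ ⁅a, b⁆ = ⁅ψ a, b⁆ ∧ ψ ⁅a, b⁆ = ⁅a, ψ b⁆}
  mul_mem' {φ ψ} hφ hψ a b := by
    simp only [Module.End.mul_apply]
    exact ⟨by rw [(hψ a b).1, (hφ _ _).1], by rw [(hψ a b).2, (hφ _ _).2]⟩
  add_mem' {φ ψ} hφ hψ a b := by
    simp only [LinearMap.add_apply, add_lie, lie_add]
    exact ⟨by rw [(hφ a b).1, (hψ a b).1], by rw [(hφ a b).2, (hψ a b).2]⟩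
  algebraMap_mem' c a b := by simp [Module.algebraMap_end_apply]

/-- The support of the centroid: the degrees `μ` for which some nonzero element of the centroid is
homogeneous of degree `μ`, that is, maps `A m` into `A (m + μ)` for all `m`. -/
def centroidSupport (A : M → Submodule ℂ L) : Set M :=
  {μ | ∃ ψ ∈ centroid L, ψ ≠ 0 ∧ ∀ m, ∀ x ∈ A m, ψ x ∈ A (m + μ)}

/-- Isomorphism of `M`-graded Lie algebras: a Lie algebra isomorphism that carries each homogeneous
component onto the homogeneous component of the same degree. -/
def IsGradedIsomorphic {L' : Type w} [LieRing L'] [LieAlgebra ℂ L']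
    (A : M → Submodule ℂ L) (A' : M → Submodule ℂ L') : Prop :=
  ∃ e : L ≃ₗ⁅ℂ⁆ L', ∀ m, (A m).map (e : L →ₗ[ℂ] L') = A' m

end Gradings

noncomputable section Pullback

variable {Q : Type u} [AddCommGroup Q] {M : Type v} [AddCommGroup M]
  {L : Type w} [LieRing L] [LieAlgebra ℂ L]

/-- The subspace `e^q ⊗ A (π q)` of `ℂ[Q] ⊗ L`, where `ℂ[Q]` is the group algebra. -/
def pullbackPiece (π : Q →+ M) (A : M → Submodule ℂ L) (q : Q) :
    Submodule ℂ (LieAlgebra.loopAlgebra ℂ Q L) :=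
  (A (π q)).map (TensorProduct.mk ℂ (AddMonoidAlgebra ℂ Q) L (AddMonoidAlgebra.single q 1))

theorem lie_mem_pullbackPiece (π : Q →+ M) {A : M → Submodule ℂ L} (hA : IsLieGrading A)
    {p q : Q} {x y : LieAlgebra.loopAlgebra ℂ Q L} (hx : x ∈ pullbackPiece π A p)
    (hy : y ∈ pullbackPiece π A q) : ⁅x, y⁆ ∈ pullbackPiece π A (p + q) := by
  obtain ⟨a, ha, rfl⟩ := hx
  obtain ⟨b, hb, rfl⟩ := hy
  refine ⟨⁅a, b⁆, ?_, ?_⟩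
  · rw [map_add]
    exact hA.bracket_mem ha hb
  · simp [AddMonoidAlgebra.single_mul_single]

/-- The Lie algebra `π^* L = ⨁_q e^q ⊗ A (π q)`, as a subalgebra of `ℂ[Q] ⊗ L`. -/
def pullback (π : Q →+ M) {A : M → Submodule ℂ L} (hA : IsLieGrading A) :
    LieSubalgebra ℂ (LieAlgebra.loopAlgebra ℂ Q L) where
  __ := ⨆ q, pullbackPiece π A q
  lie_mem' {x y} hx hy := by
    change x ∈ ⨆ q, pullbackPiece π A q at hx
    change y ∈ ⨆ q, pullbackPiece π A q at hy
    change ⁅x, y⁆ ∈ ⨆ q, pullbackPiece π A q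
    induction hx using Submodule.iSup_induction' with
    | zero => exact (zero_lie y : ⁅(0 : LieAlgebra.loopAlgebra ℂ Q L), y⁆ = 0).symm ▸ zero_mem _
    | add x x' _ _ h h' => exact (add_lie x x' y : ⁅x + x', y⁆ = _).symm ▸ add_mem h h'
    | mem p x hx =>
      induction hy using Submodule.iSup_induction' with
      | zero => exact (lie_zero x : ⁅x, (0 : LieAlgebra.loopAlgebra ℂ Q L)⁆ = 0).symm ▸ zero_mem _
      | add y y' _ _ h h' => exact (lie_add x y y' : ⁅x, y + y'⁆ = _).symm ▸ add_mem h h'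
      | mem q y hy =>
        exact Submodule.mem_iSup_of_mem (p + q) (lie_mem_pullbackPiece π hA hx hy)

/-- The grading of `π^* L` by `Q`: the component of degree `q` is `e^q ⊗ A (π q)`. -/
def pullbackGrading (π : Q →+ M) {A : M → Submodule ℂ L} (hA : IsLieGrading A) (q : Q) :
    Submodule ℂ (pullback π hA) :=
  (pullbackPiece π A q).comap (pullback π hA).toSubmodule.subtype

end Pullback

end GradedLie

/-! Bounded weights make `L` look like a finite-dimensional simple Lie algebra, up to translation by
degrees of the centroid. An element of degree `α` with `l α ≠ 0` is ad-nilpotent, and two such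
elements of opposite degrees that do not commute give an `𝔰𝔩₂`-triple with neutral element in `ℂ
h₀`. As components are lines, each homogeneous element lies in one finite string
(`IsTriple.exists_string`), and exponentials give reflections. The product of two reflections of
equal weight translates degrees by multiples of `α' - α`.

The hard point is that every nonzero homogeneous element of nonzero weight lies in a triple
(`exists_isTriple_of_ne_zero`). The obstacle is a Heisenberg pair: `x`, `y` of weight 0 with `[x, y]
= h₀`. On a space of nonzero weight it acts as a Weyl algebra, and infinite Weyl strings conflict
with reflections and translations (`IsHeisenberg.elim`). Without such pairs, the elements that
commute with the opposite component generate a proper graded ideal, which is zero by simplicity.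

A translation restricted to the top weight then generates, under the action of `L`, the graph of a
homogeneous centroid element. Hence a fixed multiple of `α' - α` lies in `M`
(`IsTriple.exists_smul_sub_mem`); there are finitely many weights and `Λ/M` has finite `n`-torsion
for each `n ≠ 0`, so the support is finite modulo `M`.

By Schur's lemma homogeneous centroid elements are invertible and commute. Since `M` is free they
can be chosen multiplicatively; setting them equal to 1 produces the finite-dimensional `𝔤`, and `L`
is its pullback. The centroid of `𝔤` has no nonzero degree, so an element of an ideal with the
fewest components is homogeneous, and `𝔤` is simple. -/

namespace GradedLie

/-! ### Operators and ideals given by homogeneous components -/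

section Grading

variable {Λ : Type u} [AddCommGroup Λ] {L : Type v} [LieRing L] [LieAlgebra ℂ L]
  {A : Λ → Submodule ℂ L}

theorem IsLieGrading.lie_mem (hA : IsLieGrading A) {i j : Λ} {x y : L} (hx : x ∈ A i)
    (hy : y ∈ A j) : ⁅x, y⁆ ∈ A (i + j) :=
  hA.bracket_mem hx hy

theorem IsLieGrading.lie_mem_of_eq (hA : IsLieGrading A) {i j k : Λ} {x y : L} (hx : x ∈ A i)
    (hy : y ∈ A j) (h : i + j = k) : ⁅x, y⁆ ∈ A k :=
  h ▸ hA.lie_mem hx hy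

theorem IsLieGrading.iSup_eq_top (hA : IsLieGrading A) : ⨆ i, A i = ⊤ := by
  classical
  exact hA.isInternal.submodule_iSup_eq_top

theorem IsLieGrading.induction (hA : IsLieGrading A) {P : L → Prop} (hom : ∀ i, ∀ x ∈ A i, P x)
    (zero : P 0) (add : ∀ x y, P x → P y → P (x + y)) (x : L) : P x :=
  Submodule.iSup_induction A (motive := P) (hA.iSup_eq_top ▸ Submodule.mem_top) hom zero add

variable {N : Type w} [AddCommGroup N] [Module ℂ N]

open scoped Classical in
theorem IsLieGrading.bijective (hA : IsLieGrading A) :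
    Function.Bijective (DirectSum.coeLinearMap A) :=
  hA.isInternal

open scoped Classical in
/-- The linear map on a graded Lie algebra that is given by `φ i` on the component of
degree `i`. -/
noncomputable def IsLieGrading.lift (hA : IsLieGrading A) (φ : Λ → L →ₗ[ℂ] N) : L →ₗ[ℂ] N :=
  (DirectSum.toModule ℂ Λ N fun i => φ i ∘ₗ (A i).subtype) ∘ₗ
    (LinearEquiv.ofBijective (DirectSum.coeLinearMap A) hA.bijective).symm.toLinearMap

theorem IsLieGrading.lift_apply (hA : IsLieGrading A) (φ : Λ → L →ₗ[ℂ] N) {i : Λ} {x : L}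
    (hx : x ∈ A i) : hA.lift φ x = φ i x := by
  classical
  have h : (LinearEquiv.ofBijective (DirectSum.coeLinearMap A) hA.bijective).symm x
      = DirectSum.lof ℂ Λ (fun i => A i) i ⟨x, hx⟩ := by
    rw [LinearEquiv.symm_apply_eq]
    simp [DirectSum.coeLinearMap_lof]
  simp only [lift, LinearMap.comp_apply, LinearEquiv.coe_coe]
  rw [h]
  simp

theorem IsLieGrading.linearMap_ext (hA : IsLieGrading A) {φ ψ : L →ₗ[ℂ] N}
    (h : ∀ i, ∀ x ∈ A i, φ x = ψ x) (x : L) : φ x = ψ x :=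
  hA.induction (P := fun x => φ x = ψ x) h (by simp) (fun x y hx hy => by simp [hx, hy]) x

/-- The operator which acts on the component of degree `i` by the scalar `χ i`. -/
noncomputable def IsLieGrading.diag (hA : IsLieGrading A) (χ : Λ → ℂ) : L →ₗ[ℂ] L :=
  hA.lift fun i => χ i • LinearMap.id

theorem IsLieGrading.diag_apply (hA : IsLieGrading A) (χ : Λ → ℂ) {i : Λ} {x : L}
    (hx : x ∈ A i) : hA.diag χ x = χ i • x := by
  simp [diag, hA.lift_apply _ hx]

open scoped Classical in
/-- The projection onto the component of degree `i`. -/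
noncomputable def IsLieGrading.proj (hA : IsLieGrading A) (i : Λ) : L →ₗ[ℂ] L :=
  hA.diag fun j => if j = i then 1 else 0

theorem IsLieGrading.proj_same (hA : IsLieGrading A) {i : Λ} {x : L} (hx : x ∈ A i) :
    hA.proj i x = x := by
  simp [proj, hA.diag_apply _ hx]

theorem IsLieGrading.proj_ne (hA : IsLieGrading A) {i j : Λ} {x : L} (hx : x ∈ A j)
    (h : j ≠ i) : hA.proj i x = 0 := by
  simp [proj, hA.diag_apply _ hx, h]

theorem IsLieGrading.proj_mem (hA : IsLieGrading A) (i : Λ) (x : L) : hA.proj i x ∈ A i := by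
  refine hA.induction (P := fun x => hA.proj i x ∈ A i) (fun j x hx => ?_) (by simp)
    (fun x y hx hy => by simpa using add_mem hx hy) x
  by_cases h : j = i
  · subst h; rwa [hA.proj_same hx]
  · simp [hA.proj_ne hx h]

theorem IsLieGrading.mem_of_proj_mem (hA : IsLieGrading A) {K : Submodule ℂ L} {x : L}
    (h : ∀ i, hA.proj i x ∈ K) : x ∈ K := by
  classical
  have hx : x ∈ ⨆ i, A i := hA.iSup_eq_top ▸ Submodule.mem_top
  rw [Submodule.mem_iSup_iff_exists_finsupp] at hx
  obtain ⟨f, hf, rfl⟩ := hx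
  have hp : ∀ i, hA.proj i (f.sum fun _ y => y) = f i := by
    intro i
    rw [Finsupp.sum, map_sum, Finset.sum_eq_single i]
    · exact hA.proj_same (hf i)
    · intro j _ hj
      exact hA.proj_ne (hf j) hj
    · intro hi
      simp [Finsupp.notMem_support_iff.1 hi]
  exact Submodule.sum_mem _ fun i _ => by simpa [hp] using h i

theorem IsLieGrading.eq_zero_of_proj (hA : IsLieGrading A) {x : L} (h : ∀ i, hA.proj i x = 0) :
    x = 0 :=
  hA.mem_of_proj_mem (K := ⊥) fun i => (Submodule.mem_bot ℂ).2 (h i)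

theorem IsLieGrading.isGradedIdeal (hA : IsLieGrading A) {I : LieIdeal ℂ L}
    (h : ∀ x ∈ I, ∀ i, hA.proj i x ∈ I) : IsGradedIdeal A I := by
  refine le_antisymm (fun x hx => ?_) (iSup_le fun i => inf_le_left)
  refine hA.mem_of_proj_mem fun i => ?_
  exact Submodule.mem_iSup_of_mem i ⟨h x hx i, hA.proj_mem i x⟩

/-- An ideal given by homogeneous components of a simple graded Lie algebra is trivial. -/
theorem IsSimpleGraded.family_dichotomy (hs : IsSimpleGraded A) (hA : IsLieGrading A)
    (K : Λ → Submodule ℂ L) (hK : ∀ i, K i ≤ A i)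
    (hlie : ∀ i j, ∀ x ∈ A i, ∀ y ∈ K j, ⁅x, y⁆ ∈ K (i + j)) :
    (∀ i, K i = ⊥) ∨ ∀ i, K i = A i := by
  classical
  have hproj : ∀ x ∈ ⨆ i, K i, ∀ i, hA.proj i x ∈ K i := by
    intro x hx i
    refine Submodule.iSup_induction K (motive := fun x => hA.proj i x ∈ K i) hx ?_ (by simp)
      (fun x y hx hy => by simpa using add_mem hx hy)
    intro j y hy
    by_cases h : j = i
    · subst h; rwa [hA.proj_same (hK _ hy)]
    · simp [hA.proj_ne (hK _ hy) h]
  let I : LieIdeal ℂ L :=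
    { __ := ⨆ i, K i
      lie_mem := by
        intro x y hy
        change y ∈ ⨆ i, K i at hy
        change ⁅x, y⁆ ∈ ⨆ i, K i
        refine hA.induction (P := fun x => ⁅x, y⁆ ∈ ⨆ i, K i) ?_ (by simp)
          (fun x x' hx hx' => by simpa using add_mem hx hx') x
        intro i x hx
        refine Submodule.iSup_induction K (motive := fun y => ⁅x, y⁆ ∈ ⨆ i, K i) hy ?_ (by simp)
          (fun y y' hy hy' => by simpa using add_mem hy hy')
        intro j y hy
        exact Submodule.mem_iSup_of_mem _ (hlie i j x hx y hy) }
  have hI : ∀ x, x ∈ I ↔ x ∈ ⨆ i, K i := fun x => Iff.rfl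
  have hgr : IsGradedIdeal A I := hA.isGradedIdeal fun x hx i =>
    Submodule.mem_iSup_of_mem i (hproj x hx i)
  rcases hs.eq_bot_or_eq_top I hgr with h | h
  · left
    intro i
    rw [eq_bot_iff]
    intro x hx
    have : x ∈ I := Submodule.mem_iSup_of_mem i hx
    rwa [h] at this
  · right
    intro i
    refine le_antisymm (hK i) fun x hx => ?_
    have : x ∈ I := h ▸ LieSubmodule.mem_top x
    simpa [hA.proj_same hx] using hproj x this i

end Grading

/-! ### Weights, `𝔰𝔩₂`-triples and strings -/

section WeightSystem

variable {Λ : Type u} [AddCommGroup Λ] {L : Type v} [LieRing L] [LieAlgebra ℂ L]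

local notation "ad" => LieAlgebra.ad ℂ L

/-- A simple graded Lie algebra with components of dimension at most one, with a nonzero element
`h₀` of degree `0` that acts on the component of degree `ν` by the scalar `l ν`, where `l` is
bounded on the support. -/
structure WeightSystem (A : Λ → Submodule ℂ L) (h₀ : L) (l : Λ → ℂ) : Prop where
  grading : IsLieGrading A
  simple : IsSimpleGraded A
  line : ∀ ν, ∀ x ∈ A ν, x ≠ 0 → ∀ y ∈ A ν, ∃ c : ℂ, y = c • x
  mem : h₀ ∈ A 0
  ne_zero : h₀ ≠ 0
  lie : ∀ ν, ∀ x ∈ A ν, ⁅h₀, x⁆ = l ν • x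
  bdd : ∃ C : ℝ, ∀ ν, ∀ x ∈ A ν, x ≠ 0 → ‖l ν‖ ≤ C

theorem exists_line {V : Type v} [AddCommGroup V] [Module ℂ V] {B : Submodule ℂ V}
    (h : Module.rank ℂ B ≤ 1) {x : V} (hx : x ∈ B) (hx0 : x ≠ 0) {y : V} (hy : y ∈ B) :
    ∃ c : ℂ, y = c • x := by
  rw [rank_submodule_le_one_iff] at h
  obtain ⟨v, _, hv⟩ := h
  obtain ⟨a, rfl⟩ := Submodule.mem_span_singleton.1 (hv hx)
  obtain ⟨b, rfl⟩ := Submodule.mem_span_singleton.1 (hv hy)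
  have ha : a ≠ 0 := fun h => hx0 (by simp [h])
  exact ⟨b / a, by rw [smul_smul, div_mul_cancel₀ _ ha]⟩

theorem exists_weightSystem {A : Λ → Submodule ℂ L} (hA : IsClassG' A) (hint : IsIntegrable A) :
    ∃ h₀ l, WeightSystem A h₀ l := by
  classical
  obtain ⟨h₀, hmem, hne, l, hl, hb⟩ := hint
  obtain ⟨C, hC⟩ := hb.exists_norm_le
  -- The value 0 off the support is arbitrary: no condition sees it.
  refine ⟨h₀, fun ν => if h : ν ∈ support A then l ⟨ν, h⟩ else 0, hA.grading, hA.simple,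
    fun ν x hx hx0 y hy => exists_line (hA.rank_le_one ν) hx hx0 hy, hmem, hne, ?_, C, ?_⟩
  · intro ν x hx
    by_cases h : ν ∈ support A
    · simpa [h] using hl ⟨ν, h⟩ x hx
    · have : x = 0 := by simpa [not_not.1 h] using hx
      simp [this]
  · intro ν x hx hx0
    have h : ν ∈ support A := by
      intro h
      rw [h] at hx
      exact hx0 (by simpa using hx)
    simpa [h] using hC _ ⟨⟨ν, h⟩, rfl⟩

/-- An `𝔰𝔩₂`-triple of homogeneous elements of degrees `α` and `-α` whose neutral element is a
multiple of `h₀`. -/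
structure IsTriple (A : Λ → Submodule ℂ L) (h₀ : L) (l : Λ → ℂ) (α : Λ) (e f : L) : Prop where
  l_ne_zero : l α ≠ 0
  e_mem : e ∈ A α
  f_mem : f ∈ A (-α)
  lie_e_f : ⁅e, f⁆ = (2 / l α) • h₀

namespace WeightSystem

variable {A : Λ → Submodule ℂ L} {h₀ : L} {l : Λ → ℂ}

theorem l_eq (S : WeightSystem A h₀ l) {ν : Λ} {x : L} {c : ℂ} (hx : x ∈ A ν) (hx0 : x ≠ 0)
    (h : ⁅h₀, x⁆ = c • x) : l ν = c := by
  rw [S.lie ν x hx] at h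
  exact smul_left_injective ℂ hx0 h

theorem weight_lie {h₀ x y : L} {a b : ℂ} (hx : ⁅h₀, x⁆ = a • x) (hy : ⁅h₀, y⁆ = b • y) :
    ⁅h₀, ⁅x, y⁆⁆ = (a + b) • ⁅x, y⁆ := by
  rw [leibniz_lie, hx, hy, smul_lie, lie_smul, add_smul]

theorem l_add (S : WeightSystem A h₀ l) {α β : Λ} {x y : L} (hx : x ∈ A α) (hy : y ∈ A β)
    (h : ⁅x, y⁆ ≠ 0) : l (α + β) = l α + l β :=
  S.l_eq (S.grading.lie_mem hx hy) h (weight_lie (S.lie _ _ hx) (S.lie _ _ hy))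

theorem l_add_of_eq (S : WeightSystem A h₀ l) {α β γ : Λ} {x y : L} (hx : x ∈ A α) (hy : y ∈ A β)
    (h : ⁅x, y⁆ ≠ 0) (hγ : α + β = γ) : l γ = l α + l β :=
  hγ ▸ S.l_add hx hy h

theorem l_zero (S : WeightSystem A h₀ l) : l 0 = 0 :=
  S.l_eq S.mem S.ne_zero (by simp)

theorem exists_smul_h₀ (S : WeightSystem A h₀ l) {x : L} (hx : x ∈ A 0) : ∃ c : ℂ, x = c • h₀ :=
  S.line 0 h₀ S.mem S.ne_zero x hx

theorem pow_mem (S : WeightSystem A h₀ l) {α ν : Λ} {e v : L} (he : e ∈ A α) (hv : v ∈ A ν)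
    (n : ℕ) : ((ad e) ^ n) v ∈ A (ν + n • α) := by
  induction n with
  | zero => simpa using hv
  | succ n ih =>
    rw [pow_succ', Module.End.mul_apply, LieAlgebra.ad_apply]
    exact S.grading.lie_mem_of_eq he ih (by rw [succ_nsmul]; abel)

theorem weight_pow {h₀ : L} {a b : ℂ} {e v : L} (he : ⁅h₀, e⁆ = a • e) (hv : ⁅h₀, v⁆ = b • v)
    (n : ℕ) : ⁅h₀, ((ad e) ^ n) v⁆ = (b + n * a) • ((ad e) ^ n) v := by
  induction n with
  | zero => simpa using hv
  | succ n ih =>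
    rw [pow_succ', Module.End.mul_apply, LieAlgebra.ad_apply, weight_lie he ih]
    congr 1
    push_cast
    ring

/-- Each application of `ad e` adds `l α ≠ 0` to the weight, so the bound on `l` limits the number
of steps uniformly in the starting vector. -/
theorem exists_pow_eq_zero (S : WeightSystem A h₀ l) {α : Λ} {e : L} (he : e ∈ A α)
    (hl : l α ≠ 0) : ∃ n : ℕ, (ad e) ^ n = 0 := by
  obtain ⟨C, hC⟩ := S.bdd
  obtain ⟨n, hn⟩ := exists_nat_gt (2 * C / ‖l α‖)
  refine ⟨n, LinearMap.ext fun v => S.grading.linearMap_ext (ψ := 0) (fun ν v hv => ?_) v⟩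
  by_contra h0
  have hv0 : v ≠ 0 := fun h => h0 (by simp [h])
  have h1 := hC _ _ (S.pow_mem he hv n) h0
  rw [S.l_eq (S.pow_mem he hv n) h0 (weight_pow (S.lie _ _ he) (S.lie _ _ hv) n)] at h1
  have h2 := hC _ _ hv hv0
  have h3 : (n : ℝ) * ‖l α‖ ≤ 2 * C := by
    calc (n : ℝ) * ‖l α‖ = ‖(l ν + n * l α) - l ν‖ := by simp
      _ ≤ ‖l ν + n * l α‖ + ‖l ν‖ := norm_sub_le _ _
      _ ≤ 2 * C := by linarith
  rw [div_lt_iff₀ (norm_pos_iff.2 hl)] at hn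
  linarith

end WeightSystem

namespace IsTriple

variable {A : Λ → Submodule ℂ L} {h₀ : L} {l : Λ → ℂ} {α : Λ} {e f : L}

theorem lie_ne_zero (T : IsTriple A h₀ l α e f) (S : WeightSystem A h₀ l) : ⁅e, f⁆ ≠ 0 := by
  rw [T.lie_e_f]
  exact smul_ne_zero (div_ne_zero two_ne_zero T.l_ne_zero) S.ne_zero

theorem e_ne_zero (T : IsTriple A h₀ l α e f) (S : WeightSystem A h₀ l) : e ≠ 0 :=
  fun h => T.lie_ne_zero S (by simp [h])

theorem f_ne_zero (T : IsTriple A h₀ l α e f) (S : WeightSystem A h₀ l) : f ≠ 0 :=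
  fun h => T.lie_ne_zero S (by simp [h])

theorem l_neg (T : IsTriple A h₀ l α e f) (S : WeightSystem A h₀ l) : l (-α) = -l α := by
  have h := S.l_add_of_eq T.e_mem T.f_mem (T.lie_ne_zero S) (add_neg_cancel α)
  rw [S.l_zero] at h
  linear_combination -h

theorem symm (T : IsTriple A h₀ l α e f) (S : WeightSystem A h₀ l) :
    IsTriple A h₀ l (-α) f e where
  l_ne_zero := by rw [T.l_neg S]; exact neg_ne_zero.2 T.l_ne_zero
  e_mem := T.f_mem
  f_mem := by simpa using T.e_mem
  lie_e_f := by rw [T.l_neg S, ← lie_skew, T.lie_e_f, ← neg_smul]; congr 1; ring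

theorem lie_h_e (T : IsTriple A h₀ l α e f) (S : WeightSystem A h₀ l) : ⁅h₀, e⁆ = l α • e :=
  S.lie _ _ T.e_mem

theorem lie_h_f (T : IsTriple A h₀ l α e f) (S : WeightSystem A h₀ l) : ⁅h₀, f⁆ = -l α • f := by
  rw [S.lie _ _ T.f_mem, T.l_neg S]

theorem lie_e_lie_f (T : IsTriple A h₀ l α e f) {v : L} {c : ℂ} (hv : ⁅h₀, v⁆ = c • v) :
    ⁅e, ⁅f, v⁆⁆ = ⁅f, ⁅e, v⁆⁆ + (2 * c / l α) • v := by
  rw [leibniz_lie, T.lie_e_f, smul_lie, hv, smul_smul, add_comm]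
  congr 2
  ring

/-- Components are lines, so `v` is an eigenvector of `ad f ∘ ad e` and generates a single string,
not a mixture of several. Following the eigenvalue down to the last nonzero `f^n v` determines it.
-/
theorem exists_string_aux (T : IsTriple A h₀ l α e f) (S : WeightSystem A h₀ l) {ν : Λ} {v : L}
    (hv : v ∈ A ν) (hv0 : v ≠ 0) :
    ∃ n : ℕ, ((ad f) ^ n) v ≠ 0 ∧ ((ad f) ^ (n + 1)) v = 0 ∧
      ⁅f, ⁅e, v⁆⁆ = ((n + 1) * (n - 2 * l ν / l α) : ℂ) • v := by
  classical
  obtain ⟨N, hN⟩ := S.exists_pow_eq_zero T.f_mem (T.symm S).l_ne_zero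
  have hex : ∃ n, ((ad f) ^ n) v = 0 := ⟨N, by simp [hN]⟩
  obtain ⟨n, hn⟩ : ∃ n, Nat.find hex = n + 1 := by
    refine Nat.exists_eq_succ_of_ne_zero fun h => hv0 ?_
    have := Nat.find_spec hex
    rw [h] at this
    simpa using this
  have h1 : ((ad f) ^ (n + 1)) v = 0 := hn ▸ Nat.find_spec hex
  have h2 : ((ad f) ^ n) v ≠ 0 := Nat.find_min hex (by omega)
  refine ⟨n, h2, h1, ?_⟩
  have hfe : ⁅f, ⁅e, v⁆⁆ ∈ A ν :=
    S.grading.lie_mem_of_eq T.f_mem (S.grading.lie_mem T.e_mem hv) (by abel)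
  obtain ⟨d, hd⟩ := S.line ν v hv hv0 _ hfe
  have hw : ∀ i : ℕ, ⁅h₀, ((ad f) ^ i) v⁆ = (l ν + i * -l α) • ((ad f) ^ i) v :=
    fun i => WeightSystem.weight_pow (T.lie_h_f S) (S.lie _ _ hv) i
  have key : ∀ i : ℕ, ⁅f, ⁅e, ((ad f) ^ i) v⁆⁆ =
      (d + i * (2 * l ν / l α) - i * (i - 1)) • ((ad f) ^ i) v := by
    intro i
    induction i with
    | zero => simpa using hd
    | succ i ih =>
      rw [pow_succ', Module.End.mul_apply, LieAlgebra.ad_apply, T.lie_e_lie_f (hw i), ih,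
        ← add_smul, lie_smul]
      congr 1
      have := T.l_ne_zero
      field_simp
      push_cast
      ring
  have h3 := T.lie_e_lie_f (hw n)
  rw [key n, ← add_smul] at h3
  have h4 : ⁅f, ((ad f) ^ n) v⁆ = 0 := by
    rw [← h1, pow_succ', Module.End.mul_apply, LieAlgebra.ad_apply]
  rw [h4, lie_zero, eq_comm, smul_eq_zero, or_iff_left h2] at h3
  rw [hd]
  congr 1
  have := T.l_ne_zero
  field_simp at h3 ⊢
  linear_combination h3

/-- The `𝔰𝔩₂`-string of a homogeneous element. -/
theorem exists_string (T : IsTriple A h₀ l α e f) (S : WeightSystem A h₀ l) {ν : Λ} {v : L}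
    (hv : v ∈ A ν) (hv0 : v ≠ 0) :
    ∃ n m : ℕ, 2 * l ν / l α = (n : ℂ) - m ∧ ⁅f, ⁅e, v⁆⁆ = ((n + 1) * m : ℂ) • v ∧
      ⁅e, ⁅f, v⁆⁆ = ((m + 1) * n : ℂ) • v ∧ ((ad f) ^ n) v ≠ 0 ∧ ((ad f) ^ (n + 1)) v = 0 ∧
      ((ad e) ^ m) v ≠ 0 ∧ ((ad e) ^ (m + 1)) v = 0 := by
  obtain ⟨n, hn1, hn2, hn3⟩ := T.exists_string_aux S hv hv0
  obtain ⟨m, hm1, hm2, hm3⟩ := (T.symm S).exists_string_aux S hv hv0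
  have h := T.lie_e_lie_f (S.lie _ _ hv)
  have hl := T.l_ne_zero
  rw [hn3, hm3, T.l_neg S, ← add_smul] at h
  have h := smul_left_injective ℂ hv0 h
  -- `n` counts the steps with `f`, `m` those with `e`. Comparing the eigenvalues computed from the
  -- two ends gives the claim multiplied by `n + m + 1`.
  have hnm : 2 * l ν / l α = (n : ℂ) - m := by
    have h5 : ((n + m + 1 : ℕ) : ℂ) ≠ 0 := Nat.cast_ne_zero.2 (by omega)
    refine mul_left_cancel₀ h5 ?_
    push_cast
    simp only [div_neg] at h
    linear_combination h
  refine ⟨n, m, hnm, ?_, ?_, hn1, hn2, hm1, hm2⟩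
  · rw [hn3, hnm]; congr 1; ring
  · rw [hm3, T.l_neg S, div_neg, hnm]; congr 1; ring

end IsTriple

end WeightSystem

/-! ### Weight 0 is generated by the nonzero weights -/

section Roots

variable {Λ : Type u} [AddCommGroup Λ] {L : Type v} [LieRing L] [LieAlgebra ℂ L]
  {A : Λ → Submodule ℂ L} {h₀ : L} {l : Λ → ℂ}

namespace WeightSystem

theorem l_neg_of_lie_ne (S : WeightSystem A h₀ l) {α : Λ} {u v : L} (hu : u ∈ A α)
    (hv : v ∈ A (-α)) (h : ⁅u, v⁆ ≠ 0) : l (-α) = -l α := by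
  have := S.l_add_of_eq hu hv h (add_neg_cancel α)
  rw [S.l_zero] at this
  linear_combination -this

/-- Homogeneous elements of opposite degrees and nonzero weights that do not commute span, together
with their bracket, a copy of `𝔰𝔩₂`. -/
theorem exists_isTriple (S : WeightSystem A h₀ l) {α : Λ} {u v : L} (hl : l α ≠ 0) (hu : u ∈ A α)
    (hv : v ∈ A (-α)) (h : ⁅u, v⁆ ≠ 0) : ∃ c : ℂ, c ≠ 0 ∧ IsTriple A h₀ l α u (c • v) := by
  obtain ⟨d, hd⟩ := S.exists_smul_h₀ (S.grading.lie_mem_of_eq hu hv (add_neg_cancel α))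
  have hd0 : d ≠ 0 := fun h0 => h (by simp [hd, h0])
  refine ⟨2 / l α / d, by simp [hl, hd0], hl, hu, (A _).smul_mem _ hv, ?_⟩
  rw [lie_smul, hd, smul_smul, div_mul_cancel₀ _ hd0]

/-- Otherwise `h₀` is central, its line is a graded ideal, and `L = ℂ h₀` is abelian. -/
theorem exists_l_ne_zero (S : WeightSystem A h₀ l) : ∃ ν, A ν ≠ ⊥ ∧ l ν ≠ 0 := by
  classical
  by_contra hne
  push Not at hne
  have hc : ∀ x : L, ⁅h₀, x⁆ = 0 := by
    refine S.grading.induction (fun ν x hx => ?_) (by simp) (fun x y hx hy => by simp [hx, hy])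
    by_cases h : A ν = ⊥
    · have : x = 0 := by simpa [h] using hx
      simp [this]
    · rw [S.lie ν x hx, hne ν h, zero_smul]
  have hc' : ∀ x : L, ⁅x, h₀⁆ = 0 := fun x => by rw [← lie_skew, hc, neg_zero]
  rcases S.simple.family_dichotomy S.grading (fun ν => if ν = 0 then A 0 else ⊥)
    (fun ν => by by_cases h : ν = 0 <;> simp [h]) (by
      intro i j x _ y hy
      by_cases h : j = 0
      · simp only [h, if_true] at hy
        obtain ⟨c, rfl⟩ := S.exists_smul_h₀ hy
        simp [hc']
      · simp only [h, if_false, Submodule.mem_bot] at hy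
        simp [hy]) with h | h
  · have := h 0
    simp only [if_true] at this
    exact S.ne_zero (by simpa [this] using S.mem)
  · have hall : ∀ x : L, ∃ c : ℂ, x = c • h₀ := by
      refine S.grading.induction (fun ν x hx => ?_) ⟨0, by simp⟩ ?_
      · rw [← h ν] at hx
        by_cases hν : ν = 0
        · simp only [hν, if_true] at hx
          exact S.exists_smul_h₀ hx
        · exact ⟨0, by simpa [hν] using hx⟩
      · rintro x y ⟨a, rfl⟩ ⟨b, rfl⟩
        exact ⟨a + b, (add_smul _ _ _).symm⟩
    refine S.simple.non_abelian ⟨fun x y => ?_⟩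
    obtain ⟨c, rfl⟩ := hall y
    simp [hc']

open scoped Classical in
/-- The elements of weight `0` are brackets of elements of nonzero weights. -/
theorem exists_lie_eq (S : WeightSystem A h₀ l) {σ : Λ} (hσ : l σ = 0) {x : L} (hx : x ∈ A σ)
    (hx0 : x ≠ 0) : ∃ β, ∃ u ∈ A β, ∃ v ∈ A (σ - β), l β ≠ 0 ∧ ⁅u, v⁆ = x := by
  let G : Λ → Set L := fun σ => {x | ∃ β, ∃ u ∈ A β, ∃ v ∈ A (σ - β), l β ≠ 0 ∧ ⁅u, v⁆ = x}
  have hG : ∀ σ, ∀ x ∈ G σ, x ∈ A σ := by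
    rintro σ _ ⟨β, u, hu, v, hv, _, rfl⟩
    exact S.grading.lie_mem_of_eq hu hv (by abel)
  -- These pieces form a nonzero graded ideal, hence all of `L`. As a component is a line, one
  -- bracket then suffices instead of a sum.
  let K : Λ → Submodule ℂ L := fun σ => if l σ = 0 then Submodule.span ℂ (G σ) else A σ
  have hK : ∀ σ, K σ ≤ A σ := by
    intro σ
    by_cases h : l σ = 0
    · simp only [K, h, if_true]
      exact Submodule.span_le.2 (hG σ)
    · simp [K, h]
  have hlie : ∀ i j, ∀ x ∈ A i, ∀ y ∈ K j, ⁅x, y⁆ ∈ K (i + j) := by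
    intro i j x hx y hy
    by_cases hxy : ⁅x, y⁆ = 0
    · simp [hxy]
    have hadd := S.l_add hx (hK j hy) hxy
    by_cases hij : l (i + j) = 0
    · simp only [K, hij, if_true]
      by_cases hj : l j = 0
      · have hi : l i = 0 := by rw [hij, hj] at hadd; linear_combination -hadd
        simp only [K, hj, if_true] at hy
        induction hy using Submodule.span_induction with
        | zero => simp
        | smul c y _ h =>
          rw [lie_smul]
          refine Submodule.smul_mem _ _ (h ?_)
          intro h0
          exact hxy (by simp [h0])
        | add y z hy hz hy' hz' =>
          rw [lie_add]
          refine add_mem ?_ ?_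
          · by_cases h0 : ⁅x, y⁆ = 0
            · simp [h0]
            · exact hy' h0
          · by_cases h0 : ⁅x, z⁆ = 0
            · simp [h0]
            · exact hz' h0
        | mem y hy =>
          obtain ⟨β, u, hu, v, hv, hβ, rfl⟩ := hy
          rw [leibniz_lie]
          refine add_mem ?_ (Submodule.subset_span ⟨β, u, hu, _,
            S.grading.lie_mem_of_eq hx hv (by abel), hβ, rfl⟩)
          by_cases h0 : ⁅x, u⁆ = 0
          · simp [h0]
          · exact Submodule.subset_span ⟨i + β, _, S.grading.lie_mem hx hu, v,
              by convert hv using 1; congr 1; abel, by rwa [S.l_add hx hu h0, hi, zero_add], rfl⟩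
      · refine Submodule.subset_span ⟨i, x, hx, y, ?_, ?_, rfl⟩
        · convert hK j hy using 1; congr 1; abel
        · intro hi
          rw [hij, hi, zero_add] at hadd
          exact hj hadd.symm
    · simp only [K, hij, if_false]
      exact S.grading.lie_mem hx (hK j hy)
  rcases S.simple.family_dichotomy S.grading K hK hlie with h | h
  · obtain ⟨ν, hν, hl⟩ := S.exists_l_ne_zero
    exact absurd (by simpa [K, hl] using h ν) hν
  · have hs := h σ
    simp only [K, hσ, if_true] at hs
    obtain ⟨y, hy, hy0⟩ : ∃ y ∈ G σ, y ≠ 0 := by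
      by_contra hn
      push Not at hn
      rw [← hs] at hx
      have : Submodule.span ℂ (G σ) ≤ ⊥ := Submodule.span_le.2 fun y hy => by simp [hn y hy]
      exact hx0 (by simpa using this hx)
    obtain ⟨c, hc⟩ := S.line σ y (hG σ y hy) hy0 x hx
    obtain ⟨β, u, hu, v, hv, hβ, rfl⟩ := hy
    exact ⟨β, c • u, (A β).smul_mem _ hu, v, hv, hβ, by rw [hc, smul_lie]⟩

theorem exists_triple (S : WeightSystem A h₀ l) : ∃ α e f, IsTriple A h₀ l α e f := by
  obtain ⟨β, u, hu, v, hv, hβ, h⟩ := S.exists_lie_eq S.l_zero S.mem S.ne_zero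
  rw [zero_sub] at hv
  obtain ⟨c, _, hc⟩ := S.exists_isTriple hβ hu hv (h ▸ S.ne_zero)
  exact ⟨β, u, _, hc⟩

end WeightSystem

end Roots

/-! ### Reflections and translations from exponentials -/

section Reflections

variable {Λ : Type u} [AddCommGroup Λ] {L : Type v} [LieRing L] [LieAlgebra ℂ L]

local notation "ad" => LieAlgebra.ad ℂ L

/-- The exponential of an ad-nilpotent element. -/
theorem exists_exp_ad {e : L} {N : ℕ} (hN : (ad e) ^ N = 0) :
    ∃ Φ : L ≃ₗ⁅ℂ⁆ L,
      (∀ x, Φ x = ∑ i ∈ Finset.range N, ((i.factorial : ℂ)⁻¹) • ((ad e) ^ i) x) ∧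
      ∀ x, Φ.symm x = ∑ i ∈ Finset.range N, ((i.factorial : ℂ)⁻¹) • ((-ad e) ^ i) x := by
  -- The coefficients `1/i!` of `LieDerivation.exp` are rational, so `L` is also viewed over `ℚ`.
  let _ : Module ℚ L := Module.compHom L (algebraMap ℚ ℂ)
  have hq : ∀ (q : ℚ) (x : L), q • x = (q : ℂ) • x := fun q x => by
    change (algebraMap ℚ ℂ q) • x = _
    simp
  let _ : LieAlgebra ℚ L := { lie_smul := fun q x y => by simp only [hq, lie_smul] }
  let D : LieDerivation ℂ L L := LieDerivation.ad ℂ L e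
  have hD : D.toLinearMap = ad e := by
    ext x
    simp [D]
  have hnil : IsNilpotent D.toLinearMap := ⟨N, by rw [hD, hN]⟩
  refine ⟨LieDerivation.exp D hnil, fun x => ?_, fun x => ?_⟩
  · rw [LieDerivation.exp_map_apply, IsNilpotent.exp_eq_sum (k := N) (by rw [hD, hN])]
    simp only [hD, LinearMap.sum_apply, LinearMap.smul_apply, hq]
    simp
  · change IsNilpotent.exp (-D.toLinearMap) x = _
    rw [IsNilpotent.exp_eq_sum (k := N) (by rw [hD, neg_pow, hN, mul_zero])]
    simp only [hD, LinearMap.sum_apply, LinearMap.smul_apply, hq]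
    simp

theorem sum_exp_eq {E : Module.End ℂ L} (N : ℕ) {x : L} (h : E (E (E x)) = 0) :
    ∑ i ∈ Finset.range (N + 3), ((i.factorial : ℂ)⁻¹) • (E ^ i) x =
      x + E x + (2⁻¹ : ℂ) • E (E x) := by
  have hz : ∀ i ∈ Finset.range (N + 3), i ∉ Finset.range 3 →
      ((i.factorial : ℂ)⁻¹) • (E ^ i) x = 0 := fun i _ hi => by
    obtain ⟨j, rfl⟩ := Nat.exists_eq_add_of_le' (not_lt.1 fun h => hi (Finset.mem_range.2 h))
    simp [pow_succ, h]
  rw [← Finset.sum_subset (Finset.range_mono (by omega)) hz]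
  simp [Finset.sum_range_succ, pow_two]

theorem sum_exp_mem {E : Module.End ℂ L} (N : ℕ) {K : Submodule ℂ L} (hK : ∀ x ∈ K, E x ∈ K)
    {x : L} (hx : x ∈ K) :
    ∑ i ∈ Finset.range N, ((i.factorial : ℂ)⁻¹) • (E ^ i) x ∈ K := by
  refine Submodule.sum_mem _ fun i _ => K.smul_mem _ ?_
  clear * - hK hx
  induction i with
  | zero => simpa using hx
  | succ i ih => rw [pow_succ']; exact hK _ ih

variable {A : Λ → Submodule ℂ L} {h₀ : L} {l : Λ → ℂ} {α : Λ} {e f : L}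

/-- The Weyl reflection `exp(ad e) exp(-ad f) exp(ad e)`. It negates weights and preserves strings,
and a string meets each weight once, which determines the new degree. -/
theorem IsTriple.exists_reflection (T : IsTriple A h₀ l α e f) (S : WeightSystem A h₀ l) :
    ∃ w : L ≃ₗ⁅ℂ⁆ L, w h₀ = -h₀ ∧
      (∀ ν, ∀ v ∈ A ν, ∀ k : ℤ, 2 * l ν = k * l α → w v ∈ A (ν - k • α)) ∧
      (∀ σ, l σ = 0 → ∀ x ∈ A σ, w x = x ∨ w x = -x) ∧
      ∀ x, ⁅e, x⁆ = 0 → ⁅f, x⁆ = 0 → w x = x := by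
  obtain ⟨N₁, hN₁⟩ := S.exists_pow_eq_zero T.e_mem T.l_ne_zero
  obtain ⟨N₂, hN₂⟩ := S.exists_pow_eq_zero T.f_mem (T.symm S).l_ne_zero
  set N := N₁ + N₂
  have hE : (ad e) ^ (N + 3) = 0 := pow_eq_zero_of_le (by omega) hN₁
  have hF : (ad f) ^ (N + 3) = 0 := pow_eq_zero_of_le (by omega) hN₂
  obtain ⟨Φ, hΦ, hΦ'⟩ := exists_exp_ad hE
  obtain ⟨Ψ, hΨ, hΨ'⟩ := exists_exp_ad hF
  have hl := T.l_ne_zero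
  have heh : ⁅e, h₀⁆ = -(l α • e) := by rw [← lie_skew, T.lie_h_e S]
  have hfh : ⁅f, h₀⁆ = l α • f := by rw [← lie_skew, T.lie_h_f S]; simp
  have hfe : ⁅f, e⁆ = -((2 / l α) • h₀) := by rw [← lie_skew, T.lie_e_f]
  have e1 : Φ h₀ = h₀ - l α • e := by
    rw [hΦ, sum_exp_eq _ (by simp [heh])]
    simp [heh, sub_eq_add_neg]
  have e2 : Φ e = e := by
    rw [hΦ, sum_exp_eq _ (by simp)]
    simp
  have f1 : Ψ.symm h₀ = h₀ - l α • f := by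
    rw [hΨ', sum_exp_eq _ (by simp [hfh])]
    simp [hfh, sub_eq_add_neg]
  have f2 : Ψ.symm e = e + (2 / l α) • h₀ - f := by
    rw [hΨ', sum_exp_eq _ (by simp [hfe, hfh])]
    simp only [LinearMap.neg_apply, LieAlgebra.ad_apply, hfe, neg_neg, lie_smul, hfh,
      smul_neg, smul_smul]
    rw [show (2⁻¹ * (2 / l α * l α) : ℂ) = 1 by field_simp, one_smul]
    abel
  let w : L ≃ₗ⁅ℂ⁆ L := (Φ.trans Ψ.symm).trans Φ
  have hw : ∀ x, w x = Φ (Ψ.symm (Φ x)) := fun x => rfl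
  have hwh : w h₀ = -h₀ := by
    rw [hw, e1, map_sub, map_smul, f1, f2]
    have : h₀ - l α • f - l α • (e + (2 / l α) • h₀ - f) = -h₀ - l α • e := by
      rw [smul_sub, smul_add, smul_smul, show l α * (2 / l α) = 2 by field_simp, two_smul]
      abel
    rw [this, map_sub, map_neg, map_smul, e1, e2]
    abel
  have hshift : ∀ ν, ∀ v ∈ A ν, ∀ k : ℤ, 2 * l ν = k * l α → w v ∈ A (ν - k • α) := by
    intro ν v hv k hk
    -- `w v` lies in the sum of the `B j` and has weight `-l ν`. Independence of the eigenspaces of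
    -- `ad h₀` leaves only `j = -k`.
    let B : ℤ → Submodule ℂ L := fun j => A (ν + j • α) ⊓
      Module.End.eigenspace (ad h₀) (l ν + j * l α)
    have hB : ∀ (a : L) (m : ℤ), a ∈ A (m • α) → ⁅h₀, a⁆ = (m * l α : ℂ) • a →
        ∀ x ∈ ⨆ j, B j, (ad a) x ∈ ⨆ j, B j := by
      intro a m ha hha x hx
      refine Submodule.iSup_induction B (motive := fun x => (ad a) x ∈ ⨆ j, B j) hx ?_ (by simp)
        (fun x y hx hy => by rw [map_add]; exact add_mem hx hy)
      rintro j x ⟨hx1, hx2⟩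
      refine Submodule.mem_iSup_of_mem (j + m) ⟨?_, ?_⟩
      · exact S.grading.lie_mem_of_eq ha hx1 (by rw [add_smul]; abel)
      · rw [SetLike.mem_coe, Module.End.mem_eigenspace_iff] at hx2 ⊢
        simp only [LieAlgebra.ad_apply] at hx2 ⊢
        rw [WeightSystem.weight_lie hha hx2]
        congr 1
        push_cast
        ring
    have hBe := hB e 1 (by simpa using T.e_mem) (by simpa using T.lie_h_e S)
    have hBf := hB f (-1) (by simpa using T.f_mem) (by simpa using T.lie_h_f S)
    have hBf' : ∀ x ∈ ⨆ j, B j, (-ad f) x ∈ ⨆ j, B j := fun x hx => by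
      rw [LinearMap.neg_apply]; exact neg_mem (hBf x hx)
    have hv' : v ∈ ⨆ j, B j := by
      refine Submodule.mem_iSup_of_mem 0 ⟨by simpa using hv, ?_⟩
      rw [SetLike.mem_coe, Module.End.mem_eigenspace_iff]
      simpa using S.lie ν v hv
    have hwv : w v ∈ ⨆ j, B j := by
      rw [hw, hΦ]
      refine sum_exp_mem _ hBe ?_
      rw [hΨ']
      refine sum_exp_mem _ hBf' ?_
      rw [hΦ]
      exact sum_exp_mem _ hBe hv'
    have hwe : w v ∈ Module.End.eigenspace (ad h₀) (-l ν) := by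
      rw [Module.End.mem_eigenspace_iff, LieAlgebra.ad_apply]
      have : ⁅w h₀, w v⁆ = l ν • w v := by rw [← LieEquiv.map_lie, S.lie ν v hv, map_smul]
      rw [hwh, neg_lie] at this
      rw [neg_smul, ← this, neg_neg]
    have hle : ⨆ j, B j ≤ B (-k) ⊔ ⨆ (c) (_ : c ≠ -l ν), Module.End.eigenspace (ad h₀) c := by
      refine iSup_le fun j => ?_
      by_cases hj : j = -k
      · rw [hj]; exact le_sup_left
      · refine le_trans ?_ le_sup_right
        refine le_trans inf_le_right (le_iSup₂_of_le (l ν + j * l α) ?_ le_rfl)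
        intro h
        apply hj
        have : (j : ℂ) * l α = (-k : ℤ) * l α := by
          push_cast
          linear_combination h - hk
        exact_mod_cast mul_right_cancel₀ hl this
    obtain ⟨b, hb, q, hq, hbq⟩ := Submodule.mem_sup.1 (hle hwv)
    have hb2 : b ∈ Module.End.eigenspace (ad h₀) (-l ν) := by
      have := hb.2
      rwa [show l ν + ((-k : ℤ) : ℂ) * l α = -l ν by push_cast; linear_combination hk] at this
    have hq0 : q = 0 := by
      refine Submodule.disjoint_def.1 (Module.End.eigenspaces_iSupIndep (ad h₀) (-l ν)) q ?_ hq
      have : q = w v - b := by rw [← hbq]; abel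
      rw [this]
      exact sub_mem hwe hb2
    have := hb.1
    rw [← hbq, hq0, add_zero]
    simpa [sub_eq_add_neg] using this
  refine ⟨w, hwh, hshift, ?_, ?_⟩
  · intro σ hσ x hx
    have hmem : w x ∈ A σ := by simpa using hshift σ x hx 0 (by simp [hσ])
    -- `φ` anticommutes with `ad e` and `ad f`, so `φ w = w⁻¹ φ`. In weight 0 it is the identity,
    -- whence `w² = 1` there, and `w = ±1` on a line.
    let φ := S.grading.diag fun ν => Complex.exp (Real.pi * Complex.I * (l ν / l α))
    have hφσ : ∀ y ∈ A σ, φ y = y := fun y hy => by simp [φ, S.grading.diag_apply _ hy, hσ]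
    have hanti : ∀ (a : L) (β : Λ), a ∈ A β → l β = l α ∨ l β = -l α →
        ∀ x, φ ((ad a) x) = (-ad a) (φ x) := by
      intro a β ha hβ
      have hexp : Complex.exp (Real.pi * Complex.I * (l β / l α)) = -1 := by
        rcases hβ with h | h
        · rw [h, div_self hl, mul_one, Complex.exp_pi_mul_I]
        · rw [h, neg_div, div_self hl, mul_neg, mul_one, Complex.exp_neg, Complex.exp_pi_mul_I]
          norm_num
      refine fun x => S.grading.linearMap_ext (φ := φ ∘ₗ ad a) (ψ := (-ad a) ∘ₗ φ) ?_ x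
      intro ν x hx
      simp only [LinearMap.comp_apply, LinearMap.neg_apply, LieAlgebra.ad_apply]
      by_cases h0 : ⁅a, x⁆ = 0
      · simp [φ, S.grading.diag_apply _ hx, h0]
      · rw [S.grading.diag_apply _ hx, S.grading.diag_apply _ (S.grading.lie_mem ha hx),
          S.l_add ha hx h0, lie_smul, add_div, mul_add, Complex.exp_add, hexp, ← neg_smul]
        congr 1
        ring
    have hpow : ∀ (E E' : Module.End ℂ L), (∀ x, φ (E x) = E' (φ x)) → ∀ (n : ℕ) (x : L),
        φ (∑ i ∈ Finset.range n, ((i.factorial : ℂ)⁻¹) • (E ^ i) x) =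
          ∑ i ∈ Finset.range n, ((i.factorial : ℂ)⁻¹) • (E' ^ i) (φ x) := by
      intro E E' h n x
      rw [map_sum]
      refine Finset.sum_congr rfl fun i _ => ?_
      rw [map_smul]
      congr 1
      clear * - h
      induction i with
      | zero => simp
      | succ i ih => rw [pow_succ', pow_succ', Module.End.mul_apply, Module.End.mul_apply, h, ih]
    have hφe := hanti e α T.e_mem (Or.inl rfl)
    have hφf := hanti f (-α) T.f_mem (Or.inr (T.l_neg S))
    have hφf' : ∀ x, φ ((-ad f) x) = (ad f) (φ x) := fun x => by
      rw [LinearMap.neg_apply, map_neg, hφf, LinearMap.neg_apply, neg_neg]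
    have c1 : ∀ x, φ (Φ x) = Φ.symm (φ x) := fun x => by rw [hΦ, hΦ', hpow _ _ hφe]
    have c2 : ∀ x, φ (Ψ.symm x) = Ψ (φ x) := fun x => by rw [hΨ, hΨ', hpow _ _ hφf']
    have hinv : w (w x) = x := by
      have h1 : φ (w x) = Φ.symm (Ψ (Φ.symm (φ x))) := by rw [hw, c1, c2, c1]
      rw [hφσ _ hmem, hφσ _ hx] at h1
      rw [h1, hw]
      simp
    by_cases hx0 : x = 0
    · left; simp [hx0]
    obtain ⟨c, hc⟩ := S.line σ x hx hx0 _ hmem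
    rw [hc, map_smul, hc, smul_smul] at hinv
    have hcc : c * c = 1 := smul_left_injective ℂ hx0 (by simpa using hinv)
    rcases mul_self_eq_one_iff.1 hcc with h | h
    · left; rw [hc, h, one_smul]
    · right; rw [hc, h, neg_one_smul]
  · intro x hex hfx
    have h1 : Φ x = x := by rw [hΦ, sum_exp_eq _ (by simp [hex])]; simp [hex]
    have h2 : Ψ.symm x = x := by rw [hΨ', sum_exp_eq _ (by simp [hfx])]; simp [hfx]
    rw [hw, h1, h2, h1]

/-- The product of two reflections with equal weights. -/
theorem IsTriple.exists_translation {α' : Λ} {e' f' : L} (T : IsTriple A h₀ l α e f)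
    (T' : IsTriple A h₀ l α' e' f') (S : WeightSystem A h₀ l) (hα : l α' = l α) :
    ∃ θ : L ≃ₗ⁅ℂ⁆ L, θ h₀ = h₀ ∧
      (∀ ν, ∀ v ∈ A ν, ∀ k : ℤ, 2 * l ν = k * l α → θ v ∈ A (ν + k • (α' - α))) ∧
      ∀ σ, l σ = 0 → ∀ x ∈ A σ, θ x = x ∨ θ x = -x := by
  obtain ⟨w, hw1, hw2, hw3, -⟩ := T.exists_reflection S
  obtain ⟨w', hw1', hw2', hw3', -⟩ := T'.exists_reflection S
  -- `w` subtracts `k α` and negates the weight, so `w'` then adds `k α'`.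
  refine ⟨w.trans w', ?_, ?_, ?_⟩
  · simp [LieEquiv.trans_apply, hw1, hw1']
  · intro ν v hv k hk
    rw [LieEquiv.trans_apply]
    by_cases hv0 : v = 0
    · simp [hv0]
    have h1 := hw2 ν v hv k hk
    have h2 : l (ν - k • α) = -l ν := by
      refine S.l_eq h1 (by simpa using hv0) ?_
      have : ⁅w h₀, w v⁆ = l ν • w v := by rw [← LieEquiv.map_lie, S.lie ν v hv, map_smul]
      rw [hw1, neg_lie] at this
      rw [neg_smul, ← this, neg_neg]
    have h3 := hw2' _ _ h1 (-k) (by rw [h2, hα]; push_cast; linear_combination -hk)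
    convert h3 using 2
    rw [smul_sub, neg_smul]
    abel
  · intro σ hσ x hx
    rw [LieEquiv.trans_apply]
    rcases hw3 σ hσ x hx with h | h <;> rcases hw3' σ hσ x hx with h' | h' <;> simp [h, h']

end Reflections

/-! ### Heisenberg pairs and their action on one triple -/

section Heisenberg

variable {Λ : Type u} [AddCommGroup Λ] {L : Type v} [LieRing L] [LieAlgebra ℂ L]
  {A : Λ → Submodule ℂ L} {h₀ : L} {l : Λ → ℂ}

local notation "ad" => LieAlgebra.ad ℂ L

/-- The square of a product of two reflections with equal weights. -/
theorem IsTriple.exists_double_translation {α α' : Λ} {e f e' f' : L} (T : IsTriple A h₀ l α e f)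
    (T' : IsTriple A h₀ l α' e' f') (S : WeightSystem A h₀ l) (hα : l α' = l α) :
    ∃ τ : L ≃ₗ⁅ℂ⁆ L,
      (∀ ν, ∀ v ∈ A ν, ∀ k : ℤ, 2 * l ν = k * l α → τ v ∈ A (ν + (2 * k) • (α' - α))) ∧
      ∀ σ, l σ = 0 → ∀ x ∈ A σ, τ x = x := by
  obtain ⟨θ, h1, h2, h3⟩ := T.exists_translation T' S hα
  -- Squaring removes the sign of `θ` in weight 0.
  refine ⟨θ.trans θ, fun ν v hv k hk => ?_, fun σ hσ x hx => ?_⟩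
  · rw [LieEquiv.trans_apply]
    by_cases hv0 : v = 0
    · simp [hv0]
    have h4 := h2 ν v hv k hk
    have h5 : l (ν + k • (α' - α)) = l ν := by
      refine S.l_eq h4 (by simpa using hv0) ?_
      rw [← map_smul, ← S.lie ν v hv, LieEquiv.map_lie, h1]
    convert h2 _ _ h4 k (by rw [h5, hk]) using 2
    rw [two_mul, add_smul]
    abel
  · rw [LieEquiv.trans_apply]
    rcases h3 σ hσ x hx with h | h <;> simp [h]

/-- A pair of homogeneous elements of opposite degrees and weight `0` with bracket `h₀`. -/
structure IsHeisenberg (A : Λ → Submodule ℂ L) (h₀ : L) (l : Λ → ℂ) (μ : Λ) (x y : L) :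
    Prop where
  l_eq_zero : l μ = 0
  x_mem : x ∈ A μ
  y_mem : y ∈ A (-μ)
  lie_x_y : ⁅x, y⁆ = h₀

namespace IsHeisenberg

variable {μ : Λ} {x y : L}

theorem lie_ne_zero (H : IsHeisenberg A h₀ l μ x y) (S : WeightSystem A h₀ l) : ⁅x, y⁆ ≠ 0 :=
  H.lie_x_y ▸ S.ne_zero

theorem x_ne_zero (H : IsHeisenberg A h₀ l μ x y) (S : WeightSystem A h₀ l) : x ≠ 0 :=
  fun h => H.lie_ne_zero S (by simp [h])

theorem y_ne_zero (H : IsHeisenberg A h₀ l μ x y) (S : WeightSystem A h₀ l) : y ≠ 0 :=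
  fun h => H.lie_ne_zero S (by simp [h])

theorem l_neg (H : IsHeisenberg A h₀ l μ x y) (S : WeightSystem A h₀ l) : l (-μ) = 0 := by
  rw [S.l_neg_of_lie_ne H.x_mem H.y_mem (H.lie_ne_zero S), H.l_eq_zero, neg_zero]

theorem symm (H : IsHeisenberg A h₀ l μ x y) (S : WeightSystem A h₀ l) :
    IsHeisenberg A h₀ l (-μ) y (-x) where
  l_eq_zero := H.l_neg S
  x_mem := H.y_mem
  y_mem := by simpa using H.x_mem
  lie_x_y := by rw [lie_neg, lie_skew, H.lie_x_y]

theorem lie_h_x (H : IsHeisenberg A h₀ l μ x y) (S : WeightSystem A h₀ l) : ⁅h₀, x⁆ = 0 := by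
  rw [S.lie _ _ H.x_mem, H.l_eq_zero, zero_smul]

theorem lie_h_y (H : IsHeisenberg A h₀ l μ x y) (S : WeightSystem A h₀ l) : ⁅h₀, y⁆ = 0 :=
  (H.symm S).lie_h_x S

theorem weight_pow (H : IsHeisenberg A h₀ l μ x y) (S : WeightSystem A h₀ l) {v : L} {c : ℂ}
    (hv : ⁅h₀, v⁆ = c • v) (n : ℕ) : ⁅h₀, ((ad x) ^ n) v⁆ = c • ((ad x) ^ n) v := by
  simpa using WeightSystem.weight_pow (a := 0) (by simpa using H.lie_h_x S) hv n

theorem lie_y_lie_x (H : IsHeisenberg A h₀ l μ x y) {v : L} {c : ℂ} (hv : ⁅h₀, v⁆ = c • v) :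
    ⁅y, ⁅x, v⁆⁆ = ⁅x, ⁅y, v⁆⁆ - c • v := by
  rw [leibniz_lie x, H.lie_x_y, hv]
  abel

/-- In weight `c` the pair satisfies the Weyl relation `[x, y] = c`, so each `ad x` lowers the
eigenvalue of `ad y ∘ ad x` by `c`. -/
theorem lie_pow (H : IsHeisenberg A h₀ l μ x y) (S : WeightSystem A h₀ l) {v : L} {a c : ℂ}
    (hv : ⁅h₀, v⁆ = c • v) (ha : ⁅y, ⁅x, v⁆⁆ = a • v) (n : ℕ) :
    ⁅y, ⁅x, ((ad x) ^ n) v⁆⁆ = (a - n * c) • ((ad x) ^ n) v := by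
  induction n with
  | zero => simpa using ha
  | succ n ih =>
    rw [pow_succ', Module.End.mul_apply, LieAlgebra.ad_apply,
      H.lie_y_lie_x (by simpa [pow_succ'] using H.weight_pow S hv (n + 1)), ih, lie_smul, ← sub_smul]
    congr 1
    push_cast
    ring

variable {α : Λ} {e f : L}

/-- If `x⁴ e` were nonzero, `τ e` would be a multiple of it. But `τ` fixes `x` and `y`, so `ad y ∘
ad x` has eigenvalue `a` on `τ e`, and it has `a - 4 l α` on `x⁴ e`. -/
theorem pow_four_eq_zero (H : IsHeisenberg A h₀ l μ x y) (S : WeightSystem A h₀ l)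
    (T : IsTriple A h₀ l α e f) {τ : L ≃ₗ⁅ℂ⁆ L} (hx : τ x = x) (hy : τ y = y)
    (he : τ e ∈ A (α + 4 • μ)) {a : ℂ} (ha : ⁅y, ⁅x, e⁆⁆ = a • e) : ((ad x) ^ 4) e = 0 := by
  by_contra h
  have h1 : ⁅y, ⁅x, τ e⁆⁆ = a • τ e := by
    rw [← map_smul, ← ha, LieEquiv.map_lie, LieEquiv.map_lie, hx, hy]
  obtain ⟨d, hd⟩ := S.line _ _ (S.pow_mem H.x_mem T.e_mem 4) h _ he
  have h2 : ⁅y, ⁅x, τ e⁆⁆ = (a - (4 : ℕ) * l α) • τ e := by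
    rw [hd, lie_smul, lie_smul, H.lie_pow S (T.lie_h_e S) ha 4, smul_comm]
  rw [h1] at h2
  have := smul_left_injective ℂ (by simpa using T.e_ne_zero S : τ e ≠ 0) h2
  refine T.l_ne_zero ?_
  push_cast at this
  linear_combination this / 4

/-- The degrees of `𝔰𝔩₂`-triples cannot differ by the degree of a Heisenberg pair. -/
theorem lie_eq_zero (H : IsHeisenberg A h₀ l μ x y) (S : WeightSystem A h₀ l)
    (T : IsTriple A h₀ l α e f) {p q : L} (hl : l (α + μ) = l α) (hp : p ∈ A (α + μ))
    (hq : q ∈ A (-(α + μ))) : ⁅p, q⁆ = 0 := by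
  classical
  by_contra hpq
  obtain ⟨c, _, T'⟩ := S.exists_isTriple (by rw [hl]; exact T.l_ne_zero) hp hq hpq
  obtain ⟨τ, hτ1, hτ2⟩ := T.exists_double_translation T' S hl
  obtain ⟨τ', hτ1', hτ2'⟩ := T'.exists_double_translation T S hl.symm
  obtain ⟨a, ha⟩ : ∃ a : ℂ, ⁅y, ⁅x, e⁆⁆ = a • e :=
    S.line _ _ T.e_mem (T.e_ne_zero S) _
      (S.grading.lie_mem_of_eq H.y_mem (S.grading.lie_mem H.x_mem T.e_mem) (by abel))
  -- The exponent is 4 because `τ` moves `e` by `2k μ` with `k = 2`.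
  have h4 : ((ad x) ^ 4) e = 0 := by
    refine H.pow_four_eq_zero S T (hτ2 _ H.l_eq_zero _ H.x_mem) (hτ2 _ (H.l_neg S) _ H.y_mem) ?_ ha
    convert hτ1 α e T.e_mem 2 (by norm_num) using 2
    rw [add_sub_cancel_left]
    norm_num
    exact_mod_cast (natCast_zsmul μ 4).symm
  have hex : ∃ n, ((ad x) ^ n) e = 0 := ⟨4, h4⟩
  obtain ⟨j, hj⟩ : ∃ j, Nat.find hex = j + 1 := by
    refine Nat.exists_eq_succ_of_ne_zero fun h => T.e_ne_zero S ?_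
    simpa [h] using Nat.find_spec hex
  have hj1 : ((ad x) ^ (j + 1)) e = 0 := hj ▸ Nat.find_spec hex
  have hj2 : ((ad x) ^ j) e ≠ 0 := Nat.find_min hex (by omega)
  have haj : a = j * l α := by
    have h := H.lie_pow S (T.lie_h_e S) ha j
    have h0 : ⁅x, ((ad x) ^ j) e⁆ = 0 := by
      rw [← hj1, pow_succ', Module.End.mul_apply, LieAlgebra.ad_apply]
    rw [h0, lie_zero, eq_comm, smul_eq_zero, or_iff_left hj2] at h
    linear_combination h
  have ha' : ⁅-x, ⁅y, e⁆⁆ = (-((j + 1) * l α)) • e := by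
    rw [neg_lie, neg_smul, leibniz_lie, H.lie_x_y, ha, T.lie_h_e S, haj, ← add_smul]
    congr 2
    ring
  -- Since the `ad x`-string of `e` stops, `a` is a natural multiple of `l α`, and then the `ad
  -- y`-string cannot stop. The translation `τ'` in the other direction requires that it does.
  have hne : ∀ n : ℕ, ((ad y) ^ n) e ≠ 0 := by
    intro n
    induction n with
    | zero => simpa using T.e_ne_zero S
    | succ n ih =>
      intro h0
      have h := (H.symm S).lie_pow S (T.lie_h_e S) ha' n
      have h0' : ⁅y, ((ad y) ^ n) e⁆ = 0 := by
        rw [← h0, pow_succ', Module.End.mul_apply, LieAlgebra.ad_apply]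
      rw [h0', lie_zero, eq_comm, smul_eq_zero, or_iff_left ih] at h
      have h6 : ((j + 1 + n : ℕ) : ℂ) * l α = 0 := by push_cast; linear_combination -h
      rcases mul_eq_zero.1 h6 with h7 | h7
      · exact absurd (Nat.cast_eq_zero.1 h7) (by omega)
      · exact T.l_ne_zero h7
  refine hne 4 ((H.symm S).pow_four_eq_zero S T (hτ2' _ (H.l_neg S) _ H.y_mem) ?_ ?_ ha')
  · rw [map_neg, hτ2' _ H.l_eq_zero _ H.x_mem]
  · convert hτ1' α e T.e_mem 2 (by rw [hl]; norm_num) using 2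
    rw [sub_add_cancel_left]
    norm_num
    exact_mod_cast (natCast_zsmul μ 4).symm

/-- Of the two elements of a Heisenberg pair one commutes with a given `𝔰𝔩₂`-triple and the other
one generates its adjoint representation. -/
theorem triple_cases (H : IsHeisenberg A h₀ l μ x y) (S : WeightSystem A h₀ l)
    (T : IsTriple A h₀ l α e f) :
    (⁅e, y⁆ = 0 ∧ ⁅f, y⁆ = 0 ∧ ⁅e, x⁆ ≠ 0 ∧ ⁅e, ⁅f, x⁆⁆ = (2 : ℂ) • x ∧ ((ad e) ^ 2) x = 0) ∨
    (⁅e, x⁆ = 0 ∧ ⁅f, x⁆ = 0 ∧ ⁅e, y⁆ ≠ 0 ∧ ⁅e, ⁅f, y⁆⁆ = (2 : ℂ) • y ∧ ((ad e) ^ 2) y = 0) := by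
  have hl := T.l_ne_zero
  have h1 : ⁅⁅e, x⁆, ⁅f, y⁆⁆ = 0 := by
    by_cases h0 : ⁅e, x⁆ = 0
    · simp [h0]
    · refine H.lie_eq_zero S T ?_ (S.grading.lie_mem T.e_mem H.x_mem)
        (S.grading.lie_mem_of_eq T.f_mem H.y_mem (by abel))
      rw [S.l_add T.e_mem H.x_mem h0, H.l_eq_zero, add_zero]
  have h2 : ⁅⁅e, y⁆, ⁅f, x⁆⁆ = 0 := by
    by_cases h0 : ⁅e, y⁆ = 0
    · simp [h0]
    · refine (H.symm S).lie_eq_zero S T ?_ (S.grading.lie_mem T.e_mem H.y_mem)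
        (S.grading.lie_mem_of_eq T.f_mem H.x_mem (by abel))
      rw [S.l_add T.e_mem H.y_mem h0, H.l_neg S, add_zero]
  obtain ⟨n, n', hn, hn1, hn2, hn3, hn4, hn5, hn6⟩ := T.exists_string S H.x_mem (H.x_ne_zero S)
  obtain ⟨m, m', hm, hm1, hm2, hm3, hm4, hm5, hm6⟩ := T.exists_string S H.y_mem (H.y_ne_zero S)
  rw [H.l_eq_zero, mul_zero, zero_div, eq_comm, sub_eq_zero, Nat.cast_inj] at hn
  rw [H.l_neg S, mul_zero, zero_div, eq_comm, sub_eq_zero, Nat.cast_inj] at hm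
  subst hn hm
  obtain ⟨a, ha⟩ : ∃ a : ℂ, ⁅x, ⁅y, e⁆⁆ = a • e :=
    S.line _ _ T.e_mem (T.e_ne_zero S) _
      (S.grading.lie_mem_of_eq H.x_mem (S.grading.lie_mem H.y_mem T.e_mem) (by abel))
  obtain ⟨b, hb⟩ : ∃ b : ℂ, ⁅y, ⁅x, e⁆⁆ = b • e :=
    S.line _ _ T.e_mem (T.e_ne_zero S) _
      (S.grading.lie_mem_of_eq H.y_mem (S.grading.lie_mem H.x_mem T.e_mem) (by abel))
  have hab : a = l α + b := by
    rw [leibniz_lie, H.lie_x_y, hb, T.lie_h_e S, ← add_smul] at ha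
    exact (smul_left_injective ℂ (T.e_ne_zero S) ha).symm
  have hfe : ⁅f, e⁆ = -((2 / l α) • h₀) := by rw [← lie_skew, T.lie_e_f]
  have hyx : ⁅y, x⁆ = -h₀ := by rw [← lie_skew, H.lie_x_y]
  have h3 : ((n + 1) * n : ℂ) = -(2 / l α * b) := by
    have e1 : ⁅⁅e, x⁆, y⁆ = b • e := by rw [← lie_skew, ← lie_neg, lie_skew, hb]
    rw [leibniz_lie, e1, ← lie_skew ⁅e, x⁆ f, hn1, neg_lie, smul_lie, H.lie_x_y, lie_smul, hfe, smul_neg,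
      smul_smul, ← neg_add, neg_eq_zero, ← add_smul, smul_eq_zero, or_iff_left S.ne_zero] at h1
    linear_combination h1
  have h4 : ((m + 1) * m : ℂ) = 2 / l α * a := by
    have e1 : ⁅⁅e, y⁆, x⁆ = a • e := by rw [← lie_skew, ← lie_neg, lie_skew, ha]
    rw [leibniz_lie, e1, ← lie_skew ⁅e, y⁆ f, hm1, neg_lie, smul_lie, hyx, lie_smul, hfe, smul_neg,
      smul_neg, neg_neg, smul_smul, ← sub_eq_add_neg, ← sub_smul, smul_eq_zero,
      or_iff_left S.ne_zero] at h2
    linear_combination h2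
  -- In weight 0 strings are symmetric, with half-lengths `n` for `x` and `m` for `y`. The relation
  -- `a - b = l α` fixes the sum of the two eigenvalues, so one half-length is 1 and the other 0.
  have h5 : ((n + 1) * n : ℂ) + (m + 1) * m = 2 := by
    rw [h3, h4, hab]
    field_simp
    ring
  have h6 : (n + 1) * n + (m + 1) * m = 2 := by exact_mod_cast h5
  have hn7 : n ≤ 1 := by nlinarith
  have hm7 : m ≤ 1 := by nlinarith
  interval_cases n <;> interval_cases m <;> simp at h6
  · right
    refine ⟨by simpa using hn6, by simpa using hn4, by simpa using hm5, ?_, by simpa using hm6⟩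
    rw [hm2]; norm_num
  · left
    refine ⟨by simpa using hm6, by simpa using hm4, by simpa using hn5, ?_, by simpa using hn6⟩
    rw [hn2]; norm_num

/-- Write `x = [u, v]` with nonzero weights. By Jacobi, `[[u, v], y] ≠ 0` puts `u` or `v` into a
triple. The other factor has the opposite weight, so its string can be raised twice, and the first
raising is `±x`. -/
theorem exists_triple (H : IsHeisenberg A h₀ l μ x y) (S : WeightSystem A h₀ l) :
    ∃ α e f, IsTriple A h₀ l α e f ∧ ⁅e, x⁆ ≠ 0 := by
  obtain ⟨β, u, hu, v, hv, hβ, huv⟩ := S.exists_lie_eq H.l_eq_zero H.x_mem (H.x_ne_zero S)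
  have main : ∀ β, ∀ u ∈ A β, ∀ v ∈ A (μ - β), l β ≠ 0 → ⁅u, ⁅v, y⁆⁆ ≠ 0 → ⁅u, v⁆ ≠ 0 →
      ∃ α e f, IsTriple A h₀ l α e f ∧ ⁅e, x⁆ ≠ 0 := by
    intro β u hu v hv hβ h huv
    obtain ⟨c, _, T⟩ := S.exists_isTriple hβ hu
      (S.grading.lie_mem_of_eq hv H.y_mem (by abel)) h
    refine ⟨β, u, _, T, ?_⟩
    have hv0 : v ≠ 0 := fun h0 => huv (by simp [h0])
    obtain ⟨d, hd⟩ := S.line _ _ H.x_mem (H.x_ne_zero S) ⁅u, v⁆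
      (S.grading.lie_mem_of_eq hu hv (by abel))
    have hlv : l (μ - β) = -l β := by
      have := S.l_add_of_eq hu hv huv (γ := μ) (by abel)
      rw [H.l_eq_zero] at this
      linear_combination -this
    obtain ⟨n, m, hnm, -, -, -, -, hm, -⟩ := T.exists_string S hv hv0
    have hm2 : m = n + 2 := by
      rw [hlv, mul_neg, neg_div, mul_div_assoc, div_self hβ] at hnm
      have : (m : ℂ) = (n + 2 : ℕ) := by push_cast; linear_combination hnm
      exact_mod_cast this
    intro h0
    apply hm
    rw [hm2, pow_add, Module.End.mul_apply, pow_two, Module.End.mul_apply, LieAlgebra.ad_apply,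
      LieAlgebra.ad_apply, hd, lie_smul, h0]
    simp
  have hx0 : ⁅u, v⁆ ≠ 0 := huv ▸ H.x_ne_zero S
  by_cases h : ⁅u, ⁅v, y⁆⁆ = 0
  · have h2 : ⁅v, ⁅u, y⁆⁆ ≠ 0 := by
      intro h2
      refine H.lie_ne_zero S ?_
      rw [← huv, lie_lie, h, h2, sub_zero]
    have hlv : l (μ - β) = -l β := by
      have := S.l_add_of_eq hu hv hx0 (γ := μ) (by abel)
      rw [H.l_eq_zero] at this
      linear_combination -this
    refine main _ v hv u (by simpa using hu) (by rw [hlv]; exact neg_ne_zero.2 hβ) h2 ?_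
    rw [← lie_skew]
    exact neg_ne_zero.2 hx0
  · exact main β u hu v hv hβ h hx0

end IsHeisenberg

end Heisenberg

/-! ### A Heisenberg pair against two triples -/

section NoHeisenberg

variable {Λ : Type u} [AddCommGroup Λ] {L : Type v} [LieRing L] [LieAlgebra ℂ L]
  {A : Λ → Submodule ℂ L} {h₀ : L} {l : Λ → ℂ}

local notation "ad" => LieAlgebra.ad ℂ L

theorem eq_zero_of_eq_neg_self {x : L} (h : x = -x) : x = 0 := by
  have h2 : (2 : ℂ) • x = 0 := by rw [two_smul, eq_neg_iff_add_eq_zero.1 h]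
  exact (smul_eq_zero.1 h2).resolve_left two_ne_zero

theorem weight_map {θ : L ≃ₗ⁅ℂ⁆ L} (hθ : θ h₀ = h₀) {v : L} {c : ℂ} (hv : ⁅h₀, v⁆ = c • v) :
    ⁅h₀, θ v⁆ = c • θ v := by
  rw [← map_smul, ← hv, LieEquiv.map_lie, hθ]

namespace IsHeisenberg

variable {μ : Λ} {x y : L} {α α' : Λ} {e f e' f' : L}

/-- Here `e` is a vacuum vector of the Weyl algebra: `ad y` kills it, so no power of `ad x` does. -/
theorem pow_ne_zero_of_lie_eq_zero (H : IsHeisenberg A h₀ l μ x y) (S : WeightSystem A h₀ l)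
    (T : IsTriple A h₀ l α e f) (hy : ⁅e, y⁆ = 0) (n : ℕ) :
    ((ad x) ^ n) e ≠ 0 ∧ ⁅y, ⁅x, ((ad x) ^ n) e⁆⁆ = (-l α - n * l α) • ((ad x) ^ n) e := by
  have hye : ⁅y, e⁆ = 0 := by rw [← lie_skew, hy, neg_zero]
  have key := H.lie_pow S (T.lie_h_e S) (a := -l α)
    (by rw [H.lie_y_lie_x (T.lie_h_e S), hye]; simp)
  refine ⟨?_, key n⟩
  induction n with
  | zero => simpa using T.e_ne_zero S
  | succ n ih =>
    intro h
    have h0 : ⁅x, ((ad x) ^ n) e⁆ = 0 := by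
      rw [← h, pow_succ', Module.End.mul_apply, LieAlgebra.ad_apply]
    have h1 := key n
    rw [h0, lie_zero, eq_comm, smul_eq_zero, or_iff_left ih] at h1
    have h2 : ((n + 1 : ℕ) : ℂ) * l α = 0 := by push_cast; linear_combination -h1
    rcases mul_eq_zero.1 h2 with h3 | h3
    · exact absurd (Nat.cast_eq_zero.1 h3) (by omega)
    · exact T.l_ne_zero h3

theorem weight_lie_x (H : IsHeisenberg A h₀ l μ x y) (S : WeightSystem A h₀ l) {v : L} {c : ℂ}
    (hv : ⁅h₀, v⁆ = c • v) : ⁅h₀, ⁅x, v⁆⁆ = c • ⁅x, v⁆ := by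
  rw [leibniz_lie, H.lie_h_x S, hv, lie_smul, zero_lie, zero_add]

theorem weight_lie_y (H : IsHeisenberg A h₀ l μ x y) (S : WeightSystem A h₀ l) {v : L} {c : ℂ}
    (hv : ⁅h₀, v⁆ = c • v) : ⁅h₀, ⁅y, v⁆⁆ = c • ⁅y, v⁆ :=
  (H.symm S).weight_lie_x S hv

/-- `ad f` sends `z` into the line of `y`, which `ad e` kills; but `ad e ∘ ad f` is nonzero on a
nonzero vector of weight `l α`. -/
theorem eq_zero_of_weight (H : IsHeisenberg A h₀ l μ x y) (S : WeightSystem A h₀ l)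
    (T : IsTriple A h₀ l α e f) (hy : ⁅e, y⁆ = 0) {z : L} (hz : z ∈ A (α - μ))
    (hw : ⁅h₀, z⁆ = l α • z) : z = 0 := by
  by_contra hz0
  obtain ⟨c, hc⟩ := S.line _ _ H.y_mem (H.y_ne_zero S) ⁅f, z⁆
    (S.grading.lie_mem_of_eq T.f_mem hz (by abel))
  obtain ⟨n, m, hnm, -, h, -⟩ := T.exists_string S hz hz0
  rw [hc, lie_smul, hy, smul_zero, eq_comm, smul_eq_zero, or_iff_left hz0] at h
  rw [S.l_eq hz hz0 hw, mul_div_assoc, div_self T.l_ne_zero] at hnm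
  have h1 : (n : ℂ) = (m + 2 : ℕ) := by push_cast; linear_combination -hnm
  have h2 : n = m + 2 := by exact_mod_cast h1
  have h3 : (((m + 1) * n : ℕ) : ℂ) = 0 := by exact_mod_cast h
  have h4 := Nat.cast_eq_zero.1 h3
  rw [h2] at h4
  simp at h4

/-- In a module over the Weyl algebra no nonzero vector is killed by the squares of both
generators. -/
theorem eq_zero_of_sq (H : IsHeisenberg A h₀ l μ x y) (S : WeightSystem A h₀ l) {v : L} {c : ℂ}
    (hc : c ≠ 0) (hv : ⁅h₀, v⁆ = c • v) (hx : ⁅x, ⁅x, v⁆⁆ = 0) (hy : ⁅y, ⁅y, v⁆⁆ = 0) : v = 0 := by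
  have comm : ∀ u : L, ⁅h₀, u⁆ = c • u → ⁅x, ⁅y, u⁆⁆ = ⁅y, ⁅x, u⁆⁆ + c • u := fun u hu => by
    rw [H.lie_y_lie_x hu, sub_add_cancel]
  set r := ⁅y, ⁅x, v⁆⁆ with hr
  have h1 : ⁅x, ⁅y, v⁆⁆ = r + c • v := comm v hv
  have h2 : ⁅y, r⁆ = -(2 * c) • ⁅y, v⁆ := by
    have := comm _ (H.weight_lie_y S hv)
    rw [hy, lie_zero, h1, lie_add, lie_smul, add_assoc, ← two_smul ℂ (c • ⁅y, v⁆), smul_smul] at this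
    rw [neg_smul, eq_neg_iff_add_eq_zero, ← this]
  have h3 : ⁅x, r⁆ = c • ⁅x, v⁆ := by
    rw [hr, comm _ (H.weight_lie_x S hv), hx, lie_zero, zero_add]
  -- The Weyl relation applied to `r` itself, with `[x, r]` and `[y, r]` already known. The
  -- resulting eigenvalue contradicts `h3` unless `[x, v] = 0`.
  have h4 : r = (-(c / 2)) • v := by
    have := comm r (H.weight_lie_y S (H.weight_lie_x S hv))
    rw [h2, h3, lie_smul, lie_smul, h1, ← hr, smul_add, smul_smul] at this
    have h5 : (4 * c) • r = (-(2 * c * c)) • v := by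
      have e1 : (c • r + c • r) + (2 * c) • r = (4 * c) • r := by module
      rw [← e1, ← this]
      module
    have : r = (4 * c)⁻¹ • ((4 * c) • r) := by
      rw [smul_smul, inv_mul_cancel₀ (by simpa using hc), one_smul]
    rw [this, h5, smul_smul]
    congr 1
    field_simp
    ring
  have h5 : ⁅x, v⁆ = 0 := by
    rw [h4, lie_smul] at h3
    have : (c + c / 2) • ⁅x, v⁆ = 0 := by rw [add_smul, ← h3, ← add_smul]; simp
    refine (smul_eq_zero.1 this).resolve_left ?_
    intro h
    exact hc (by linear_combination 2 / 3 * h)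
  rw [hr, h5, lie_zero, eq_comm, smul_eq_zero] at h4
  exact h4.resolve_left (by simpa using hc)

/-- The test vector is `E = [x, e]`. A translation carries `Z² E` to degree `α - μ`, where
`eq_zero_of_weight` kills it, so `W² E ≠ 0` by `eq_zero_of_sq`. The opposite translation carries `W²
E` into the line of `x³ e`; but `ad y` kills `W² E` and does not kill `x³ e`. -/
theorem false_of_second_pair (H : IsHeisenberg A h₀ l μ x y) (S : WeightSystem A h₀ l)
    (T : IsTriple A h₀ l α e f) (T' : IsTriple A h₀ l α' e' f') (hl : l α' = l α)
    (hy : ⁅e, y⁆ = 0) {W Z : L} (H' : IsHeisenberg A h₀ l (μ + (α' - α)) W Z)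
    (heW : ⁅e, W⁆ = 0) (hyW : ⁅y, W⁆ = 0) : False := by
  obtain ⟨θ, hθ1, hθ2, hθ3⟩ := T.exists_translation T' S hl
  obtain ⟨θ', hθ1', hθ2', hθ3'⟩ := T'.exists_translation T S hl.symm
  have hWe : ⁅W, e⁆ = 0 := by rw [← lie_skew, heW, neg_zero]
  obtain ⟨h1, h1'⟩ := H.pow_ne_zero_of_lie_eq_zero S T hy 1
  have hE := H.weight_pow S (T.lie_h_e S) 1
  have hEm := S.pow_mem H.x_mem T.e_mem 1
  have hyE : ⁅y, ((ad x) ^ 1) e⁆ = -l α • e := by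
    simpa using (H.pow_ne_zero_of_lie_eq_zero S T hy 0).2
  set E := ((ad x) ^ 1) e with hEdef
  have hZ : ⁅Z, ⁅Z, E⁆⁆ = 0 := by
    have hw : ⁅h₀, ⁅Z, ⁅Z, E⁆⁆⁆ = l α • ⁅Z, ⁅Z, E⁆⁆ := 
      H'.weight_lie_y S (H'.weight_lie_y S hE)
    have hm : ⁅Z, ⁅Z, E⁆⁆ ∈ A (α - μ - (2 : ℤ) • (α' - α)) :=
      S.grading.lie_mem_of_eq H'.y_mem (S.grading.lie_mem H'.y_mem hEm) (by
        rw [two_smul, one_smul]; abel)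
    by_contra h0
    have hlν := S.l_eq hm h0 hw
    have h2 := hθ2 _ _ hm 2 (by rw [hlν]; norm_num)
    rw [sub_add_cancel] at h2
    have h3 := H.eq_zero_of_weight S T hy h2 (weight_map hθ1 hw)
    exact h0 (by simpa using h3)
  have hW : ⁅W, ⁅W, E⁆⁆ ≠ 0 := fun h => h1 (H'.eq_zero_of_sq S T.l_ne_zero hE h hZ)
  have hyg : ⁅y, ⁅W, ⁅W, E⁆⁆⁆ = 0 := by
    rw [leibniz_lie, hyW, zero_lie, zero_add, leibniz_lie y, hyW, zero_lie, zero_add, hyE, lie_smul,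
      hWe, smul_zero, lie_zero]
  have hw : ⁅h₀, ⁅W, ⁅W, E⁆⁆⁆ = l α • ⁅W, ⁅W, E⁆⁆ := 
    H'.weight_lie_x S (H'.weight_lie_x S hE)
  have hm := S.grading.lie_mem H'.x_mem (S.grading.lie_mem H'.x_mem hEm)
  have h2 := hθ2' _ _ hm 2 (by rw [S.l_eq hm hW hw, hl]; norm_num)
  obtain ⟨h3, -⟩ := H.pow_ne_zero_of_lie_eq_zero S T hy 3
  obtain ⟨h4, h4'⟩ := H.pow_ne_zero_of_lie_eq_zero S T hy 2
  obtain ⟨d, hd⟩ := S.line _ _ (S.pow_mem H.x_mem T.e_mem 3) h3 (θ' ⁅W, ⁅W, E⁆⁆) (by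
    convert h2 using 2
    simp only [two_smul, one_smul, succ_nsmul]
    abel)
  have hd0 : d ≠ 0 := by
    rintro rfl
    exact hW (by simpa using hd)
  have h5 : ⁅y, θ' ⁅W, ⁅W, E⁆⁆⁆ = 0 := by
    have h6 : ⁅θ' y, θ' ⁅W, ⁅W, E⁆⁆⁆ = 0 := by rw [← LieEquiv.map_lie, hyg, map_zero]
    rcases hθ3' _ (H.l_neg S) y H.y_mem with h | h
    · rwa [h] at h6
    · rwa [h, neg_lie, neg_eq_zero] at h6
  have h6 : ⁅y, ((ad x) ^ 3) e⁆ = (-l α - (2 : ℕ) * l α) • ((ad x) ^ 2) e := by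
    rw [← h4', pow_succ' (ad x) 2, Module.End.mul_apply, LieAlgebra.ad_apply]
  rw [hd, lie_smul, h6, smul_smul, smul_eq_zero, or_iff_left h4, mul_eq_zero, or_iff_right hd0] at h5
  refine T.l_ne_zero ?_
  push_cast at h5
  linear_combination -h5 / 3

/-- Raising and lowering between the two triples yields `Y`, `V`, `Z` of weight 0, and `W = [x, Y]`
with `Z` is, up to a scalar, a second Heisenberg pair. `triple_cases` for it leaves only `e` killing
`W`. For `j = 2` the string of `v` is then too long; for `j = 1` `false_of_second_pair` applies. -/
theorem false_of_triples (H : IsHeisenberg A h₀ l μ x y) (S : WeightSystem A h₀ l)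
    (T : IsTriple A h₀ l α e f) (T' : IsTriple A h₀ l α' e' f') (hy : ⁅e, y⁆ = 0)
    (hx' : ⁅e', x⁆ = 0) {j : ℕ} (hj : j = 1 ∨ j = 2) (hl : l α' = j * l α) : False := by
  have hlα := T.l_ne_zero
  obtain ⟨hfy, hex⟩ : ⁅f, y⁆ = 0 ∧ ⁅e, x⁆ ≠ 0 := by
    rcases H.triple_cases S T with h | h
    · exact ⟨h.2.1, h.2.2.1⟩
    · exact absurd hy h.2.2.1
  have hye : ⁅y, e⁆ = 0 := by rw [← lie_skew, hy, neg_zero]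
  have hye' : ⁅e', ⁅y, f'⁆⁆ = (-2 : ℂ) • y := by
    rcases H.triple_cases S T' with h | h
    · exact absurd hx' h.2.2.1
    · rw [← lie_skew y f', lie_neg, h.2.2.2.1, neg_smul]
  set v := ⁅y, f'⁆ with hv
  have hvm : v ∈ A (-α' - μ) := S.grading.lie_mem_of_eq H.y_mem T'.f_mem (by abel)
  have hv0 : v ≠ 0 := by
    intro h
    rw [h, lie_zero, eq_comm, smul_eq_zero] at hye'
    exact H.y_ne_zero S (hye'.resolve_left (by norm_num))
  have hvw : ⁅h₀, v⁆ = (-l α') • v := by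
    rw [hv, leibniz_lie, H.lie_h_y S, T'.lie_h_f S]; simp
  have hlv := S.l_eq hvm hv0 hvw
  -- By `eq_zero_of_weight` the bracket `[a, b]` vanishes, so `ad f` moves from one factor to the
  -- other with a sign.
  have transfer : ∀ a b : L, ⁅a, b⁆ ∈ A (α - μ) → ⁅h₀, ⁅a, b⁆⁆ = l α • ⁅a, b⁆ →
      ⁅⁅f, a⁆, b⁆ = -⁅a, ⁅f, b⁆⁆ := fun a b h1 h2 => by
    have := H.eq_zero_of_weight S T hy h1 h2
    rw [lie_lie, this, lie_zero, zero_sub]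
  obtain ⟨n, m, hnm, hfe, -, -, -, hm, -⟩ := T.exists_string S hvm hv0
  have hmn : m = n + 2 * j := by
    rw [hlv, hl] at hnm
    have : (m : ℂ) = (n + 2 * j : ℕ) := by
      push_cast
      field_simp at hnm
      linear_combination hnm
    exact_mod_cast this
  -- The weight of `v` is `-j l α`, so its string can be raised at least `2j` times.
  have hpow : ∀ i, i ≤ 2 * j → ((ad e) ^ i) v ≠ 0 := by
    intro i hi h0
    apply hm
    obtain ⟨k, hk⟩ := Nat.exists_eq_add_of_le' (show i ≤ m by omega)
    rw [hk, pow_add, Module.End.mul_apply, h0, map_zero]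
  set Y := ((ad f) ^ j) e' with hY
  set V := ((ad e) ^ j) f' with hV
  set Z := ((ad e) ^ j) v with hZ
  have hYm : Y ∈ A (α' - j • α) := by
    have := S.pow_mem T.f_mem T'.e_mem j
    rwa [smul_neg, ← sub_eq_add_neg] at this
  have hVm : V ∈ A (-α' + j • α) := S.pow_mem T.e_mem T'.f_mem j
  have hZm : Z ∈ A (-α' - μ + j • α) := S.pow_mem T.e_mem hvm j
  have hYw : ⁅h₀, Y⁆ = 0 := by
    rw [hY, WeightSystem.weight_pow (T.lie_h_f S) (T'.lie_h_e S), hl]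
    simp
  have hVw : ⁅h₀, V⁆ = 0 := by
    rw [hV, WeightSystem.weight_pow (T.lie_h_e S) (T'.lie_h_f S), hl]
    simp
  have hZV : Z = ⁅y, V⁆ := by
    have : ∀ u : L, ⁅y, ⁅e, u⁆⁆ = ⁅e, ⁅y, u⁆⁆ := fun u => by rw [leibniz_lie, hye]; simp
    rcases hj with rfl | rfl <;> simp [hZ, hV, pow_two, this, hv]
  obtain ⟨c, hc0, hYZ⟩ : ∃ c : ℂ, c ≠ 0 ∧ ⁅Y, Z⁆ = c • y := by
    have hd0 : ((n + 1) * m : ℂ) ≠ 0 := by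
      have : (((n + 1) * m : ℕ) : ℂ) ≠ 0 := Nat.cast_ne_zero.2
        (Nat.mul_ne_zero (by omega) (by omega))
      exact_mod_cast this
    have hev : ⁅h₀, ⁅e, v⁆⁆ = (l α - l α') • ⁅e, v⁆ := by
      rw [WeightSystem.weight_lie (T.lie_h_e S) hvw, sub_eq_add_neg]
    have t1 : ⁅⁅f, e'⁆, ⁅e, v⁆⁆ = (2 * ((n + 1) * m) : ℂ) • y := by
      rw [transfer _ _ (S.grading.lie_mem_of_eq T'.e_mem (S.grading.lie_mem T.e_mem hvm) (by abel))
        (by rw [WeightSystem.weight_lie (T'.lie_h_e S) hev]; congr 1; ring), hfe, lie_smul, hye',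
        smul_smul, ← neg_smul]
      congr 1
      ring
    rcases hj with rfl | rfl
    · exact ⟨_, mul_ne_zero two_ne_zero hd0, by simpa [hY, hZ] using t1⟩
    · have hev0 : ⁅e, v⁆ ≠ 0 := by simpa using hpow 1 (by omega)
      have hevm := S.grading.lie_mem T.e_mem hvm
      obtain ⟨n', m', hnm', hfe', -⟩ := T.exists_string S hevm hev0
      have hmn' : m' = n' + 2 := by
        rw [S.l_eq hevm hev0 hev, hl] at hnm'
        have : (m' : ℂ) = (n' + 2 : ℕ) := by
          push_cast at hnm' ⊢
          field_simp at hnm'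
          linear_combination hnm'
        exact_mod_cast this
      have hd0' : ((n' + 1) * m' : ℂ) ≠ 0 := by
        have : (((n' + 1) * m' : ℕ) : ℂ) ≠ 0 := Nat.cast_ne_zero.2
          (Nat.mul_ne_zero (by omega) (by omega))
        exact_mod_cast this
      refine ⟨_, neg_ne_zero.2 (mul_ne_zero hd0' (mul_ne_zero two_ne_zero hd0)), ?_⟩
      have : ⁅⁅f, ⁅f, e'⁆⁆, ⁅e, ⁅e, v⁆⁆⁆ = _ := transfer _ _
        (S.grading.lie_mem_of_eq (S.grading.lie_mem T.f_mem T'.e_mem)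
          (S.grading.lie_mem T.e_mem hevm) (by abel))
        (by
          rw [WeightSystem.weight_lie (WeightSystem.weight_lie (T.lie_h_f S) (T'.lie_h_e S))
            (WeightSystem.weight_lie (T.lie_h_e S) hev)]
          congr 1
          ring)
      rw [hfe', lie_smul, t1, smul_smul, ← neg_smul] at this
      simpa [hY, hZ, pow_two] using this
  have hYZ0 : ⁅Y, Z⁆ ≠ 0 := by rw [hYZ]; exact smul_ne_zero hc0 (H.y_ne_zero S)
  have hY0 : Y ≠ 0 := fun h => hYZ0 (by simp [h])
  have hZ0 : Z ≠ 0 := fun h => hYZ0 (by simp [h])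
  have hV0 : V ≠ 0 := fun h => hZ0 (by simp [hZV, h])
  have hlY : l (α' - j • α) = 0 := S.l_eq hYm hY0 (by simpa using hYw)
  have hlV : l (-α' + j • α) = 0 := S.l_eq hVm hV0 (by simpa using hVw)
  -- Signs of the reflection: `w` fixes `y`, negates `h₀` and hence `x`, and has a common sign `ε`
  -- on `V`, `Z`, `Y`. As `[x, Z]` lies on the line of `V` but has sign `-ε`, it is 0.
  obtain ⟨w, hw1, -, hw3, hw4⟩ := T.exists_reflection S
  have hwy : w y = y := hw4 y hy hfy
  have hwx : w x = -x := by
    refine (hw3 _ H.l_eq_zero x H.x_mem).resolve_left fun h => ?_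
    have h1 : ⁅w x, w y⁆ = w h₀ := by rw [← LieEquiv.map_lie, H.lie_x_y]
    rw [h, hwy, H.lie_x_y, hw1] at h1
    exact S.ne_zero (eq_zero_of_eq_neg_self h1)
  have sgn : ∀ σ, l σ = 0 → ∀ u ∈ A σ, ∃ ε : ℂ, ε * ε = 1 ∧ w u = ε • u := by
    intro σ hσ u hu
    rcases hw3 σ hσ u hu with h | h
    · exact ⟨1, by norm_num, by simp [h]⟩
    · exact ⟨-1, by norm_num, by simp [h]⟩
  obtain ⟨ε, hε, hwV⟩ := sgn _ hlV V hVm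
  obtain ⟨ε', hε', hwY⟩ := sgn _ hlY Y hYm
  have hε0 : ε ≠ 0 := fun h => by simp [h] at hε
  have hwZ : w Z = ε • Z := by rw [hZV, LieEquiv.map_lie, hwy, hwV, lie_smul]
  have hεε : ε' = ε := by
    have h1 : w ⁅Y, Z⁆ = ⁅Y, Z⁆ := by rw [hYZ, map_smul, hwy]
    rw [LieEquiv.map_lie, hwY, hwZ, smul_lie, lie_smul, smul_smul] at h1
    have h2 : ε' * ε = 1 := smul_left_injective ℂ hYZ0 (by simpa using h1)
    linear_combination ε * h2 - ε' * hε
  have hxZ : ⁅x, Z⁆ = 0 := by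
    obtain ⟨d, hd⟩ := S.line _ V hVm hV0 ⁅x, Z⁆ (S.grading.lie_mem_of_eq H.x_mem hZm (by abel))
    have h1 : w ⁅x, Z⁆ = -(ε • ⁅x, Z⁆) := by
      rw [LieEquiv.map_lie, hwx, hwZ, neg_lie, lie_smul]
    have h2 : w ⁅x, Z⁆ = ε • ⁅x, Z⁆ := by rw [hd, map_smul, hwV, smul_comm]
    have h3 := eq_zero_of_eq_neg_self (h2.symm.trans h1)
    exact (smul_eq_zero.1 h3).resolve_left hε0
  set W := ⁅x, Y⁆ with hW
  have hWm : W ∈ A (μ + (α' - j • α)) := S.grading.lie_mem H.x_mem hYm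
  have hWZ : ⁅W, Z⁆ = c • h₀ := by
    rw [hW, lie_lie, hYZ, hxZ, lie_zero, sub_zero, lie_smul, H.lie_x_y]
  have hW0 : W ≠ 0 := by
    intro h
    rw [h, zero_lie, eq_comm, smul_eq_zero] at hWZ
    exact hWZ.elim hc0 S.ne_zero
  have H' : IsHeisenberg A h₀ l (μ + (α' - j • α)) (c⁻¹ • W) Z :=
  { l_eq_zero := S.l_eq hWm hW0 (by rw [hW, leibniz_lie, H.lie_h_x S, hYw]; simp),
    x_mem := (A _).smul_mem _ hWm,
    y_mem := by convert hZm using 2; abel,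
    lie_x_y := by rw [smul_lie, hWZ, smul_smul, inv_mul_cancel₀ hc0, one_smul] }
  rcases H'.triple_cases S T with h | h
  · have h1 := hpow (j + 1) (by omega)
    rw [pow_succ', Module.End.mul_apply, LieAlgebra.ad_apply, ← hZ] at h1
    exact h1 h.1
  rcases hj with rfl | rfl
  · have heW : ⁅e, W⁆ = 0 := by
      have := h.1
      rw [lie_smul, smul_eq_zero] at this
      exact this.resolve_left (inv_ne_zero hc0)
    have hfW : ⁅f, W⁆ = 0 := by
      have := h.2.1
      rw [lie_smul, smul_eq_zero] at this
      exact this.resolve_left (inv_ne_zero hc0)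
    -- `w` fixes `W = [x, Y]` and negates `x`, hence negates `Y`. Then `[y, W]`, which is fixed by
    -- `w` and lies on the line of `Y`, must vanish.
    have hε1 : ε = -1 := by
      have h1 := hw4 W heW hfW
      rw [hW, LieEquiv.map_lie, hwx, hwY, hεε, neg_lie, lie_smul, ← hW, ← neg_smul] at h1
      have : -ε = 1 := smul_left_injective ℂ hW0 (by simpa using h1)
      linear_combination -this
    have hyW : ⁅y, W⁆ = 0 := by
      obtain ⟨d, hd⟩ := S.line _ Y hYm hY0 ⁅y, W⁆
        (S.grading.lie_mem_of_eq H.y_mem hWm (by abel))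
      have h1 : w ⁅y, W⁆ = ⁅y, W⁆ := by rw [LieEquiv.map_lie, hwy, hw4 W heW hfW]
      refine eq_zero_of_eq_neg_self ?_
      conv_lhs => rw [← h1, hd, map_smul, hwY, hεε, hε1, neg_one_smul, smul_neg, ← hd]
    refine H.false_of_second_pair S T T' (by simpa using hl) hy (by simpa using H') h.1 ?_
    rw [lie_smul, hyW, smul_zero]
  · refine hpow 4 (by omega) ?_
    rw [show (4 : ℕ) = 2 + 2 by norm_num, pow_add, Module.End.mul_apply, ← hZ, h.2.2.2.2]

end IsHeisenberg

end NoHeisenberg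

/-! ### Heisenberg pairs do not exist -/

section Nondegeneracy

variable {Λ : Type u} [AddCommGroup Λ] {L : Type v} [LieRing L] [LieAlgebra ℂ L]
  {A : Λ → Submodule ℂ L} {h₀ : L} {l : Λ → ℂ}

local notation "ad" => LieAlgebra.ad ℂ L

theorem IsTriple.exists_int {α ν : Λ} {e f v : L} (T : IsTriple A h₀ l α e f)
    (S : WeightSystem A h₀ l) (hv : v ∈ A ν) (hv0 : v ≠ 0) : ∃ k : ℤ, 2 * l ν = k * l α := by
  obtain ⟨n, m, h, -⟩ := T.exists_string S hv hv0
  refine ⟨n - m, ?_⟩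
  have := T.l_ne_zero
  field_simp at h
  push_cast
  linear_combination h

/-- What matters is that the eigenvalue is at least `k`; `n` counts the unknown steps above `v`. -/
theorem IsTriple.exists_lowering {α ν : Λ} {e f v : L} (T : IsTriple A h₀ l α e f)
    (S : WeightSystem A h₀ l) (hv : v ∈ A ν) (hv0 : v ≠ 0) {k : ℕ} (hk : 2 * l ν = k * l α) :
    ∃ n : ℕ, ⁅e, ⁅f, v⁆⁆ = (((n + 1) * (n + k) : ℕ) : ℂ) • v := by
  obtain ⟨n, m, h, -, h2, -⟩ := T.exists_string S hv hv0
  have hn : n = m + k := by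
    have hl := T.l_ne_zero
    rw [hk, mul_div_assoc, div_self hl] at h
    have : (n : ℂ) = (m + k : ℕ) := by push_cast; linear_combination -h
    exact_mod_cast this
  exact ⟨m, by rw [h2, hn]; push_cast; rfl⟩

theorem IsTriple.exists_raising {α ν : Λ} {e f v : L} (T : IsTriple A h₀ l α e f)
    (S : WeightSystem A h₀ l) (hv : v ∈ A ν) (hv0 : v ≠ 0) {k : ℕ} (hk : 2 * l ν = -(k * l α)) :
    ∃ n : ℕ, ⁅f, ⁅e, v⁆⁆ = (((n + 1) * (n + k) : ℕ) : ℂ) • v :=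
  (T.symm S).exists_lowering S hv hv0 (by rw [hk, T.l_neg S]; ring)

/-- One triple moves `x` and another moves `y`. Their Cartan integers have product 4, so up to sign
one weight is 1 or 2 times the other. Exchanging `e` with `f`, or the triples together with `x` and
`y`, reduces to `false_of_triples`. -/
theorem IsHeisenberg.elim {μ : Λ} {x y : L} (H : IsHeisenberg A h₀ l μ x y)
    (S : WeightSystem A h₀ l) : False := by
  obtain ⟨α, e, f, T, hex⟩ := H.exists_triple S
  obtain ⟨α', e', f', T', hey'⟩ := (H.symm S).exists_triple S
  obtain ⟨hey, hfy⟩ : ⁅e, y⁆ = 0 ∧ ⁅f, y⁆ = 0 := by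
    rcases H.triple_cases S T with h | h
    · exact ⟨h.1, h.2.1⟩
    · exact absurd h.1 hex
  obtain ⟨hex', hfx'⟩ : ⁅e', x⁆ = 0 ∧ ⁅f', x⁆ = 0 := by
    rcases H.triple_cases S T' with h | h
    · exact absurd h.1 hey'
    · exact ⟨h.1, h.2.1⟩
  obtain ⟨a, ha⟩ := T.exists_int S T'.e_mem (T'.e_ne_zero S)
  obtain ⟨b, hb⟩ := T'.exists_int S T.e_mem (T.e_ne_zero S)
  have hl := T.l_ne_zero
  have hab : a * b = 4 := by
    have h1 : ((a * b : ℤ) : ℂ) * l α = (4 : ℤ) * l α := by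
      push_cast
      linear_combination -2 * hb - b * ha
    exact_mod_cast mul_right_cancel₀ hl h1
  have hdvd : a ∣ 4 := ⟨b, hab.symm⟩
  have hle : a ≤ 4 := Int.le_of_dvd (by norm_num) hdvd
  have hge : -4 ≤ a := by
    have := Int.le_of_dvd (by norm_num) (neg_dvd.2 hdvd)
    omega
  have hl' := (T'.l_neg S)
  have hln := (T.l_neg S)
  interval_cases a
  · exact H.false_of_triples S T (T'.symm S) hey hfx' (Or.inr rfl)
      (by rw [hl']; push_cast at ha ⊢; linear_combination -ha / 2)
  · omega
  · exact H.false_of_triples S T (T'.symm S) hey hfx' (Or.inl rfl)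
      (by rw [hl']; push_cast at ha ⊢; linear_combination -ha / 2)
  · exact (H.symm S).false_of_triples S T' (T.symm S) (by simp [hex']) hfy (Or.inr rfl)
      (by rw [hln]; push_cast at ha ⊢; linear_combination -ha)
  · omega
  · exact (H.symm S).false_of_triples S T' T (by simp [hex']) hey (Or.inr rfl)
      (by push_cast at ha ⊢; linear_combination -ha)
  · exact H.false_of_triples S T T' hey hex' (Or.inl rfl)
      (by push_cast at ha ⊢; linear_combination ha / 2)
  · omega
  · exact H.false_of_triples S T T' hey hex' (Or.inr rfl)
      (by push_cast at ha ⊢; linear_combination ha / 2)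

namespace WeightSystem

/-- Elements of opposite degrees and weight `0` commute. -/
theorem lie_eq_zero_of_l_eq_zero (S : WeightSystem A h₀ l) {σ : Λ} {x y : L} (hσ : l σ = 0)
    (hx : x ∈ A σ) (hy : y ∈ A (-σ)) : ⁅x, y⁆ = 0 := by
  by_contra h
  obtain ⟨c, hc⟩ := S.exists_smul_h₀ (S.grading.lie_mem_of_eq hx hy (add_neg_cancel σ))
  have hc0 : c ≠ 0 := fun h0 => h (by simp [hc, h0])
  have H : IsHeisenberg A h₀ l σ x (c⁻¹ • y) :=
    ⟨hσ, hx, (A _).smul_mem _ hy, by rw [lie_smul, hc, smul_smul, inv_mul_cancel₀ hc0, one_smul]⟩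
  exact H.elim S

theorem lie_eq_zero_of_weight (S : WeightSystem A h₀ l) {σ τ : Λ} {x y : L} (hx : x ∈ A σ)
    (hy : y ∈ A τ) (hστ : σ + τ = 0) {c : ℂ} (hw : ⁅h₀, x⁆ = c • x) (hc : c = 0) :
    ⁅x, y⁆ = 0 := by
  by_cases hx0 : x = 0
  · simp [hx0]
  · exact S.lie_eq_zero_of_l_eq_zero ((S.l_eq hx hx0 hw).trans hc) hx
      (by rwa [← eq_neg_of_add_eq_zero_right hστ])

end WeightSystem

end Nondegeneracy

/-! ### Isotropic elements and numerical contradictions -/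

section Exclusion

variable {Λ : Type u} [AddCommGroup Λ] {L : Type v} [LieRing L] [LieAlgebra ℂ L]
  {A : Λ → Submodule ℂ L} {h₀ : L} {l : Λ → ℂ} {α β π : Λ} {e f p b : L}

/-- `p` commutes with the component of degree `-ν`. -/
def IsIsotropic (A : Λ → Submodule ℂ L) (ν : Λ) (p : L) : Prop :=
  ∀ q ∈ A (-ν), ⁅p, q⁆ = 0

theorem IsTriple.lie_f_lie_e_f (T : IsTriple A h₀ l α e f) (S : WeightSystem A h₀ l) :
    ⁅f, ⁅e, f⁆⁆ = (2 : ℂ) • f := by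
  have hl := T.l_ne_zero
  rw [T.lie_e_f, lie_smul, ← lie_skew, T.lie_h_f S, neg_smul, neg_neg, smul_smul]
  congr 1
  field_simp

/-- An isotropic element `p` of degree `-α - β` that moves `b` of degree `β` to the element `f` of
a triple of degree `α`. -/
structure IsIsotropicMove (A : Λ → Submodule ℂ L) (h₀ : L) (l : Λ → ℂ) (α β π : Λ)
    (e f p b : L) : Prop where
  triple : IsTriple A h₀ l α e f
  p_mem : p ∈ A π
  b_mem : b ∈ A β
  sum : α + β + π = 0
  isotropic : IsIsotropic A π p
  lie : ⁅p, b⁆ = f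

namespace IsIsotropicMove

theorem p_ne_zero (I : IsIsotropicMove A h₀ l α β π e f p b)
    (S : WeightSystem A h₀ l) : p ≠ 0 :=
  fun h => I.triple.f_ne_zero S (by rw [← I.lie, h, zero_lie])

theorem b_ne_zero (I : IsIsotropicMove A h₀ l α β π e f p b)
    (S : WeightSystem A h₀ l) : b ≠ 0 :=
  fun h => I.triple.f_ne_zero S (by rw [← I.lie, h, lie_zero])

theorem l_eq (I : IsIsotropicMove A h₀ l α β π e f p b)
    (S : WeightSystem A h₀ l) : l π = -(l α + l β) := by
  have := S.l_add_of_eq I.p_mem I.b_mem (I.lie ▸ I.triple.f_ne_zero S) (γ := -α)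
    (by rw [eq_neg_iff_add_eq_zero, ← I.sum]; abel)
  rw [I.triple.l_neg S] at this
  linear_combination -this

theorem lie_p_lie_e_b (I : IsIsotropicMove A h₀ l α β π e f p b)
    (S : WeightSystem A h₀ l) : ⁅p, ⁅e, b⁆⁆ = 0 :=
  I.isotropic _ (S.grading.lie_mem_of_eq I.triple.e_mem I.b_mem
    (by rw [eq_neg_iff_add_eq_zero, ← I.sum]))

theorem lie_lie_e_p_b (I : IsIsotropicMove A h₀ l α β π e f p b)
    (S : WeightSystem A h₀ l) : ⁅⁅e, p⁆, b⁆ = ⁅e, f⁆ := by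
  rw [← I.lie, leibniz_lie e p b, I.lie_p_lie_e_b S, add_zero]

/-- `[e, [e, p]]` and `[f, b]` have opposite degrees and weight 0, so they commute. Expanding gives
`2 = (n+1)(n+4) + (m+1)(m+2)`, whose right side is at least 6. -/
theorem false_of_l_eq (I : IsIsotropicMove A h₀ l α β π e f p b)
    (S : WeightSystem A h₀ l) (hl : l β = l α) : False := by
  have T := I.triple
  have hπ := I.l_eq S
  obtain ⟨n, hn⟩ := T.exists_raising S I.p_mem (I.p_ne_zero S) (k := 4)
    (by rw [hπ, hl]; push_cast; ring)
  obtain ⟨m, hm⟩ := T.exists_lowering S I.b_mem (I.b_ne_zero S) (k := 2)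
    (by rw [hl]; push_cast; ring)
  have h0 : ⁅⁅e, ⁅e, p⁆⁆, ⁅f, b⁆⁆ = 0 :=
    S.lie_eq_zero_of_weight (S.grading.lie_mem T.e_mem (S.grading.lie_mem T.e_mem I.p_mem))
      (S.grading.lie_mem T.f_mem I.b_mem) (by rw [← I.sum]; abel)
      (WeightSystem.weight_lie (T.lie_h_e S) (WeightSystem.weight_lie (T.lie_h_e S) (S.lie _ _ I.p_mem)))
      (by rw [hπ, hl]; ring)
  have h1 : ⁅⁅e, p⁆, ⁅f, b⁆⁆ = (2 - ((n + 1) * (n + 4) : ℕ) : ℂ) • f := by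
    have := leibniz_lie f ⁅e, p⁆ b
    rw [I.lie_lie_e_p_b S, T.lie_f_lie_e_f S, hn, smul_lie, I.lie] at this
    rw [sub_smul, this]; abel
  have h2 := leibniz_lie e ⁅e, p⁆ ⁅f, b⁆
  rw [h0, hm, h1, zero_add, lie_smul, lie_smul, I.lie_lie_e_p_b S] at h2
  have h3 := smul_left_injective ℂ (T.lie_ne_zero S) h2
  have h4 : (2 : ℂ) = (((n + 1) * (n + 4) + (m + 1) * (m + 2) : ℕ) : ℂ) := by
    push_cast at h3 ⊢
    linear_combination h3
  have h5 : 2 = (n + 1) * (n + 4) + (m + 1) * (m + 2) := by exact_mod_cast h4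
  nlinarith

/-- The same scheme with `[f, p]` and `[e, [e, b]]` in weight 0; it ends in `(n+1)(n+4) = 0`. -/
theorem false_of_l_eq_neg_two_mul (I : IsIsotropicMove A h₀ l α β π e f p b)
    (S : WeightSystem A h₀ l) (hl : l β = -(2 * l α)) : False := by
  have T := I.triple
  have hπ := I.l_eq S
  obtain ⟨n, hn⟩ := T.exists_raising S I.b_mem (I.b_ne_zero S) (k := 4)
    (by rw [hl]; push_cast; ring)
  obtain ⟨m, hm⟩ := T.exists_lowering S I.p_mem (I.p_ne_zero S) (k := 2)
    (by rw [hπ, hl]; push_cast; ring)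
  have h0 : ⁅⁅f, p⁆, ⁅e, ⁅e, b⁆⁆⁆ = 0 :=
    S.lie_eq_zero_of_weight (S.grading.lie_mem T.f_mem I.p_mem)
      (S.grading.lie_mem T.e_mem (S.grading.lie_mem T.e_mem I.b_mem)) (by rw [← I.sum]; abel)
      (WeightSystem.weight_lie (T.lie_h_f S) (S.lie _ _ I.p_mem)) (by rw [hπ, hl]; ring)
  obtain ⟨c, hc⟩ := S.line _ f T.f_mem (T.f_ne_zero S) ⁅⁅f, p⁆, ⁅e, b⁆⁆
    (S.grading.lie_mem_of_eq (S.grading.lie_mem T.f_mem I.p_mem)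
      (S.grading.lie_mem T.e_mem I.b_mem) (by rw [eq_neg_iff_add_eq_zero, ← I.sum]; abel))
  have h1 := leibniz_lie e ⁅f, p⁆ ⁅e, b⁆
  rw [h0, hm, smul_lie, I.lie_p_lie_e_b S, smul_zero, add_zero, hc, lie_smul, smul_eq_zero,
    or_iff_left (T.lie_ne_zero S)] at h1
  have h2 := leibniz_lie f p ⁅e, b⁆
  rw [I.lie_p_lie_e_b S, hc, h1, hn, lie_smul, I.lie, lie_zero, zero_smul, zero_add, eq_comm,
    smul_eq_zero, or_iff_left (T.f_ne_zero S)] at h2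
  have h3 : (n + 1) * (n + 4) = 0 := by exact_mod_cast h2
  simp at h3

/-- The same scheme with three raisings of `p` against two lowerings of `b`. -/
theorem false_of_l_eq_two_mul (I : IsIsotropicMove A h₀ l α β π e f p b)
    (S : WeightSystem A h₀ l) (hl : l β = 2 * l α) : False := by
  have T := I.triple
  have hπ := I.l_eq S
  have hep : ⁅e, p⁆ ∈ A (α + π) := S.grading.lie_mem T.e_mem I.p_mem
  have hep0 : ⁅e, p⁆ ≠ 0 := fun h => T.lie_ne_zero S (by rw [← I.lie_lie_e_p_b S, h, zero_lie])
  have hfb : ⁅f, b⁆ ∈ A (-α + β) := S.grading.lie_mem T.f_mem I.b_mem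
  obtain ⟨n, hn⟩ := T.exists_raising S I.p_mem (I.p_ne_zero S) (k := 6)
    (by rw [hπ, hl]; push_cast; ring)
  obtain ⟨m, hm⟩ := T.exists_lowering S I.b_mem (I.b_ne_zero S) (k := 4)
    (by rw [hl]; push_cast; ring)
  have hfb0 : ⁅f, b⁆ ≠ 0 := by
    intro h
    rw [h, lie_zero, eq_comm, smul_eq_zero, or_iff_left (I.b_ne_zero S)] at hm
    have h3 : (m + 1) * (m + 4) = 0 := by exact_mod_cast hm
    simp at h3
  obtain ⟨i, hi⟩ := T.exists_raising S hep hep0 (k := 4)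
    (by rw [S.l_add T.e_mem I.p_mem hep0, hπ, hl]; push_cast; ring)
  obtain ⟨j, hj⟩ := T.exists_lowering S hfb hfb0 (k := 2)
    (by rw [S.l_add T.f_mem I.b_mem hfb0, T.l_neg S, hl]; push_cast; ring)
  have h0 : ⁅⁅e, ⁅e, ⁅e, p⁆⁆⁆, ⁅f, ⁅f, b⁆⁆⁆ = 0 :=
    S.lie_eq_zero_of_weight (S.grading.lie_mem T.e_mem (S.grading.lie_mem T.e_mem hep))
      (S.grading.lie_mem T.f_mem hfb) (by rw [← I.sum]; abel)
      (WeightSystem.weight_lie (T.lie_h_e S) (WeightSystem.weight_lie (T.lie_h_e S)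
        (WeightSystem.weight_lie (T.lie_h_e S) (S.lie _ _ I.p_mem))))
      (by rw [hπ, hl]; ring)
  have h1 : ⁅⁅e, p⁆, ⁅f, b⁆⁆ = (2 - ((n + 1) * (n + 6) : ℕ) : ℂ) • f := by
    have := leibniz_lie f ⁅e, p⁆ b
    rw [I.lie_lie_e_p_b S, T.lie_f_lie_e_f S, hn, smul_lie, I.lie] at this
    rw [sub_smul, this]; abel
  have h2 : ⁅⁅e, ⁅e, p⁆⁆, ⁅f, b⁆⁆ =
      (2 - ((n + 1) * (n + 6) : ℕ) - ((m + 1) * (m + 4) : ℕ) : ℂ) • ⁅e, f⁆ := by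
    have := leibniz_lie e ⁅e, p⁆ ⁅f, b⁆
    rw [hm, h1, lie_smul, lie_smul, I.lie_lie_e_p_b S] at this
    rw [sub_smul _ _ ⁅e, f⁆, this]; abel
  have h3 := leibniz_lie f ⁅e, ⁅e, p⁆⁆ ⁅f, b⁆
  rw [h2, hi, smul_lie, h1, lie_smul, T.lie_f_lie_e_f S, smul_smul, smul_smul] at h3
  have h4 := leibniz_lie e ⁅e, ⁅e, p⁆⁆ ⁅f, ⁅f, b⁆⁆
  rw [h0, hj, lie_smul, h2, zero_add, eq_sub_of_add_eq' h3.symm, ← sub_smul, lie_smul,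
    smul_smul] at h4
  have h5 := smul_left_injective ℂ (T.lie_ne_zero S) h4
  -- Subtracting lower bounds from the products turns `h5` into a vanishing sum of natural numbers
  -- with a positive term.
  obtain ⟨c, hc⟩ : ∃ c : ℕ, (j + 1) * (j + 2) = c + 2 := ⟨j * j + 3 * j, by ring⟩
  obtain ⟨d, hd⟩ : ∃ d : ℕ, (n + 1) * (n + 6) = d + 3 := ⟨n * n + 7 * n + 3, by ring⟩
  rw [hc, hd] at h5
  have h6 : ((c * (d + 1 + (m + 1) * (m + 4)) + (i + 1) * (i + 4) * (d + 1) : ℕ) : ℂ) = 0 := by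
    push_cast at h5 ⊢
    linear_combination h5
  have h7 : c * (d + 1 + (m + 1) * (m + 4)) + (i + 1) * (i + 4) * (d + 1) = 0 := by
    exact_mod_cast h6
  simp at h7

end IsIsotropicMove

/-- A nonzero value would put `a` and `b` into triples whose Cartan integers have product 4. Of the
six possibilities `s = -2` means `l π = 0`, and the others are excluded by a move based at `α` or at
`β`. -/
theorem IsIsotropic.lie_lie_eq_zero {a : L} (h : IsIsotropic A π p) (S : WeightSystem A h₀ l)
    (hp : p ∈ A π) (ha : a ∈ A α) (hb : b ∈ A β) (hsum : α + β + π = 0) (hπ : l π ≠ 0)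
    (hα : l α ≠ 0) (hβ : l β ≠ 0) : ⁅⁅a, p⁆, b⁆ = 0 := by
  by_contra h0
  have hab : ⁅p, ⁅a, b⁆⁆ = 0 :=
    h _ (S.grading.lie_mem_of_eq ha hb (by rw [eq_neg_iff_add_eq_zero, ← hsum]))
  have h1 : ⁅⁅a, p⁆, b⁆ = ⁅a, ⁅p, b⁆⁆ := by rw [leibniz_lie a p b, hab, add_zero]
  obtain ⟨c, hc, T⟩ := S.exists_isTriple hα ha (v := ⁅p, b⁆)
    (S.grading.lie_mem_of_eq hp hb (by rw [eq_neg_iff_add_eq_zero, ← hsum]; abel)) (h1 ▸ h0)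
  obtain ⟨d, hd, T'⟩ := S.exists_isTriple hβ hb (v := ⁅a, p⁆)
    (S.grading.lie_mem_of_eq ha hp (by rw [eq_neg_iff_add_eq_zero, ← hsum]; abel))
    (by rw [← lie_skew]; exact neg_ne_zero.2 h0)
  have hiso : ∀ c : ℂ, IsIsotropic A π (c • p) := fun c q hq => by rw [smul_lie, h q hq, smul_zero]
  have I : IsIsotropicMove A h₀ l α β π a (c • ⁅p, b⁆) (c • p) b :=
    ⟨T, (A _).smul_mem _ hp, hb, hsum, hiso _, smul_lie _ _ _⟩
  have I' : IsIsotropicMove A h₀ l β α π b (d • ⁅a, p⁆) (-d • p) a :=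
    ⟨T', (A _).smul_mem _ hp, ha, by rw [← hsum]; abel, hiso _,
      by rw [neg_smul, neg_lie, ← lie_skew, neg_neg, lie_smul]⟩
  obtain ⟨s, hs⟩ := T.exists_int S T'.e_mem (T'.e_ne_zero S)
  obtain ⟨r, hr⟩ := T'.exists_int S T.e_mem (T.e_ne_zero S)
  have hsr : s * r = 4 := by
    have h1 : ((s * r : ℤ) : ℂ) * l α = (4 : ℤ) * l α := by
      push_cast
      linear_combination -2 * hr - r * hs
    exact_mod_cast mul_right_cancel₀ hα h1
  have hdvd : s ∣ 4 := ⟨r, hsr.symm⟩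
  have hle : s ≤ 4 := Int.le_of_dvd (by norm_num) hdvd
  have hge : -4 ≤ s := by
    have := Int.le_of_dvd (by norm_num) (neg_dvd.2 hdvd)
    omega
  have hlπ := I.l_eq S
  interval_cases s <;> try omega
  · exact I.false_of_l_eq_neg_two_mul S (by push_cast at hs; linear_combination hs / 2)
  · exact hπ (by rw [hlπ]; push_cast at hs; linear_combination -hs / 2)
  · exact I'.false_of_l_eq_neg_two_mul S (by push_cast at hs; linear_combination hs)
  · exact I'.false_of_l_eq_two_mul S (by push_cast at hs; linear_combination -hs)
  · exact I.false_of_l_eq S (by push_cast at hs; linear_combination hs / 2)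
  · exact I.false_of_l_eq_two_mul S (by push_cast at hs; linear_combination hs / 2)

end Exclusion

/-! ### The isotropic ideal is zero -/

section Nondegenerate

variable {Λ : Type u} [AddCommGroup Λ] {L : Type v} [LieRing L] [LieAlgebra ℂ L]
  {A : Λ → Submodule ℂ L} {h₀ : L} {l : Λ → ℂ}

namespace IsIsotropic

variable {ν γ π : Λ} {p q c : L}

theorem add (hp : IsIsotropic A ν p) (hq : IsIsotropic A ν q) : IsIsotropic A ν (p + q) :=
  fun b hb => by rw [add_lie, hp b hb, hq b hb, add_zero]

theorem smul (hp : IsIsotropic A ν p) (t : ℂ) : IsIsotropic A ν (t • p) :=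
  fun b hb => by rw [smul_lie, hp b hb, smul_zero]

theorem zero : IsIsotropic A ν (0 : L) := fun _ _ => zero_lie _

theorem lie (h : IsIsotropic A π p) (S : WeightSystem A h₀ l) (hp : p ∈ A π) (hc : c ∈ A γ)
    {s t : ℂ} (hps : ⁅h₀, p⁆ = s • p) (hct : ⁅h₀, c⁆ = t • c) (hs : s ≠ 0) (hst : t + s ≠ 0)
    (hν : γ + π = ν) : IsIsotropic A ν ⁅c, p⁆ := by
  intro b hb
  by_contra h0
  have hcp0 : ⁅c, p⁆ ≠ 0 := fun h => h0 (by rw [h, zero_lie])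
  have hp0 : p ≠ 0 := fun h => hcp0 (by rw [h, lie_zero])
  have hc0 : c ≠ 0 := fun h => hcp0 (by rw [h, zero_lie])
  have hlπ := S.l_eq hp hp0 hps
  have hlγ := S.l_eq hc hc0 hct
  have hcp : ⁅c, p⁆ ∈ A ν := S.grading.lie_mem_of_eq hc hp hν
  have hlν : l ν = t + s := S.l_eq hcp hcp0 (WeightSystem.weight_lie hct hps)
  have hlb : l (-ν) ≠ 0 := by
    have := S.l_add_of_eq hcp hb h0 (add_neg_cancel ν)
    rw [S.l_zero] at this
    intro h
    rw [h, hlν, add_zero] at this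
    exact hst this.symm
  by_cases ht : t = 0
  · have h1 := leibniz_lie c p b
    have h2 : ⁅c, ⁅p, b⁆⁆ = 0 :=
      S.lie_eq_zero_of_weight hc (S.grading.lie_mem hp hb) (by rw [← hν]; abel) hct ht
    have h3 : ⁅p, ⁅c, b⁆⁆ = 0 := h _ (S.grading.lie_mem_of_eq hc hb (by rw [← hν]; abel))
    rw [h2, h3, add_zero] at h1
    exact h0 h1.symm
  · exact h0 (h.lie_lie_eq_zero S hp hc hb (by rw [← hν]; abel) (hlπ ▸ hs) (hlγ ▸ ht) hlb)

end IsIsotropic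

/-- The component of degree `ν` of the ideal generated by isotropic elements of nonzero weight. -/
def isotropicPart (A : Λ → Submodule ℂ L) (l : Λ → ℂ) (ν : Λ) : Submodule ℂ L where
  carrier := {p | p ∈ A ν ∧ (l ν ≠ 0 → IsIsotropic A ν p) ∧
    (l ν = 0 → ∀ α, l α ≠ 0 → ∀ a ∈ A α, IsIsotropic A (α + ν) ⁅a, p⁆)}
  add_mem' {p q} hp hq := ⟨add_mem hp.1 hq.1, fun h => (hp.2.1 h).add (hq.2.1 h),
    fun h α hα a ha => by
      rw [lie_add]
      exact (hp.2.2 h α hα a ha).add (hq.2.2 h α hα a ha)⟩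
  zero_mem' := ⟨zero_mem _, fun _ => .zero, fun _ _ _ _ _ => by rw [lie_zero]; exact .zero⟩
  smul_mem' t p hp := ⟨(A ν).smul_mem t hp.1, fun h => (hp.2.1 h).smul t,
    fun h α hα a ha => by
      rw [lie_smul]
      exact (hp.2.2 h α hα a ha).smul t⟩

-- In weight 0 isotropy is automatic, so `isotropicPart` tests such elements by their brackets with
-- nonzero weights. The delicate case is `[c, p]` of weight 0 with `l α = -l ν`: there `[a, p]` has
-- weight 0 too, and isotropy cannot be passed on through it.
open WeightSystem in
theorem lie_mem_isotropicPart (S : WeightSystem A h₀ l) {γ ν : Λ} {c p : L} (hc : c ∈ A γ)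
    (hpK : p ∈ isotropicPart A l ν) : ⁅c, p⁆ ∈ isotropicPart A l (γ + ν) := by
  by_cases hcp0 : ⁅c, p⁆ = 0
  · rw [hcp0]; exact zero_mem _
  obtain ⟨hp, hp1, hp2⟩ := hpK
  have hcp := S.grading.lie_mem hc hp
  have hl := S.l_add hc hp hcp0
  have wc := S.lie _ _ hc
  have wp := S.lie _ _ hp
  refine ⟨hcp, fun h => ?_, fun h α hα a ha => ?_⟩
  · rw [hl] at h
    by_cases hν : l ν = 0
    · exact hp2 hν γ (by simpa [hν] using h) c hc
    · exact (hp1 hν).lie S hp hc wp wc hν h rfl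
  rw [hl] at h
  have wa := S.lie _ _ ha
  by_cases hν : l ν = 0
  · have hγ : l γ = 0 := by simpa [hν] using h
    rw [leibniz_lie]
    refine .add ?_ ?_
    · by_cases h0 : ⁅a, c⁆ = 0
      · rw [h0, zero_lie]; exact .zero
      have := hp2 hν (α + γ) (by rwa [S.l_add ha hc h0, hγ, add_zero]) _ (S.grading.lie_mem ha hc)
      rwa [add_assoc] at this
    · exact (hp2 hν α hα a ha).lie S (S.grading.lie_mem ha hp) hc (weight_lie wa wp) wc
        (by rwa [hν, add_zero]) (by rwa [hν, hγ, zero_add, add_zero]) (by abel)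
  have hp1 := hp1 hν
  by_cases hαν : l α + l ν = 0
  · intro q hq
    by_contra h0
    have haz : ⁅a, ⁅c, p⁆⁆ ∈ A (α + (γ + ν)) := S.grading.lie_mem ha hcp
    have haz0 : ⁅a, ⁅c, p⁆⁆ ≠ 0 := fun h => h0 (by rw [h, zero_lie])
    have hlq : l (-(α + (γ + ν))) = l ν := by
      have h1 := S.l_add_of_eq haz hq h0 (add_neg_cancel _)
      rw [S.l_zero, S.l_add ha hcp haz0, hl] at h1
      linear_combination -h1 - h - hαν
    have wq := S.lie _ _ hq
    rw [hlq] at wq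
    have h1 : ⁅⁅c, p⁆, ⁅a, q⁆⁆ = 0 :=
      S.lie_eq_zero_of_weight hcp (S.grading.lie_mem ha hq) (by abel) (weight_lie wc wp) h
    -- The detour: `q` has weight `l ν`, so `[q, p]` has weight `2 l ν ≠ 0` and inherits isotropy.
    have hpq : IsIsotropic A (-(α + (γ + ν)) + ν) ⁅q, p⁆ :=
      hp1.lie S hp hq wp wq hν (by simpa [← two_mul] using hν) rfl
    have h2 : ⁅⁅c, ⁅q, p⁆⁆, a⁆ = 0 :=
      hpq.lie S (S.grading.lie_mem hq hp) hc (weight_lie wq wp) wc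
        (by simpa [← two_mul] using hν) (by rwa [← add_assoc, h, zero_add] ) rfl a
        (by convert ha using 1; abel_nf)
    have h3 : ⁅⁅⁅c, q⁆, p⁆, a⁆ = 0 :=
      hp1.lie S hp (S.grading.lie_mem hc hq) wp (weight_lie wc wq) hν (by rwa [h, zero_add]) rfl a
        (by convert ha using 1; abel_nf)
    refine h0 ?_
    have e1 : ⁅⁅c, p⁆, q⁆ = ⁅⁅c, q⁆, p⁆ - ⁅c, ⁅q, p⁆⁆ := by
      rw [leibniz_lie c q p, ← lie_skew ⁅c, p⁆ q]
      abel
    have e2 : ⁅a, ⁅⁅c, p⁆, q⁆⁆ = 0 := by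
      rw [e1, ← lie_skew, sub_lie, h3, h2, sub_zero, neg_zero]
    have e3 := leibniz_lie a ⁅c, p⁆ q
    rw [h1, e2, add_zero] at e3
    exact e3.symm
  · rw [leibniz_lie]
    refine .add ?_ ?_
    · exact hp1.lie S hp (S.grading.lie_mem ha hc) wp (weight_lie wa wc) hν
        (by rwa [add_assoc, h, add_zero]) (by abel)
    · exact (hp1.lie S hp ha wp wa hν hαν rfl).lie S (S.grading.lie_mem ha hp) hc
        (weight_lie wa wp) wc hαν (by rwa [add_left_comm, h, add_zero]) (by abel)

namespace WeightSystem

/-- `h₀` is not in this ideal: `[e, h₀]` is a nonzero multiple of `e`, and `[e, f] ≠ 0`. -/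
theorem isotropicPart_eq_bot (S : WeightSystem A h₀ l) (ν : Λ) : isotropicPart A l ν = ⊥ := by
  rcases S.simple.family_dichotomy S.grading (isotropicPart A l) (fun _ _ h => h.1)
    (fun _ _ _ hx _ hy => lie_mem_isotropicPart S hx hy) with h | h
  · exact h ν
  obtain ⟨α, e, f, T⟩ := S.exists_triple
  have hh : h₀ ∈ isotropicPart A l 0 := h 0 ▸ S.mem
  have h1 := hh.2.2 S.l_zero α T.l_ne_zero e T.e_mem f (by simpa using T.f_mem)
  rw [← lie_skew e h₀, T.lie_h_e S, neg_lie, smul_lie, neg_eq_zero, smul_eq_zero,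
    or_iff_right T.l_ne_zero] at h1
  exact absurd h1 (T.lie_ne_zero S)

/-- Nonzero homogeneous elements of nonzero weight belong to an `𝔰𝔩₂`-triple. -/
theorem exists_isTriple_of_ne_zero (S : WeightSystem A h₀ l) {ν : Λ} (hl : l ν ≠ 0) {p : L}
    (hp : p ∈ A ν) (hp0 : p ≠ 0) : ∃ f, IsTriple A h₀ l ν p f := by
  by_contra! hf
  refine hp0 ?_
  have : p ∈ isotropicPart A l ν := by
    refine ⟨hp, fun _ q hq => ?_, fun h => absurd h hl⟩
    by_contra h
    obtain ⟨c, -, T⟩ := S.exists_isTriple hl hp hq h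
    exact hf _ T
  rwa [S.isotropicPart_eq_bot] at this

end WeightSystem

end Nondegenerate

/-! ### Centroid elements from translations of the top weight -/

section Graph

variable {Λ : Type u} [AddCommGroup Λ] {L : Type v} [LieRing L] [LieAlgebra ℂ L]
  {A : Λ → Submodule ℂ L} {h₀ : L} {l : Λ → ℂ}

/-- In a simple graded Lie algebra, a homogeneous correspondence of degree `ε` that commutes with
the adjoint action and is proper and nonzero is the graph of an element of the centroid. -/
theorem IsSimpleGraded.mem_centroidSupport_of_graph (hs : IsSimpleGraded A) (hA : IsLieGrading A)
    {ε : Λ} (G : Submodule ℂ (L × L)) (hlie : ∀ c : L, ∀ g ∈ G, (⁅c, g.1⁆, ⁅c, g.2⁆) ∈ G)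
    (hgr : ∀ g ∈ G, ∀ ν, (hA.proj ν g.1, hA.proj (ν + ε) g.2) ∈ G)
    (hne : ∃ z, ((0 : L), z) ∉ G) (hnz : ∃ g ∈ G, g.2 ≠ 0) : ε ∈ centroidSupport A := by
  -- `I` measures the failure of `G` to be single-valued and `J` below is its domain. Both are
  -- graded ideals; the first is proper, hence 0, and the second nonzero, hence `L`.
  let I : LieIdeal ℂ L :=
    { __ := G.comap (LinearMap.inr ℂ L L)
      lie_mem := by
        intro c z hz
        simpa using hlie c (0, z) hz }
  have hI : ∀ z, z ∈ I ↔ ((0 : L), z) ∈ G := fun z => Iff.rfl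
  have hIbot : I = ⊥ := by
    refine (hs.eq_bot_or_eq_top I (hA.isGradedIdeal fun z hz i => ?_)).resolve_right fun h => ?_
    · have := hgr _ ((hI z).1 hz) (i - ε)
      rw [hI]
      simpa using this
    · obtain ⟨z, hz⟩ := hne
      exact hz ((hI z).1 (h ▸ LieSubmodule.mem_top z))
  have huniq : ∀ a b b', (a, b) ∈ G → (a, b') ∈ G → b = b' := by
    intro a b b' h h'
    have : b - b' ∈ I := by
      rw [hI]
      simpa using sub_mem h h'
    rw [hIbot, LieSubmodule.mem_bot] at this
    exact sub_eq_zero.1 this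
  let J : LieIdeal ℂ L :=
    { __ := G.map (LinearMap.fst ℂ L L)
      lie_mem := by
        rintro c _ ⟨g, hg, rfl⟩
        exact ⟨_, hlie c g hg, rfl⟩ }
  have hJ : ∀ a, a ∈ J ↔ ∃ b, (a, b) ∈ G := by
    intro a
    constructor
    · rintro ⟨g, hg, rfl⟩
      exact ⟨g.2, hg⟩
    · rintro ⟨b, hb⟩
      exact ⟨_, hb, rfl⟩
  have hJtop : J = ⊤ := by
    refine (hs.eq_bot_or_eq_top J (hA.isGradedIdeal fun a ha i => ?_)).resolve_left fun h => ?_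
    · obtain ⟨b, hb⟩ := (hJ a).1 ha
      exact (hJ _).2 ⟨_, hgr _ hb i⟩
    · obtain ⟨⟨a, b⟩, hg, hb⟩ := hnz
      have ha : a ∈ J := (hJ a).2 ⟨b, hg⟩
      rw [h, LieSubmodule.mem_bot] at ha
      subst ha
      exact hb (huniq 0 b 0 hg (zero_mem G))
  have hex : ∀ a, ∃ b, (a, b) ∈ G := fun a => (hJ a).1 (hJtop ▸ LieSubmodule.mem_top a)
  choose ψ hψ using hex
  let Ψ : Module.End ℂ L :=
    { toFun := ψ
      map_add' := fun a b => huniq _ _ _ (hψ _) (add_mem (hψ a) (hψ b))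
      map_smul' := fun t a => huniq _ _ _ (hψ _) (G.smul_mem t (hψ a)) }
  have hΨ : ∀ a b, ψ ⁅a, b⁆ = ⁅a, ψ b⁆ := fun a b => huniq _ _ _ (hψ _) (hlie a _ (hψ b))
  refine ⟨Ψ, fun a b => ⟨?_, hΨ a b⟩, fun h => ?_, fun m x hx => ?_⟩
  · rw [← lie_skew, map_neg]
    change -ψ ⁅b, a⁆ = ⁅ψ a, b⁆
    rw [hΨ, lie_skew]
  · obtain ⟨⟨a, b⟩, hg, hb⟩ := hnz
    refine hb ?_
    rw [huniq _ _ _ hg (hψ a)]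
    exact LinearMap.congr_fun h a
  · have := hgr _ (hψ x) m
    rw [hA.proj_same hx] at this
    change ψ x ∈ _
    rw [huniq _ _ _ (hψ x) this]
    exact hA.proj_mem _ _

/-- The pairs generated from the pairs `(x, τ x)` with `x` of top degree by the diagonal action of
elements of negative degree. -/
inductive TopOrbit (A : Λ → Submodule ℂ L) (τ : L → L) (top neg : Λ → Prop) : Λ → L → L → Prop
  | base {ν : Λ} {x : L} (hν : top ν) (hx : x ∈ A ν) : TopOrbit A τ top neg ν x (τ x)
  | step {κ ν : Λ} {y a b : L} (hκ : neg κ) (hy : y ∈ A κ) (h : TopOrbit A τ top neg ν a b) :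
      TopOrbit A τ top neg (κ + ν) ⁅y, a⁆ ⁅y, b⁆

theorem IsTriple.exists_top {α : Λ} {e f : L} (T : IsTriple A h₀ l α e f)
    (S : WeightSystem A h₀ l) : ∃ N : ℤ, 0 < N ∧ (∃ ν, ∃ x ∈ A ν, x ≠ 0 ∧ 2 * l ν = N * l α) ∧
      ∀ ν, ∀ x ∈ A ν, x ≠ 0 → ∀ k : ℤ, 2 * l ν = k * l α → k ≤ N := by
  obtain ⟨C, hC⟩ := S.bdd
  have hl := T.l_ne_zero
  obtain ⟨N, ⟨ν, x, hx, hx0, hN⟩, hmax⟩ := Int.exists_greatest_of_bdd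
    (P := fun k : ℤ => ∃ ν, ∃ x ∈ A ν, x ≠ 0 ∧ 2 * l ν = k * l α)
    ⟨⌈2 * C / ‖l α‖⌉, by
      rintro k ⟨ν, x, hx, hx0, hk⟩
      have h1 := hC ν x hx hx0
      have h2 : (k : ℝ) * ‖l α‖ ≤ 2 * C := by
        have := congrArg norm hk
        rw [norm_mul, norm_mul, Complex.norm_intCast] at this
        have h3 : (k : ℝ) ≤ |(k : ℝ)| := le_abs_self _
        have h4 := norm_nonneg (l α)
        simp only [Complex.norm_ofNat] at this
        nlinarith
      rw [← le_div_iff₀ (norm_pos_iff.2 hl)] at h2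
      exact_mod_cast h2.trans (Int.le_ceil _)⟩
    ⟨2, α, e, T.e_mem, T.e_ne_zero S, by push_cast; rfl⟩
  refine ⟨N, ?_, ⟨ν, x, hx, hx0, hN⟩, fun ν x hx hx0 k hk => hmax k ⟨ν, x, hx, hx0, hk⟩⟩
  have := hmax 2 ⟨α, e, T.e_mem, T.e_ne_zero S, by push_cast; rfl⟩
  omega

/-- For two degrees of the same nonzero weight, a fixed multiple of the difference belongs to the
support of the centroid. -/
theorem IsTriple.exists_smul_sub_mem {α : Λ} {e f : L} (T : IsTriple A h₀ l α e f)
    (S : WeightSystem A h₀ l) : ∃ N : ℤ, 0 < N ∧ ∀ α' e' f', IsTriple A h₀ l α' e' f' →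
      l α' = l α → N • (α' - α) ∈ centroidSupport A := by
  classical
  obtain ⟨N, hN, ⟨ν₀, x₀, hx₀, hx₀0, hν₀⟩, hmax⟩ := T.exists_top S
  refine ⟨2 * N, by omega, fun α' e' f' T' hα => ?_⟩
  obtain ⟨τ, hτ, hτ0⟩ := T.exists_double_translation T' S hα
  have hl := T.l_ne_zero
  -- `τ` shifts degrees by an amount that depends on the weight. Only its constant shift `ε` on the
  -- top weight is kept, and the action of `L` extends it downwards.
  set ε := (2 * N) • (α' - α) with hε
  let top : Λ → Prop := fun ν => 2 * l ν = N * l α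
  let neg : Λ → Prop := fun ν => ∃ k : ℤ, k < 0 ∧ 2 * l ν = k * l α
  let W := TopOrbit A τ top neg
  have hWmem : ∀ ν a b, W ν a b → a ∈ A ν ∧ b ∈ A (ν + ε) := by
    intro ν a b h
    induction h with
    | base hν hx => exact ⟨hx, hτ _ _ hx N hν⟩
    | step hκ hy h ih =>
      exact ⟨S.grading.lie_mem hy ih.1, S.grading.lie_mem_of_eq hy ih.2 (add_assoc _ _ _).symm⟩
  let G : Submodule ℂ (L × L) := Submodule.span ℂ {g | ∃ ν, W ν g.1 g.2}
  let D : L → L × L →ₗ[ℂ] L × L := fun c =>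
    (LieAlgebra.ad ℂ L c).prodMap (LieAlgebra.ad ℂ L c)
  have hW : ∀ ν a b, W ν a b → (a, b) ∈ G := fun ν a b h => Submodule.subset_span ⟨ν, h⟩
  have hneg : ∀ κ, neg κ → ∀ y ∈ A κ, ∀ g ∈ G, D y g ∈ G := by
    intro κ hκ y hy g hg
    have : G ≤ G.comap (D y) := Submodule.span_le.2 fun g ⟨ν, h⟩ => hW _ _ _ (h.step hκ hy)
    exact this hg
  have hkill : ∀ κ ν, ∀ c ∈ A κ, ∀ x ∈ A ν, ∀ k : ℤ, 0 < k → 2 * l κ = k * l α → top ν →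
      ⁅c, x⁆ = 0 := by
    intro κ ν c hc x hx k hk hκ hν
    by_contra h0
    have := hmax _ _ (S.grading.lie_mem hc hx) h0 (k + N) (by
      rw [S.l_add hc hx h0, mul_add, hκ, hν]; push_cast; ring)
    omega
  have htop : ∀ ν, ∀ x ∈ A ν, x ≠ 0 → top ν → top (ν + ε) := by
    intro ν x hx hx0 hν
    have hx' := hτ _ _ hx N hν
    have hτx0 : τ x ≠ 0 := by simpa using hx0
    have := S.l_eq hx' hτx0 (weight_map (hτ0 0 S.l_zero h₀ S.mem) (S.lie _ _ hx))
    change 2 * l (ν + ε) = N * l α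
    rw [this]
    exact hν
  -- On the top weight, negative weights act by construction, weight 0 commutes with `τ`, and
  -- positive weights give 0. The Leibniz rule carries this down the orbit.
  have hstab : ∀ ν a b, W ν a b → ∀ κ, ∀ c ∈ A κ, D c (a, b) ∈ G := by
    intro ν a b h
    induction h with
    | @base ν x hν hx =>
      intro κ c hc
      by_cases hc0 : c = 0
      · simp [D, hc0]
      by_cases hx0 : x = 0
      · have : D c (x, τ x) = 0 := by simp [D, hx0]
        rw [this]; exact zero_mem G
      obtain ⟨k, hk⟩ := T.exists_int S hc hc0
      rcases lt_trichotomy k 0 with h | h | h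
      · exact hW _ _ _ ((TopOrbit.base hν hx).step ⟨k, h, hk⟩ hc)
      · have hκ : l κ = 0 := by simpa [h] using hk
        have h1 : ⁅c, τ x⁆ = τ ⁅c, x⁆ := by rw [LieEquiv.map_lie, hτ0 κ hκ c hc]
        change (⁅c, x⁆, ⁅c, τ x⁆) ∈ G
        rw [h1]
        by_cases hcx : ⁅c, x⁆ = 0
        · rw [hcx, map_zero]; exact zero_mem G
        · exact hW _ _ _ (.base (by
            change 2 * _ = _
            rw [S.l_add hc hx hcx, hκ, zero_add]; exact hν) (S.grading.lie_mem hc hx))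
      · have h1 := hkill _ _ c hc x hx k h hk hν
        have h2 := hkill _ _ c hc (τ x) (hτ _ _ hx N hν) k h hk (htop ν x hx hx0 hν)
        change (⁅c, x⁆, ⁅c, τ x⁆) ∈ G
        rw [h1, h2]
        exact zero_mem G
    | @step κ' ν y a b hκ' hy h ih =>
      intro κ c hc
      have h1 : D c (⁅y, a⁆, ⁅y, b⁆) = D y (D c (a, b)) + D ⁅c, y⁆ (a, b) := by
        change (⁅c, ⁅y, a⁆⁆, ⁅c, ⁅y, b⁆⁆)
          = (⁅y, ⁅c, a⁆⁆ + ⁅⁅c, y⁆, a⁆, ⁅y, ⁅c, b⁆⁆ + ⁅⁅c, y⁆, b⁆)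
        rw [leibniz_lie c y a, leibniz_lie c y b, add_comm, add_comm ⁅⁅c, y⁆, b⁆]
      rw [h1]
      exact add_mem (hneg _ hκ' _ hy _ (ih _ _ hc)) (ih _ _ (S.grading.lie_mem hc hy))
  -- The projection onto the top weight. Orbit steps land strictly below it, so `P` maps `G` into
  -- the graph of `τ`; hence `(0, x₀) ∉ G`.
  let P : L →ₗ[ℂ] L := S.grading.diag fun ν => if top ν then 1 else 0
  have hP1 : ∀ ν, ∀ x ∈ A ν, top ν → P x = x := fun ν x hx h => by
    simp [P, S.grading.diag_apply _ hx, h]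
  have hP0 : ∀ ν, ∀ x ∈ A ν, ¬ top ν → P x = 0 := fun ν x hx h => by
    simp [P, S.grading.diag_apply _ hx, h]
  have hlow : ∀ κ ν, neg κ → ∀ y ∈ A κ, ∀ a ∈ A ν, P ⁅y, a⁆ = 0 := by
    rintro κ ν ⟨k, hk, hκ⟩ y hy a ha
    by_cases h0 : ⁅y, a⁆ = 0
    · rw [h0, map_zero]
    refine hP0 _ _ (S.grading.lie_mem hy ha) fun h => ?_
    change 2 * l (κ + ν) = N * l α at h
    rw [S.l_add hy ha h0] at h
    have := hmax ν a ha (fun h => h0 (by rw [h, lie_zero])) (N - k) (by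
      push_cast; linear_combination h - hκ)
    omega
  have hPG : ∀ g ∈ G, P g.2 = τ (P g.1) := by
    intro g hg
    induction hg using Submodule.span_induction with
    | mem g hg =>
      obtain ⟨a, b⟩ := g
      obtain ⟨ν, h⟩ := hg
      change W ν a b at h
      change P b = τ (P a)
      cases h with
      | base hν hx =>
        by_cases hx0 : a = 0
        · simp [hx0]
        · rw [hP1 _ _ hx hν, hP1 _ _ (hτ _ _ hx N hν) (htop _ _ hx hx0 hν)]
      | step hκ hy h =>
        obtain ⟨h1, h2⟩ := hWmem _ _ _ h
        rw [hlow _ _ hκ _ hy _ h1, hlow _ _ hκ _ hy _ h2, map_zero]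
    | zero => simp
    | add g g' _ _ h h' => simp [h, h']
    | smul t g _ h => simp [h]
  refine S.simple.mem_centroidSupport_of_graph S.grading G ?_ ?_ ⟨x₀, fun h => ?_⟩
    ⟨(x₀, τ x₀), hW _ _ _ (.base hν₀ hx₀), by simpa using hx₀0⟩
  · intro c g hg
    change D c g ∈ G
    induction hg using Submodule.span_induction with
    | mem g hg =>
      obtain ⟨ν, h⟩ := hg
      refine S.grading.induction (P := fun c => D c g ∈ G) (fun κ c hc => hstab _ _ _ h κ c hc)
        ?_ (fun c c' h h' => ?_) c
      · simp [D]
      · have : D (c + c') g = D c g + D c' g := by simp [D]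
        rw [this]; exact add_mem h h'
    | zero => rw [map_zero]; exact zero_mem G
    | add g g' _ _ h h' => rw [map_add]; exact add_mem h h'
    | smul t g _ h => rw [map_smul]; exact G.smul_mem t h
  · intro g hg μ
    have : G ≤ G.comap ((S.grading.proj μ).prodMap (S.grading.proj (μ + ε))) := by
      refine Submodule.span_le.2 fun g ⟨ν, h⟩ => ?_
      obtain ⟨h1, h2⟩ := hWmem _ _ _ h
      change (S.grading.proj μ g.1, S.grading.proj (μ + ε) g.2) ∈ G
      by_cases hν : ν = μ
      · subst hν
        rw [S.grading.proj_same h1, S.grading.proj_same h2]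
        exact hW _ _ _ h
      · rw [S.grading.proj_ne h1 hν, S.grading.proj_ne h2 (by simpa using hν)]
        exact zero_mem G
    exact this hg
  · have := hPG _ h
    simp only [map_zero] at this
    rw [hP1 _ _ hx₀ hν₀] at this
    exact hx₀0 this

end Graph

/-! ### The subgroup `M` and finiteness of the support modulo `M` -/

section CentroidSupport

variable {Λ : Type u} [AddCommGroup Λ] {L : Type v} [LieRing L] [LieAlgebra ℂ L]
  {A : Λ → Submodule ℂ L} {h₀ : L} {l : Λ → ℂ}

theorem IsLieGrading.proj_add_apply (hA : IsLieGrading A) {ψ : Module.End ℂ L} {μ : Λ}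
    (hψ : ∀ m, ∀ x ∈ A m, ψ x ∈ A (m + μ)) (i : Λ) (x : L) :
    hA.proj (i + μ) (ψ x) = ψ (hA.proj i x) := by
  refine hA.linearMap_ext (φ := hA.proj (i + μ) ∘ₗ ψ) (ψ := ψ ∘ₗ hA.proj i)
    (fun j x hx => ?_) x
  simp only [LinearMap.comp_apply]
  by_cases h : j = i
  · subst h
    rw [hA.proj_same hx, hA.proj_same (hψ _ _ hx)]
  · rw [hA.proj_ne hx h, hA.proj_ne (hψ _ _ hx) (by simpa using h), map_zero]

/-- Schur's lemma: kernel and image are graded ideals. -/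
theorem IsSimpleGraded.bijective_of_mem_centroid (hs : IsSimpleGraded A) (hA : IsLieGrading A)
    {ψ : Module.End ℂ L} {μ : Λ} (hc : ψ ∈ centroid L) (h0 : ψ ≠ 0)
    (hψ : ∀ m, ∀ x ∈ A m, ψ x ∈ A (m + μ)) : Function.Bijective ψ := by
  let K : LieIdeal ℂ L :=
    { __ := LinearMap.ker ψ
      lie_mem := by
        intro c z hz
        change ψ ⁅c, z⁆ = 0
        rw [(hc c z).2, LinearMap.mem_ker.1 hz, lie_zero] }
  have hK : ∀ x, x ∈ K ↔ ψ x = 0 := fun x => Iff.rfl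
  let R : LieIdeal ℂ L :=
    { __ := LinearMap.range ψ
      lie_mem := by
        rintro c _ ⟨z, rfl⟩
        exact ⟨⁅c, z⁆, (hc c z).2⟩ }
  have hR : ∀ x, x ∈ R ↔ ∃ y, ψ y = x := fun x => Iff.rfl
  have hK0 : K = ⊥ := by
    refine (hs.eq_bot_or_eq_top K (hA.isGradedIdeal fun x hx i => ?_)).resolve_right fun h => ?_
    · rw [hK, ← hA.proj_add_apply hψ, (hK x).1 hx, map_zero]
    · exact h0 (LinearMap.ext fun x => (hK x).1 (h ▸ LieSubmodule.mem_top x))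
  have hR1 : R = ⊤ := by
    refine (hs.eq_bot_or_eq_top R (hA.isGradedIdeal fun x hx i => ?_)).resolve_left fun h => ?_
    · obtain ⟨y, rfl⟩ := (hR x).1 hx
      refine (hR _).2 ⟨hA.proj (i - μ) y, ?_⟩
      rw [← hA.proj_add_apply hψ, sub_add_cancel]
    · refine h0 (LinearMap.ext fun x => ?_)
      have : ψ x ∈ R := ⟨x, rfl⟩
      rwa [h, LieSubmodule.mem_bot] at this
  refine ⟨(injective_iff_map_eq_zero ψ).2 fun x hx => ?_, fun x => ?_⟩
  · have := (hK x).2 hx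
    rwa [hK0, LieSubmodule.mem_bot] at this
  · exact (hR x).1 (hR1 ▸ LieSubmodule.mem_top x)

theorem IsSimpleGraded.exists_ne_zero {ι : Type u} {B : ι → Submodule ℂ L}
    (hs : IsSimpleGraded B) : ∃ x : L, x ≠ 0 := by
  by_contra! h
  exact hs.non_abelian ⟨fun x y => h _⟩

/-- Nonzero homogeneous elements of the centroid are invertible in the centroid. -/
theorem IsSimpleGraded.exists_unit_of_mem_centroid (hs : IsSimpleGraded A) (hA : IsLieGrading A)
    {φ : Module.End ℂ L} {μ : Λ} (hφ : φ ∈ centroid L) (hφ0 : φ ≠ 0)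
    (hφ1 : ∀ m, ∀ x ∈ A m, φ x ∈ A (m + μ)) :
    ∃ u : (Module.End ℂ L)ˣ, (u : Module.End ℂ L) = φ ∧
      ((u⁻¹ : (Module.End ℂ L)ˣ) : Module.End ℂ L) ∈ centroid L ∧
      ∀ m, ∀ x ∈ A m, ((u⁻¹ : (Module.End ℂ L)ˣ) : Module.End ℂ L) x ∈ A (m - μ) := by
  have hb := hs.bijective_of_mem_centroid hA hφ hφ0 hφ1
  let e := LinearEquiv.ofBijective φ hb
  have he : ∀ x, φ (e.symm x) = x := fun x => e.apply_symm_apply x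
  have he' : ∀ x, e.symm (φ x) = x := fun x => e.symm_apply_apply x
  let u : (Module.End ℂ L)ˣ := ⟨φ, e.symm.toLinearMap, LinearMap.ext he, LinearMap.ext he'⟩
  have hu : ∀ x, ((u⁻¹ : (Module.End ℂ L)ˣ) : Module.End ℂ L) x = e.symm x := fun x => rfl
  refine ⟨u, rfl, fun a b => ⟨hb.1 ?_, hb.1 ?_⟩, fun m x hx => ?_⟩
  · rw [hu, hu, he, (hφ _ _).1, he]
  · rw [hu, hu, he, (hφ _ _).2, he]
  · have h1 := hA.proj_add_apply hφ1 (m - μ) (e.symm x)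
    rw [he, sub_add_cancel, hA.proj_same hx] at h1
    rw [hu, show e.symm x = hA.proj (m - μ) (e.symm x) from hb.1 (by rw [he, ← h1])]
    exact hA.proj_mem _ _

/-- The support of the centroid of a simple graded Lie algebra is a subgroup. -/
def centroidSubgroup (hA : IsLieGrading A) (hs : IsSimpleGraded A) : AddSubgroup Λ where
  carrier := centroidSupport A
  zero_mem' := by
    refine ⟨1, one_mem _, fun h => ?_, fun m x hx => by simpa using hx⟩
    obtain ⟨x, hx⟩ := hs.exists_ne_zero
    exact hx (LinearMap.congr_fun h x)
  add_mem' := by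
    rintro μ ν ⟨φ, hφ, hφ0, hφ1⟩ ⟨ψ, hψ, hψ0, hψ1⟩
    refine ⟨φ * ψ, mul_mem hφ hψ, fun h => ?_, fun m x hx => ?_⟩
    · obtain ⟨x, hx⟩ := hs.exists_ne_zero
      have h1 : φ (ψ x) = φ 0 := (LinearMap.congr_fun h x).trans (map_zero φ).symm
      have h2 := (hs.bijective_of_mem_centroid hA hφ hφ0 hφ1).1 h1
      exact hx ((hs.bijective_of_mem_centroid hA hψ hψ0 hψ1).1 (h2.trans (map_zero ψ).symm))
    · have := hφ1 _ _ (hψ1 m x hx)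
      rwa [add_assoc, add_comm ν μ] at this
  neg_mem' := by
    rintro μ ⟨φ, hφ, hφ0, hφ1⟩
    obtain ⟨u, -, h1, h2⟩ := hs.exists_unit_of_mem_centroid hA hφ hφ0 hφ1
    refine ⟨_, h1, fun h => ?_, fun m x hx => by simpa [sub_eq_add_neg] using h2 m x hx⟩
    obtain ⟨x, hx⟩ := hs.exists_ne_zero
    have h3 : ((u : Module.End ℂ L) * ((u⁻¹ : (Module.End ℂ L)ˣ) : Module.End ℂ L)) x = x := by
      simp
    rw [h, mul_zero] at h3
    exact hx h3.symm

theorem finite_torsionBy {P : Type u} [AddCommGroup P] [Module.Finite ℤ P] {n : ℤ} (hn : n ≠ 0) :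
    {p : P | n • p = 0}.Finite := by
  have : Module.Finite ℤ (Submodule.torsionBy ℤ P n) := inferInstance
  have : Module.IsTorsion ℤ (Submodule.torsionBy ℤ P n) := by
    rintro ⟨x, hx⟩
    exact ⟨⟨n, mem_nonZeroDivisors_of_ne_zero hn⟩, Subtype.ext (by simpa using hx)⟩
  have : Finite (Submodule.torsionBy ℤ P n) := Module.finite_of_fg_torsion _ this
  have h : ((Submodule.torsionBy ℤ P n : Submodule ℤ P) : Set P).Finite := Set.toFinite _
  refine h.subset fun x hx => ?_
  simpa using hx

open scoped Pointwise in
/-- The support is finite modulo the support of the centroid. -/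
theorem WeightSystem.finite_image_support [Module.Finite ℤ Λ] (S : WeightSystem A h₀ l) :
    ((QuotientAddGroup.mk : Λ → Λ ⧸ centroidSubgroup S.grading S.simple) '' support A).Finite := by
  set M := centroidSubgroup S.grading S.simple with hM
  have hfin : Module.Finite ℤ (Λ ⧸ M) :=
    Module.Finite.of_surjective (QuotientAddGroup.mk' M).toIntLinearMap
      (QuotientAddGroup.mk'_surjective M)
  have hsupp : ∀ ν ∈ support A, ∃ x ∈ A ν, x ≠ 0 := fun ν hν => (Submodule.ne_bot_iff _).1 hν
  obtain ⟨α, e, f, T⟩ := S.exists_triple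
  have hl := T.l_ne_zero
  obtain ⟨N, hN, -, hmax⟩ := T.exists_top S
  obtain ⟨N', hN', -, hmax'⟩ := (T.symm S).exists_top S
  let F : ℤ → Set Λ := fun k => {ν | ν ∈ support A ∧ 2 * l ν = k * l α}
  -- All degrees in `F k` belong to triples of one weight, so their differences from a fixed `ν` are
  -- killed by one integer `n` modulo `M`: the classes lie in a translate of a finite torsion group.
  have hF : ∀ k : ℤ, k ≠ 0 → ((QuotientAddGroup.mk : Λ → Λ ⧸ M) '' F k).Finite := by
    intro k hk
    rcases (F k).eq_empty_or_nonempty with h | ⟨ν, hν, hνk⟩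
    · simp [h]
    have hl0 : ∀ ν' ∈ F k, l ν' ≠ 0 := by
      rintro ν' ⟨-, h⟩ h0
      rw [h0, mul_zero, eq_comm] at h
      simp [hk, hl] at h
    obtain ⟨x, hx, hx0⟩ := hsupp ν hν
    obtain ⟨y, T₁⟩ := S.exists_isTriple_of_ne_zero (hl0 ν ⟨hν, hνk⟩) hx hx0
    obtain ⟨n, hn, hmem⟩ := T₁.exists_smul_sub_mem S
    refine ((finite_torsionBy (P := Λ ⧸ M) hn.ne').preimage
      (f := fun c => c - QuotientAddGroup.mk ν) (sub_left_injective.injOn)).subset ?_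
    rintro _ ⟨ν', hν', rfl⟩
    obtain ⟨x', hx', hx0'⟩ := hsupp ν' hν'.1
    obtain ⟨y', T₂⟩ := S.exists_isTriple_of_ne_zero (hl0 ν' hν') hx' hx0'
    have := hmem _ _ _ T₂ (by
      have := hν'.2.trans hνk.symm
      exact mul_left_cancel₀ two_ne_zero this)
    exact (QuotientAddGroup.eq_zero_iff (N := M) _).2 this
  let R : Set (Λ ⧸ M) := ⋃ k ∈ (Finset.Icc (-N') N).erase 0, QuotientAddGroup.mk '' F k
  have hR : R.Finite := Set.Finite.biUnion (Finset.finite_toSet _) fun k hk => hF k (by simp_all)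
  have hmem : ∀ ν ∈ support A, l ν ≠ 0 → (QuotientAddGroup.mk ν : Λ ⧸ M) ∈ R := by
    intro ν hν h0
    obtain ⟨x, hx, hx0⟩ := hsupp ν hν
    obtain ⟨k, hk⟩ := T.exists_int S hx hx0
    have h1 := hmax ν x hx hx0 k hk
    have h2 := hmax' ν x hx hx0 (-k) (by rw [hk, T.l_neg S]; push_cast; ring)
    refine Set.mem_biUnion (x := k) ?_ ⟨ν, ⟨hν, hk⟩, rfl⟩
    simp only [Finset.coe_erase, Finset.coe_Icc, Set.mem_sdiff, Set.mem_Icc, Set.mem_singleton_iff]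
    refine ⟨by omega, fun h => h0 ?_⟩
    simpa [h] using hk
  -- A degree of weight 0 is a sum of two degrees of nonzero weight, by `exists_lie_eq`.
  refine (hR.union (hR.add hR)).subset ?_
  rintro _ ⟨ν, hν, rfl⟩
  by_cases h0 : l ν = 0
  · right
    obtain ⟨x, hx, hx0⟩ := hsupp ν hν
    obtain ⟨β, p, hp, q, hq, hβ, rfl⟩ := S.exists_lie_eq h0 hx hx0
    have hp0 : p ≠ 0 := fun h => hx0 (by rw [h, zero_lie])
    have hq0 : q ≠ 0 := fun h => hx0 (by rw [h, lie_zero])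
    have hlq := S.l_add_of_eq hp hq hx0 (by abel : _ = ν)
    rw [h0] at hlq
    refine Set.mem_add.2 ⟨_, hmem β ((Submodule.ne_bot_iff _).2 ⟨p, hp, hp0⟩) hβ, _,
      hmem (ν - β) ((Submodule.ne_bot_iff _).2 ⟨q, hq, hq0⟩) fun h => hβ ?_, ?_⟩
    · rw [h, add_zero] at hlq
      exact hlq.symm
    · rw [← QuotientAddGroup.mk_add, add_sub_cancel]
  · exact Or.inl (hmem ν hν h0)

end CentroidSupport

/-! ### A multiplicative choice of centroid elements -/

section CentroidSection

variable {Λ : Type u} [AddCommGroup Λ] {L : Type v} [LieRing L] [LieAlgebra ℂ L]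
  {A : Λ → Submodule ℂ L}

theorem IsSimpleGraded.eq_zero_of_lie_eq_zero (hs : IsSimpleGraded A) (hA : IsLieGrading A)
    {ψ : Module.End ℂ L} {μ : Λ} (hc : ψ ∈ centroid L)
    (hψ : ∀ m, ∀ x ∈ A m, ψ x ∈ A (m + μ)) (h : ∀ a b : L, ψ ⁅a, b⁆ = 0) : ψ = 0 := by
  by_contra h0
  have hb := hs.bijective_of_mem_centroid hA hc h0 hψ
  exact hs.non_abelian ⟨fun a b => hb.1 ((h a b).trans (map_zero ψ).symm)⟩

/-- Homogeneous elements of the centroid commute. -/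
theorem IsSimpleGraded.mul_comm_of_mem_centroid (hs : IsSimpleGraded A) (hA : IsLieGrading A)
    {φ ψ : Module.End ℂ L} {μ ν : Λ} (hφ : φ ∈ centroid L) (hψ : ψ ∈ centroid L)
    (hφ1 : ∀ m, ∀ x ∈ A m, φ x ∈ A (m + μ)) (hψ1 : ∀ m, ∀ x ∈ A m, ψ x ∈ A (m + ν)) :
    φ * ψ = ψ * φ := by
  rw [← sub_eq_zero]
  refine hs.eq_zero_of_lie_eq_zero hA (μ := μ + ν)
    (sub_mem (mul_mem hφ hψ) (mul_mem hψ hφ)) (fun m x hx => ?_) fun a b => ?_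
  · refine sub_mem ?_ ?_
    · have := hφ1 _ _ (hψ1 m x hx)
      rwa [add_assoc, add_comm ν μ] at this
    · have := hψ1 _ _ (hφ1 m x hx)
      rwa [add_assoc] at this
  · simp only [LinearMap.sub_apply, Module.End.mul_apply]
    -- Both products send `[a, b]` to `[φ a, ψ b]`.
    rw [(hψ a b).2, (hφ _ _).1, (hφ a b).1, (hψ _ _).2, sub_self]

/-- A multiplicative choice of homogeneous elements of the centroid with degrees in `M`. -/
structure IsCentroidSection (A : Λ → Submodule ℂ L) (M : AddSubgroup Λ)
    (ψ : M → Module.End ℂ L) : Prop where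
  mem : ∀ μ, ψ μ ∈ centroid L
  homogeneous : ∀ (μ : M) (m : Λ), ∀ x ∈ A m, ψ μ x ∈ A (m + μ)
  zero : ψ 0 = 1
  add : ∀ μ ν, ψ (μ + ν) = ψ μ * ψ ν

/-- The group of the invertible homogeneous elements of the centroid, with their degrees. -/
def homogeneousUnits (A : Λ → Submodule ℂ L) :
    Subgroup (Multiplicative Λ × (Module.End ℂ L)ˣ) where
  carrier := {g | ((g.2 : Module.End ℂ L) ∈ centroid L ∧
      ∀ m, ∀ x ∈ A m, (g.2 : Module.End ℂ L) x ∈ A (m + g.1.toAdd)) ∧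
    (((g.2⁻¹ : (Module.End ℂ L)ˣ) : Module.End ℂ L) ∈ centroid L ∧
      ∀ m, ∀ x ∈ A m, ((g.2⁻¹ : (Module.End ℂ L)ˣ) : Module.End ℂ L) x ∈ A (m - g.1.toAdd))}
  one_mem' := by
    refine ⟨⟨one_mem _, fun m x hx => ?_⟩, by simp, fun m x hx => ?_⟩
    · simpa using hx
    · simpa using hx
  mul_mem' := by
    rintro g h ⟨⟨g1, g2⟩, g3, g4⟩ ⟨⟨h1, h2⟩, h3, h4⟩
    refine ⟨⟨mul_mem g1 h1, fun m x hx => ?_⟩, ?_, fun m x hx => ?_⟩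
    · have := g2 _ _ (h2 m x hx)
      rwa [add_assoc, add_comm h.1.toAdd] at this
    · rw [Prod.snd_mul, mul_inv_rev]
      exact mul_mem h3 g3
    · rw [Prod.snd_mul, mul_inv_rev]
      have := h4 _ _ (g4 m x hx)
      rwa [sub_sub] at this
  inv_mem' := by
    rintro g ⟨⟨g1, g2⟩, g3, g4⟩
    refine ⟨⟨g3, fun m x hx => ?_⟩, by simpa using g1, fun m x hx => ?_⟩
    · simpa [sub_eq_add_neg] using g4 m x hx
    · simpa using g2 m x hx

theorem exists_isCentroidSection [Module.Free ℤ Λ] [Module.Finite ℤ Λ] (hA : IsLieGrading A)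
    (hs : IsSimpleGraded A) : ∃ ψ, IsCentroidSection A (centroidSubgroup hA hs) ψ := by
  set M := centroidSubgroup hA hs
  let _ : CommGroup (homogeneousUnits A) :=
    { (inferInstance : Group (homogeneousUnits A)) with
      mul_comm := fun g h => Subtype.ext (Prod.ext (mul_comm _ _) (Units.ext
        (hs.mul_comm_of_mem_centroid hA g.2.1.1 h.2.1.1 g.2.1.2 h.2.1.2))) }
  have hdeg : ∀ g : homogeneousUnits A, g.1.1.toAdd ∈ M := by
    intro g
    refine ⟨(g.1.2 : Module.End ℂ L), g.2.1.1, fun h => ?_, g.2.1.2⟩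
    obtain ⟨x, hx⟩ := hs.exists_ne_zero
    have h1 : (((g.1.2⁻¹ : (Module.End ℂ L)ˣ) : Module.End ℂ L) * (g.1.2 : Module.End ℂ L)) x
      = x := by simp
    rw [h, mul_zero] at h1
    exact hx h1.symm
  let deg : Additive (homogeneousUnits A) →ₗ[ℤ] M :=
    AddMonoidHom.toIntLinearMap (M := Additive (homogeneousUnits A)) (M₂ := M)
      { toFun := fun g => ⟨g.toMul.1.1.toAdd, hdeg _⟩
        map_zero' := rfl
        map_add' := fun _ _ => rfl }
  have hsurj : Function.Surjective deg := by
    rintro ⟨μ, φ, hφ, hφ0, hφ1⟩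
    obtain ⟨u, rfl, h1, h2⟩ := hs.exists_unit_of_mem_centroid hA hφ hφ0 hφ1
    exact ⟨Additive.ofMul ⟨(Multiplicative.ofAdd μ, u), ⟨hφ, hφ1⟩, h1, h2⟩, rfl⟩
  -- As a subgroup of a free group of finite rank `M` is free, hence projective, so the degree map
  -- on homogeneous units splits.
  have : Module.Free ℤ M := inferInstanceAs (Module.Free ℤ (AddSubgroup.toIntSubmodule M))
  obtain ⟨s, hs⟩ := Module.projective_lifting_property deg LinearMap.id hsurj
  have hs' : ∀ μ, (s μ).toMul.1.1.toAdd = (μ : Λ) := fun μ =>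
    congrArg Subtype.val (LinearMap.congr_fun hs μ)
  refine ⟨fun μ => ((s μ).toMul.1.2 : Module.End ℂ L), fun μ => (s μ).toMul.2.1.1,
    fun μ m x hx => ?_, ?_, fun μ ν => ?_⟩
  · have := (s μ).toMul.2.1.2 m x hx
    rwa [hs'] at this
  · rw [map_zero]; rfl
  · rw [map_add]; rfl

end CentroidSection

/-! ### The quotient in which the chosen centroid elements become 1 -/

section Specialization

variable {Λ : Type u} [AddCommGroup Λ] {L : Type v} [LieRing L] [LieAlgebra ℂ L]
  {A : Λ → Submodule ℂ L} {M : AddSubgroup Λ} {ψ : M → Module.End ℂ L}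

namespace IsCentroidSection

theorem neg_apply (hψ : IsCentroidSection A M ψ) (μ : M) (x : L) : ψ (-μ) (ψ μ x) = x := by
  rw [← Module.End.mul_apply, ← hψ.add, neg_add_cancel, hψ.zero, Module.End.one_apply]

theorem eq_zero (hψ : IsCentroidSection A M ψ) {μ : M} {x : L} (h : ψ μ x = 0) : x = 0 := by
  rw [← hψ.neg_apply μ x, h, map_zero]

end IsCentroidSection

/-- The difference between the chosen representative of the class of `m` and `m`. -/
noncomputable def shift (M : AddSubgroup Λ) (m : Λ) : M :=
  ⟨(QuotientAddGroup.mk m : Λ ⧸ M).out - m, by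
    rw [← QuotientAddGroup.eq_zero_iff, QuotientAddGroup.mk_sub, QuotientAddGroup.out_eq',
      sub_self]⟩

theorem add_shift (m : Λ) : m + shift M m = (QuotientAddGroup.mk m : Λ ⧸ M).out := by
  simp [shift]

theorem shift_add (m : Λ) (μ : M) : shift M (m + μ) + μ = shift M m := by
  apply Subtype.ext
  have : (QuotientAddGroup.mk (m + μ) : Λ ⧸ M) = QuotientAddGroup.mk m := by
    rw [QuotientAddGroup.mk_add, (QuotientAddGroup.eq_zero_iff (μ : Λ)).2 μ.2, add_zero]
  simp only [shift, AddSubgroup.coe_add, this]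
  abel

/-- The projection onto the sum of the components of the chosen degrees modulo `M` along a
multiplicative choice of elements of the centroid. -/
noncomputable def IsLieGrading.reduce (hA : IsLieGrading A) (ψ : M → Module.End ℂ L) : L →ₗ[ℂ] L :=
  hA.lift fun m => ψ (shift M m)

namespace IsCentroidSection

theorem reduce_apply (hA : IsLieGrading A) {m : Λ} {x : L} (hx : x ∈ A m) :
    hA.reduce ψ x = ψ (shift M m) x :=
  hA.lift_apply _ hx

theorem reduce_map (hψ : IsCentroidSection A M ψ) (hA : IsLieGrading A) (μ : M) (x : L) :
    hA.reduce ψ (ψ μ x) = hA.reduce ψ x := by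
  refine hA.linearMap_ext (φ := hA.reduce ψ ∘ₗ ψ μ) (fun m x hx => ?_) x
  rw [LinearMap.comp_apply, reduce_apply hA hx, reduce_apply hA (hψ.homogeneous μ m x hx),
    ← Module.End.mul_apply, ← hψ.add, shift_add]

theorem reduce_mem (hψ : IsCentroidSection A M ψ) (hA : IsLieGrading A) {c : Λ ⧸ M} {x : L}
    (hx : x ∈ A c.out) : hA.reduce ψ x ∈ A c.out := by
  rw [reduce_apply hA hx]
  have := hψ.homogeneous (shift M c.out) _ _ hx
  rwa [add_shift, QuotientAddGroup.out_eq'] at this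

theorem reduce_reduce (hψ : IsCentroidSection A M ψ) (hA : IsLieGrading A) (x : L) :
    hA.reduce ψ (hA.reduce ψ x) = hA.reduce ψ x := by
  refine hA.linearMap_ext (φ := hA.reduce ψ ∘ₗ hA.reduce ψ) (fun m x hx => ?_) x
  rw [LinearMap.comp_apply, reduce_apply hA hx, hψ.reduce_map hA, reduce_apply hA hx]

/-- This makes the kernel of `reduce` an ideal: `ψ` passes through brackets and `reduce` absorbs it.
-/
theorem reduce_lie_reduce (hψ : IsCentroidSection A M ψ) (hA : IsLieGrading A) (c x : L) :
    hA.reduce ψ ⁅c, hA.reduce ψ x⁆ = hA.reduce ψ ⁅c, x⁆ := by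
  refine hA.linearMap_ext (φ := hA.reduce ψ ∘ₗ LieAlgebra.ad ℂ L c ∘ₗ hA.reduce ψ)
    (ψ := hA.reduce ψ ∘ₗ LieAlgebra.ad ℂ L c) (fun m x hx => ?_) x
  simp only [LinearMap.comp_apply, LieAlgebra.ad_apply]
  rw [reduce_apply hA hx, ← (hψ.mem _ c x).2, hψ.reduce_map hA]

/-- The kernel of the reduction; it is spanned by the elements `ψ μ x - x`. -/
noncomputable def kernel (hψ : IsCentroidSection A M ψ) (hA : IsLieGrading A) : LieIdeal ℂ L :=
  { __ := LinearMap.ker (hA.reduce ψ)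
    lie_mem := by
      intro c x hx
      change hA.reduce ψ ⁅c, x⁆ = 0
      rw [← hψ.reduce_lie_reduce hA, LinearMap.mem_ker.1 hx, lie_zero, map_zero] }

theorem mem_kernel (hψ : IsCentroidSection A M ψ) (hA : IsLieGrading A) {x : L} :
    x ∈ hψ.kernel hA ↔ hA.reduce ψ x = 0 :=
  Iff.rfl

/-- The specialization of `L` at the character of the centroid given by `ψ`. -/
abbrev Specialization (hψ : IsCentroidSection A M ψ) (hA : IsLieGrading A) : Type v :=
  L ⧸ hψ.kernel hA

/-- The natural projection of `L` onto its specialization. -/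
noncomputable def proj (hψ : IsCentroidSection A M ψ) (hA : IsLieGrading A) :
    L →ₗ⁅ℂ⁆ hψ.Specialization hA :=
  { LieSubmodule.Quotient.mk' (hψ.kernel hA) with
    map_lie' := fun {_ _} => rfl }

variable (hψ : IsCentroidSection A M ψ) (hA : IsLieGrading A)

theorem proj_surjective : Function.Surjective (hψ.proj hA) :=
  LieSubmodule.Quotient.surjective_mk' _

theorem proj_eq_zero_iff {x : L} : hψ.proj hA x = 0 ↔ hA.reduce ψ x = 0 :=
  LieSubmodule.Quotient.mk_eq_zero'.trans (hψ.mem_kernel hA)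

theorem proj_eq_iff {x y : L} : hψ.proj hA x = hψ.proj hA y ↔ hA.reduce ψ x = hA.reduce ψ y := by
  rw [← sub_eq_zero, ← map_sub, proj_eq_zero_iff, map_sub, sub_eq_zero]

/-- The linear section of the projection that is given by the reduction. -/
noncomputable def repr : hψ.Specialization hA →ₗ[ℂ] L :=
  (hψ.kernel hA).toSubmodule.liftQ (hA.reduce ψ) fun _ hx => hx

theorem repr_proj (x : L) : hψ.repr hA (hψ.proj hA x) = hA.reduce ψ x := rfl

theorem proj_repr (y : hψ.Specialization hA) : hψ.proj hA (hψ.repr hA y) = y := by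
  obtain ⟨x, rfl⟩ := hψ.proj_surjective hA y
  rw [repr_proj, proj_eq_iff, hψ.reduce_reduce hA]

theorem proj_map (μ : M) (x : L) : hψ.proj hA (ψ μ x) = hψ.proj hA x := by
  rw [proj_eq_iff, hψ.reduce_map hA]

/-- On one component `reduce` is a single invertible operator `ψ μ`. -/
theorem proj_injOn {m : Λ} {x : L} (hx : x ∈ A m) (h : hψ.proj hA x = 0) : x = 0 := by
  rw [proj_eq_zero_iff, reduce_apply hA hx] at h
  exact hψ.eq_zero h

/-- The grading of the specialization by the quotient group. -/
noncomputable def grading (c : Λ ⧸ M) : Submodule ℂ (hψ.Specialization hA) :=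
  (A c.out).map (hψ.proj hA : L →ₗ[ℂ] hψ.Specialization hA)

theorem proj_mem {m : Λ} {x : L} (hx : x ∈ A m) :
    hψ.proj hA x ∈ hψ.grading hA (QuotientAddGroup.mk m) := by
  refine ⟨ψ (shift M m) x, ?_, hψ.proj_map hA _ x⟩
  rw [← add_shift]
  exact hψ.homogeneous _ _ _ hx

theorem grading_mk (m : Λ) : hψ.grading hA (QuotientAddGroup.mk m)
    = (A m).map (hψ.proj hA : L →ₗ[ℂ] hψ.Specialization hA) := by
  refine le_antisymm ?_ ?_
  · rintro _ ⟨x, hx, rfl⟩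
    refine ⟨ψ (-shift M m) x, ?_, hψ.proj_map hA _ x⟩
    have := hψ.homogeneous (-shift M m) _ _ hx
    rwa [← add_shift, AddSubgroup.coe_neg, add_neg_cancel_right] at this
  · rintro _ ⟨x, hx, rfl⟩
    exact hψ.proj_mem hA hx

theorem iSup_grading : ⨆ c, hψ.grading hA c = ⊤ := by
  rw [eq_top_iff]
  rintro y -
  obtain ⟨x, rfl⟩ := hψ.proj_surjective hA y
  refine hA.induction (P := fun x => hψ.proj hA x ∈ ⨆ c, hψ.grading hA c)
    (fun m x hx => Submodule.mem_iSup_of_mem _ (hψ.proj_mem hA hx)) (by simp)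
    (fun x y hx hy => by rw [map_add]; exact add_mem hx hy) x

theorem isLieGrading : IsLieGrading (hψ.grading hA) where
  bracket_mem {c d x y} hx hy := by
    obtain ⟨a, ha, rfl⟩ := hx
    obtain ⟨b, hb, rfl⟩ := hy
    have := hψ.proj_mem hA (hA.lie_mem ha hb)
    rw [QuotientAddGroup.mk_add, QuotientAddGroup.out_eq', QuotientAddGroup.out_eq'] at this
    rw [LieHom.map_lie] at this
    exact this
  isInternal := by
    refine (@DirectSum.isInternal_submodule_iff_iSupIndep_and_iSup_eq_top _ _ _
      (fun a b => Classical.propDecidable (a = b)) _ _ _ _).2 ⟨fun c => ?_, hψ.iSup_grading hA⟩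
    have hq : ∀ x, (hA.proj c.out ∘ₗ hψ.repr hA) (hψ.proj hA x)
        = hA.proj c.out (hA.reduce ψ x) := fun x => rfl
    rw [Submodule.disjoint_def]
    rintro _ ⟨x, hx, rfl⟩ hx'
    have h1 : ⨆ j, ⨆ (_ : j ≠ c), hψ.grading hA j ≤ LinearMap.ker (hA.proj c.out ∘ₗ hψ.repr hA) := by
      refine iSup₂_le fun d hd => ?_
      rintro _ ⟨x, hx, rfl⟩
      rw [LinearMap.mem_ker]
      refine (hq x).trans ?_
      exact hA.proj_ne (reduce_mem hψ hA hx) fun h => hd (by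
        rw [← QuotientAddGroup.out_eq' d, ← QuotientAddGroup.out_eq' c, h])
    have h2 := (hq x).symm.trans (h1 hx')
    rw [hA.proj_same (reduce_mem hψ hA hx)] at h2
    exact (hψ.proj_eq_zero_iff hA).2 h2

theorem isSimpleGraded (hs : IsSimpleGraded A) : IsSimpleGraded (hψ.grading hA) where
  non_abelian h := by
    refine hs.non_abelian ⟨fun x y => ?_⟩
    refine hA.induction (P := fun x => ⁅x, y⁆ = 0) (fun i x hx => ?_) (by simp)
      (fun x x' h h' => by simp [h, h']) x
    refine hA.induction (P := fun y => ⁅x, y⁆ = 0) (fun j y hy => ?_) (by simp)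
      (fun y y' h h' => by simp [h, h']) y
    refine hψ.proj_injOn hA (hA.lie_mem hx hy) ?_
    rw [LieHom.map_lie]
    exact h.trivial _ _
  eq_bot_or_eq_top I hI := by
    let K : Λ → Submodule ℂ L := fun m =>
      A m ⊓ I.toSubmodule.comap (hψ.proj hA : L →ₗ[ℂ] hψ.Specialization hA)
    have hK : ∀ m x, x ∈ K m ↔ x ∈ A m ∧ hψ.proj hA x ∈ I := fun m x => Iff.rfl
    rcases hs.family_dichotomy hA K (fun m => inf_le_left) (fun i j x hx y hy => by
      rw [hK] at hy ⊢
      refine ⟨hA.lie_mem hx hy.1, ?_⟩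
      rw [LieHom.map_lie]
      exact I.lie_mem hy.2) with h | h
    · left
      rw [← LieSubmodule.toSubmodule_eq_bot, hI, iSup_eq_bot]
      intro c
      rw [eq_bot_iff]
      rintro _ ⟨hy, x, hx, rfl⟩
      have : x ∈ K c.out := ⟨hx, hy⟩
      rw [h, Submodule.mem_bot] at this
      simp [this]
    · right
      rw [eq_top_iff]
      rintro y -
      obtain ⟨x, rfl⟩ := hψ.proj_surjective hA y
      refine hA.induction (P := fun x => hψ.proj hA x ∈ I) (fun m x hx => ?_) (by simp)
        (fun x y hx hy => by rw [map_add]; exact add_mem hx hy) x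
      have : x ∈ K m := (h m).symm ▸ hx
      exact this.2

theorem isClassG' (hC : IsClassG' A) : IsClassG' (hψ.grading hC.grading) where
  grading := hψ.isLieGrading _
  simple := hψ.isSimpleGraded _ hC.simple
  rank_le_one c := (rank_map_le _ _).trans (hC.rank_le_one c.out)
  rank_zero := by
    have h0 : hψ.grading hC.grading 0 = _ := hψ.grading_mk hC.grading 0
    rw [h0]
    refine le_antisymm ?_ ?_
    · exact hC.rank_zero ▸ rank_map_le _ _
    · have h1 : 0 < Module.rank ℂ (A 0) := by rw [hC.rank_zero]; exact zero_lt_one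
      obtain ⟨⟨x, hx⟩, hx0⟩ := rank_pos_iff_exists_ne_zero.1 h1
      rw [Cardinal.one_le_iff_pos, rank_pos_iff_exists_ne_zero]
      refine ⟨⟨hψ.proj hC.grading x, x, hx, rfl⟩, fun h => hx0 (Subtype.ext ?_)⟩
      exact hψ.proj_injOn hC.grading hx (congrArg Subtype.val h)
  closure_support := by
    rw [eq_top_iff]
    rintro c -
    obtain ⟨m, rfl⟩ := QuotientAddGroup.mk_surjective c
    have hm : m ∈ AddSubgroup.closure (support A) := hC.closure_support ▸ AddSubgroup.mem_top m
    have := AddSubgroup.mem_map_of_mem (QuotientAddGroup.mk' M) hm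
    rw [AddMonoidHom.map_closure] at this
    refine AddSubgroup.closure_mono ?_ this
    rintro _ ⟨ν, hν, rfl⟩
    obtain ⟨x, hx, hx0⟩ := (Submodule.ne_bot_iff _).1 hν
    exact (Submodule.ne_bot_iff _).2 ⟨_, hψ.proj_mem hC.grading hx,
      fun h => hx0 (hψ.proj_injOn hC.grading hx h)⟩

theorem support_grading : support (hψ.grading hA) = QuotientAddGroup.mk '' support A := by
  ext c
  constructor
  · intro hc
    refine ⟨c.out, fun h => hc ?_, QuotientAddGroup.out_eq' c⟩
    rw [grading, h, Submodule.map_bot]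
  · rintro ⟨ν, hν, rfl⟩
    obtain ⟨x, hx, hx0⟩ := (Submodule.ne_bot_iff _).1 hν
    exact (Submodule.ne_bot_iff _).2 ⟨_, hψ.proj_mem hA hx, fun h => hx0 (hψ.proj_injOn hA hx h)⟩

theorem finiteDimensional (hC : IsClassG' A)
    (hfin : ((QuotientAddGroup.mk : Λ → Λ ⧸ M) '' support A).Finite) :
    FiniteDimensional ℂ (hψ.Specialization hC.grading) := by
  have hg := hψ.isClassG' hC
  have h1 : ∀ c, FiniteDimensional ℂ (hψ.grading hC.grading c) := fun c =>
    Module.rank_lt_aleph0_iff.1 ((hg.rank_le_one c).trans_lt Cardinal.one_lt_aleph0)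
  rw [← hψ.support_grading hC.grading] at hfin
  have := hfin.to_subtype
  have h2 : ⨆ c : support (hψ.grading hC.grading), hψ.grading hC.grading c = ⊤ := by
    rw [eq_top_iff, ← hψ.iSup_grading hC.grading]
    refine iSup_le fun c => ?_
    by_cases hc : c ∈ support (hψ.grading hC.grading)
    · exact le_iSup (fun c : support (hψ.grading hC.grading) => hψ.grading hC.grading c) ⟨c, hc⟩
    · rw [not_not.1 hc]; exact bot_le
  have h3 := Submodule.finiteDimensional_iSup
    fun c : support (hψ.grading hC.grading) => hψ.grading hC.grading c
  rw [h2] at h3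
  exact Module.finite_def.2 ((Submodule.fg_iff_finiteDimensional _).2 h3)

end IsCentroidSection

end Specialization

/-! ### Recovery of `L` as a pullback -/

section Embedding

variable {Λ : Type u} [AddCommGroup Λ] {L : Type v} [LieRing L] [LieAlgebra ℂ L]
  {A : Λ → Submodule ℂ L} {M : AddSubgroup Λ} {ψ : M → Module.End ℂ L}

namespace IsCentroidSection

variable (hψ : IsCentroidSection A M ψ) (hA : IsLieGrading A)

/-- The map from `L` to the loop algebra of its specialization. -/
noncomputable def toLoop : L →ₗ[ℂ] LieAlgebra.loopAlgebra ℂ Λ (hψ.Specialization hA) :=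
  hA.lift fun m => TensorProduct.mk ℂ (AddMonoidAlgebra ℂ Λ) (hψ.Specialization hA)
    (AddMonoidAlgebra.single m 1) ∘ₗ (hψ.proj hA : L →ₗ[ℂ] hψ.Specialization hA)

theorem toLoop_apply {m : Λ} {x : L} (hx : x ∈ A m) :
    hψ.toLoop hA x = AddMonoidAlgebra.single m 1 ⊗ₜ[ℂ] hψ.proj hA x :=
  hA.lift_apply _ hx

theorem toLoop_lie (x y : L) : hψ.toLoop hA ⁅x, y⁆ = ⁅hψ.toLoop hA x, hψ.toLoop hA y⁆ := by
  refine hA.induction (P := fun x => hψ.toLoop hA ⁅x, y⁆ = ⁅hψ.toLoop hA x, hψ.toLoop hA y⁆)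
    (fun i x hx => ?_) (by rw [zero_lie, map_zero]; exact (zero_lie (hψ.toLoop hA y)).symm)
    (fun x x' h h' => by rw [add_lie, map_add, h, h', map_add]; exact
      (add_lie (hψ.toLoop hA x) (hψ.toLoop hA x') (hψ.toLoop hA y)).symm) x
  refine hA.induction (P := fun y => hψ.toLoop hA ⁅x, y⁆ = ⁅hψ.toLoop hA x, hψ.toLoop hA y⁆)
    (fun j y hy => ?_) (by rw [lie_zero, map_zero]; exact (lie_zero (hψ.toLoop hA x)).symm)
    (fun y y' h h' => by rw [lie_add, map_add, h, h', map_add]; exact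
      (lie_add (hψ.toLoop hA x) (hψ.toLoop hA y) (hψ.toLoop hA y')).symm) y
  rw [hψ.toLoop_apply hA hx, hψ.toLoop_apply hA hy, hψ.toLoop_apply hA (hA.lie_mem hx hy),
    LieHom.map_lie]
  simp [AddMonoidAlgebra.single_mul_single]

theorem toLoop_injective : Function.Injective (hψ.toLoop hA) := by
  rw [injective_iff_map_eq_zero]
  intro x hx
  refine hA.eq_zero_of_proj fun i => hψ.proj_injOn hA (hA.proj_mem i x) ?_
  -- The coefficient at `e^i` is the image of the component of degree `i`.
  have h : ∀ x, Finsupp.lapply (R := ℂ) i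
      (LieAlgebra.LoopAlgebra.toFinsupp ℂ Λ (hψ.Specialization hA) (hψ.toLoop hA x))
      = hψ.proj hA (hA.proj i x) := by
    refine hA.linearMap_ext (φ := Finsupp.lapply (R := ℂ) i ∘ₗ
      (LieAlgebra.LoopAlgebra.toFinsupp ℂ Λ (hψ.Specialization hA)).toLinearMap ∘ₗ hψ.toLoop hA)
      (ψ := (hψ.proj hA : L →ₗ[ℂ] hψ.Specialization hA) ∘ₗ hA.proj i) fun m x hx => ?_
    simp only [LinearMap.comp_apply, LinearEquiv.coe_coe, LieHom.coe_toLinearMap]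
    rw [hψ.toLoop_apply hA hx, LieAlgebra.LoopAlgebra.toFinsupp_single_tmul, Finsupp.lapply_apply]
    by_cases hm : m = i
    · subst hm
      rw [Finsupp.single_eq_same, hA.proj_same hx]
    · rw [hA.proj_ne hx hm, map_zero, Finsupp.single_eq_of_ne (Ne.symm hm)]
  rw [← h, hx, map_zero, map_zero]

theorem map_toLoop (m : Λ) : (A m).map (hψ.toLoop hA)
    = pullbackPiece (QuotientAddGroup.mk' M) (hψ.grading hA) m := by
  have h0 : hψ.grading hA (QuotientAddGroup.mk' M m) = _ := hψ.grading_mk hA m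
  rw [pullbackPiece, h0]
  ext y
  constructor
  · rintro ⟨x, hx, rfl⟩
    exact ⟨_, ⟨x, hx, rfl⟩, (hψ.toLoop_apply hA hx).symm⟩
  · rintro ⟨_, ⟨x, hx, rfl⟩, rfl⟩
    exact ⟨x, hx, hψ.toLoop_apply hA hx⟩

/-- A graded Lie algebra with a multiplicative choice of elements of the centroid is the pullback
of its specialization. -/
theorem isGradedIsomorphic (hB : IsLieGrading (hψ.grading hA)) :
    IsGradedIsomorphic A (pullbackGrading (QuotientAddGroup.mk' M) hB) := by
  have hmem : ∀ x, hψ.toLoop hA x ∈ pullback (QuotientAddGroup.mk' M) hB := by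
    intro x
    refine hA.induction (P := fun x => hψ.toLoop hA x ∈ pullback (QuotientAddGroup.mk' M) hB)
      (fun m x hx => ?_) (by simp) (fun x y hx hy => by rw [map_add]; exact add_mem hx hy) x
    exact Submodule.mem_iSup_of_mem m (hψ.map_toLoop hA m ▸ Submodule.mem_map_of_mem hx)
  let Φ : L →ₗ⁅ℂ⁆ pullback (QuotientAddGroup.mk' M) hB :=
    { toFun := fun x => ⟨hψ.toLoop hA x, hmem x⟩
      map_add' := fun x y => Subtype.ext (map_add _ x y)
      map_smul' := fun t x => Subtype.ext (map_smul _ t x)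
      map_lie' := fun {x y} => Subtype.ext (hψ.toLoop_lie hA x y) }
  have hΦ : Function.Bijective Φ := by
    refine ⟨fun x y h => hψ.toLoop_injective hA (congrArg Subtype.val h), ?_⟩
    rintro ⟨y, hy⟩
    change y ∈ ⨆ m, pullbackPiece (QuotientAddGroup.mk' M) (hψ.grading hA) m at hy
    have h1 : ⨆ m, pullbackPiece (QuotientAddGroup.mk' M) (hψ.grading hA) m
        ≤ LinearMap.range (hψ.toLoop hA) := by
      refine iSup_le fun m => ?_
      rw [← hψ.map_toLoop hA]
      exact LinearMap.map_le_range
    obtain ⟨x, rfl⟩ := h1 hy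
    exact ⟨x, rfl⟩
  refine ⟨LieEquiv.ofBijective Φ hΦ, fun m => ?_⟩
  ext y
  rw [pullbackGrading, Submodule.mem_comap, ← hψ.map_toLoop hA]
  constructor
  · rintro ⟨x, hx, rfl⟩
    exact ⟨x, hx, rfl⟩
  · rintro ⟨x, hx, h⟩
    exact ⟨x, hx, Subtype.ext h⟩

end IsCentroidSection

end Embedding

/-! ### From simple graded to simple -/

section Simplicity

variable {Λ : Type u} [AddCommGroup Λ] {L : Type v} [LieRing L] [LieAlgebra ℂ L]
  {A : Λ → Submodule ℂ L}

theorem IsLieGrading.finite_support (hA : IsLieGrading A) (x : L) :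
    {i | hA.proj i x ≠ 0}.Finite := by
  refine hA.induction (P := fun x => {i | hA.proj i x ≠ 0}.Finite) (fun i x hx => ?_) (by simp)
    (fun x y hx hy => (hx.union hy).subset fun i hi => ?_) x
  · refine (Set.finite_singleton i).subset fun j hj => ?_
    by_contra h
    exact hj (hA.proj_ne hx (Ne.symm h))
  · by_contra h
    simp only [Set.mem_union, Set.mem_ofPred_eq, not_or, not_not] at h
    exact hi (by rw [map_add, h.1, h.2, add_zero])

theorem IsLieGrading.proj_lie (hA : IsLieGrading A) {κ : Λ} {c : L} (hc : c ∈ A κ) (i : Λ)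
    (x : L) : hA.proj (i + κ) ⁅c, x⁆ = ⁅c, hA.proj i x⁆ :=
  hA.proj_add_apply (ψ := LieAlgebra.ad ℂ L c)
    (fun _ _ hx => hA.lie_mem_of_eq hc hx (add_comm _ _)) i x

/-- The elements obtained from `r` by repeated brackets with homogeneous elements, with the total
degree of these. -/
inductive HomogeneousOrbit (A : Λ → Submodule ℂ L) (r : L) : Λ → L → Prop
  | base : HomogeneousOrbit A r 0 r
  | step {κ δ : Λ} {y x : L} (hy : y ∈ A κ) (h : HomogeneousOrbit A r δ x) :
      HomogeneousOrbit A r (δ + κ) ⁅y, x⁆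

/-- An element of an ideal with the minimal number of components is homogeneous, if the centroid is
concentrated in degree `0`. -/
theorem IsSimpleGraded.proj_eq_zero_of_minimal (hs : IsSimpleGraded A) (hA : IsLieGrading A)
    (hC : ∀ ε ∈ centroidSupport A, ε = 0) (I : LieIdeal ℂ L) {r : L} (hr : r ∈ I)
    (hmin : ∀ x ∈ I, x ≠ 0 → {i | hA.proj i r ≠ 0}.ncard ≤ {i | hA.proj i x ≠ 0}.ncard)
    {c d : Λ} (hcd : c ≠ d) (hc : hA.proj c r ≠ 0) : hA.proj d r = 0 := by
  by_contra hd
  have horb : ∀ δ x, HomogeneousOrbit A r δ x →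
      x ∈ I ∧ ∀ i, hA.proj i r = 0 → hA.proj (i + δ) x = 0 := by
    intro δ x h
    induction h with
    | base => exact ⟨hr, fun i hi => by rwa [add_zero]⟩
    | step hy h ih =>
      refine ⟨I.lie_mem ih.1, fun i hi => ?_⟩
      rw [← add_assoc, hA.proj_lie hy, ih.2 i hi, lie_zero]
  -- The correspondence that takes the component of `r` at `c` to that at `d`, propagated by
  -- brackets. Being a graph, it yields a centroid element of degree `d - c`.
  let G : Submodule ℂ (L × L) := Submodule.span ℂ
    {g | ∃ δ x, HomogeneousOrbit A r δ x ∧ g = (hA.proj (c + δ) x, hA.proj (d + δ) x)}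
  have hG : ∀ δ x, HomogeneousOrbit A r δ x → (hA.proj (c + δ) x, hA.proj (d + δ) x) ∈ G :=
    fun δ x h => Submodule.subset_span ⟨δ, x, h, rfl⟩
  -- In degrees `(c, d)` a pair of `G` is realised by an element of `I` supported inside the support
  -- of `r`. For the pair of 0 and the component of `r` at `d`, it would have fewer components than
  -- `r`.
  have hlift : ∀ g ∈ G, ∃ x ∈ I, (∀ i, hA.proj i r = 0 → hA.proj i x = 0) ∧
      hA.proj c x = hA.proj c g.1 ∧ hA.proj d x = hA.proj d g.2 := by
    intro g hg
    induction hg using Submodule.span_induction with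
    | mem g hg =>
      obtain ⟨δ, x, h, rfl⟩ := hg
      by_cases hδ : δ = 0
      · subst hδ
        refine ⟨x, (horb _ _ h).1, fun i hi => ?_, ?_, ?_⟩
        · simpa using (horb _ _ h).2 i hi
        · simp [hA.proj_same (hA.proj_mem c x)]
        · simp [hA.proj_same (hA.proj_mem d x)]
      · refine ⟨0, zero_mem _, by simp, ?_, ?_⟩
        · rw [hA.proj_ne (hA.proj_mem (c + δ) x) (by simpa using hδ), map_zero]
        · rw [hA.proj_ne (hA.proj_mem (d + δ) x) (by simpa using hδ), map_zero]
    | zero => exact ⟨0, zero_mem _, by simp, by simp, by simp⟩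
    | add g g' _ _ h h' =>
      obtain ⟨x, hx, h1, h2, h3⟩ := h
      obtain ⟨x', hx', h1', h2', h3'⟩ := h'
      refine ⟨x + x', add_mem hx hx', fun i hi => ?_, ?_, ?_⟩
      · rw [map_add, h1 i hi, h1' i hi, add_zero]
      · rw [map_add, h2, h2', Prod.fst_add, map_add]
      · rw [map_add, h3, h3', Prod.snd_add, map_add]
    | smul t g _ h =>
      obtain ⟨x, hx, h1, h2, h3⟩ := h
      refine ⟨t • x, I.smul_mem t hx, fun i hi => ?_, ?_, ?_⟩
      · rw [map_smul, h1 i hi, smul_zero]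
      · rw [map_smul, h2, Prod.smul_fst, map_smul]
      · rw [map_smul, h3, Prod.smul_snd, map_smul]
  have hne : ((0 : L), hA.proj d r) ∉ G := by
    intro h
    obtain ⟨x, hx, h1, h2, h3⟩ := hlift _ h
    rw [hA.proj_same (hA.proj_mem d r)] at h3
    have hx0 : x ≠ 0 := fun h => hd (by rw [← h3, h, map_zero])
    refine absurd (hmin x hx hx0) (not_le.2 (Set.ncard_lt_ncard ?_ (hA.finite_support r)))
    refine ⟨fun i hi h => hi (h1 i h), fun h => ?_⟩
    exact h hc (by rw [h2, map_zero])
  refine hcd (sub_eq_zero.1 (hC _ (hs.mem_centroidSupport_of_graph hA G ?_ ?_ ⟨_, hne⟩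
    ⟨_, hG 0 r .base, by simpa using hd⟩))).symm
  · intro y g hg
    induction hg using Submodule.span_induction with
    | mem g hg =>
      obtain ⟨δ, x, h, rfl⟩ := hg
      refine hA.induction (P := fun y =>
        (⁅y, hA.proj (c + δ) x⁆, ⁅y, hA.proj (d + δ) x⁆) ∈ G) (fun κ y hy => ?_) ?_ ?_ y
      · rw [← hA.proj_lie hy, ← hA.proj_lie hy, add_assoc, add_assoc]
        exact hG _ _ (h.step hy)
      · rw [zero_lie, zero_lie]
        exact zero_mem G
      · intro y y' h h'
        simpa using add_mem h h'
    | zero =>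
      rw [Prod.fst_zero, Prod.snd_zero, lie_zero]
      exact zero_mem G
    | add g g' _ _ h h' => simpa using add_mem h h'
    | smul t g _ h => simpa using G.smul_mem t h
  · intro g hg ν
    have : G ≤ G.comap ((hA.proj ν).prodMap (hA.proj (ν + (d - c)))) := by
      refine Submodule.span_le.2 ?_
      rintro _ ⟨δ, x, h, rfl⟩
      change (hA.proj ν (hA.proj (c + δ) x), hA.proj (ν + (d - c)) (hA.proj (d + δ) x)) ∈ G
      by_cases hν : c + δ = ν
      · subst hν
        rw [show c + δ + (d - c) = d + δ by abel, hA.proj_same (hA.proj_mem _ x),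
          hA.proj_same (hA.proj_mem _ x)]
        exact hG _ _ h
      · rw [hA.proj_ne (hA.proj_mem _ x) hν, hA.proj_ne (hA.proj_mem _ x)]
        · exact zero_mem G
        · intro h
          apply hν
          rw [← add_sub_cancel_right ν (d - c), ← h]
          abel
    exact this hg

/-- A simple graded Lie algebra whose centroid is concentrated in degree `0` is simple. -/
theorem IsSimpleGraded.isSimple (hs : IsSimpleGraded A) (hA : IsLieGrading A)
    (hC : ∀ ε ∈ centroidSupport A, ε = 0) : LieAlgebra.IsSimple ℂ L where
  non_abelian := hs.non_abelian
  eq_bot_or_eq_top I := by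
    classical
    by_cases hI : I = ⊥
    · exact Or.inl hI
    right
    obtain ⟨x₀, hx₀, hx₀0⟩ : ∃ x ∈ I, x ≠ 0 := by
      by_contra! h
      exact hI ((LieSubmodule.eq_bot_iff I).2 h)
    have hex : ∃ n, ∃ x ∈ I, x ≠ 0 ∧ {i | hA.proj i x ≠ 0}.ncard = n := ⟨_, x₀, hx₀, hx₀0, rfl⟩
    obtain ⟨r, hr, hr0, hrn⟩ := Nat.find_spec hex
    have hmin : ∀ x ∈ I, x ≠ 0 →
        {i | hA.proj i r ≠ 0}.ncard ≤ {i | hA.proj i x ≠ 0}.ncard := fun x hx hx0 => by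
      rw [hrn]
      exact Nat.find_min' hex ⟨x, hx, hx0, rfl⟩
    obtain ⟨c, hc⟩ : ∃ c, hA.proj c r ≠ 0 := by
      by_contra! h
      exact hr0 (hA.eq_zero_of_proj h)
    have hrc : hA.proj c r = r := by
      rw [← sub_eq_zero]
      refine hA.eq_zero_of_proj fun i => ?_
      rw [map_sub, sub_eq_zero]
      by_cases hi : c = i
      · subst hi
        exact hA.proj_same (hA.proj_mem c r)
      · rw [hA.proj_ne (hA.proj_mem c r) hi,
          hs.proj_eq_zero_of_minimal hA hC I hr hmin hi hc]
    -- The minimal `r` is homogeneous, so the graded part of `I` is nonzero and hence everything.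
    rcases hs.family_dichotomy hA (fun i => A i ⊓ I.toSubmodule) (fun i => inf_le_left)
      (fun i j x hx y hy => ⟨hA.lie_mem hx hy.1, I.lie_mem hy.2⟩) with h | h
    · have : r ∈ A c ⊓ I.toSubmodule := ⟨hrc ▸ hA.proj_mem c r, hr⟩
      rw [h c, Submodule.mem_bot] at this
      exact absurd this hr0
    · rw [eq_top_iff]
      rintro x -
      refine hA.induction (P := fun x => x ∈ I) (fun i x hx => ?_) (zero_mem I)
        (fun x y hx hy => add_mem hx hy) x
      have hx' : x ∈ A i ⊓ I.toSubmodule := (h i).symm ▸ hx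
      exact hx'.2

variable {M : AddSubgroup Λ} {ψ : M → Module.End ℂ L}

/-- The centroid of the specialization is concentrated in degree `0`. -/
theorem IsCentroidSection.eq_zero_of_mem_centroidSupport (hψ : IsCentroidSection A M ψ)
    (hA : IsLieGrading A) (hM : ∀ μ ∈ centroidSupport A, μ ∈ M) {ε : Λ ⧸ M}
    (hε : ε ∈ centroidSupport (hψ.grading hA)) : ε = 0 := by
  obtain ⟨χ, hχ, hχ0, hχ1⟩ := hε
  obtain ⟨e, rfl⟩ := QuotientAddGroup.mk_surjective ε
  -- A lift of `χ` to the centroid of `L`: project, apply `χ`, return to the representative degree,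
  -- then use `ψ` to reach degree `m + e`. Hence `e ∈ M`.
  let φ : Module.End ℂ L := hA.lift fun m => ψ (-shift M (m + e)) ∘ₗ hψ.repr hA ∘ₗ χ ∘ₗ
    (hψ.proj hA : L →ₗ[ℂ] hψ.Specialization hA)
  have hφ : ∀ m, ∀ x ∈ A m, φ x = ψ (-shift M (m + e)) (hψ.repr hA (χ (hψ.proj hA x))) :=
    fun m x hx => hA.lift_apply _ hx
  have hφm : ∀ m, ∀ x ∈ A m, φ x ∈ A (m + e) := by
    intro m x hx
    rw [hφ m x hx]
    have h1 := hχ1 _ _ (hψ.proj_mem hA hx)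
    rw [← QuotientAddGroup.mk_add] at h1
    obtain ⟨y, hy, hy'⟩ := h1
    have h2 := hψ.homogeneous (-shift M (m + e)) _ _ (hψ.reduce_mem hA hy)
    rw [← add_shift, AddSubgroup.coe_neg, add_neg_cancel_right] at h2
    rw [← hy']
    exact h2
  have hφχ : ∀ x, hψ.proj hA (φ x) = χ (hψ.proj hA x) := by
    refine hA.linearMap_ext (φ := (hψ.proj hA : L →ₗ[ℂ] hψ.Specialization hA) ∘ₗ φ)
      (ψ := χ ∘ₗ (hψ.proj hA : L →ₗ[ℂ] hψ.Specialization hA)) fun m x hx => ?_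
    simp only [LinearMap.comp_apply, LieHom.coe_toLinearMap]
    rw [hφ m x hx, hψ.proj_map, hψ.proj_repr]
  have hφ_lie : ∀ a b : L, φ ⁅a, b⁆ = ⁅a, φ b⁆ := by
    intro a b
    refine hA.induction (P := fun a => φ ⁅a, b⁆ = ⁅a, φ b⁆) (fun i a ha => ?_) (by simp)
      (fun a a' h h' => by simp [h, h']) a
    refine hA.induction (P := fun b => φ ⁅a, b⁆ = ⁅a, φ b⁆) (fun j b hb => ?_) (by simp)
      (fun b b' h h' => by simp [h, h']) b
    rw [← sub_eq_zero]
    refine hψ.proj_injOn hA (m := i + j + e) (sub_mem (hφm _ _ (hA.lie_mem ha hb))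
      (hA.lie_mem_of_eq ha (hφm _ _ hb) (add_assoc _ _ _).symm)) ?_
    rw [map_sub, hφχ, LieHom.map_lie, LieHom.map_lie, hφχ, (hχ _ _).2, sub_self]
  refine (QuotientAddGroup.eq_zero_iff e).2 (hM e ⟨φ, fun a b => ⟨?_, hφ_lie a b⟩, fun h => ?_, hφm⟩)
  · rw [← lie_skew, map_neg, hφ_lie, lie_skew]
  · refine hχ0 (LinearMap.ext fun y => ?_)
    obtain ⟨x, rfl⟩ := hψ.proj_surjective hA y
    rw [← hφχ, h, LinearMap.zero_apply, map_zero, LinearMap.zero_apply]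

end Simplicity

end GradedLie

theorem theorem2 {Λ : Type u} [AddCommGroup Λ] [Module.Free ℤ Λ] [Module.Finite ℤ Λ]
    {L : Type v} [LieRing L] [LieAlgebra ℂ L] (A : Λ → Submodule ℂ L)
    (hA : GradedLie.IsClassG' A) (hint : GradedLie.IsIntegrable A) :
    ∃ M : AddSubgroup Λ, (M : Set Λ) = GradedLie.centroidSupport A ∧
      ∃ (𝔤 : Type v) (_ : LieRing 𝔤) (_ : LieAlgebra ℂ 𝔤) (B : Λ ⧸ M → Submodule ℂ 𝔤)
        (hB : GradedLie.IsClassG' B),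
        LieAlgebra.IsSimple ℂ 𝔤 ∧ FiniteDimensional ℂ 𝔤 ∧
        GradedLie.IsGradedIsomorphic A
          (GradedLie.pullbackGrading (QuotientAddGroup.mk' M) hB.grading) := by
  obtain ⟨h₀, l, S⟩ := GradedLie.exists_weightSystem hA hint
  obtain ⟨ψ, hψ⟩ := GradedLie.exists_isCentroidSection hA.grading hA.simple
  have hB := hψ.isClassG' hA
  exact ⟨GradedLie.centroidSubgroup hA.grading hA.simple, rfl, hψ.Specialization hA.grading,
    inferInstance, inferInstance, hψ.grading hA.grading, hB,
    hB.simple.isSimple hB.grading fun ε hε =>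
      hψ.eq_zero_of_mem_centroidSupport hA.grading (fun _ h => h) hε,
    hψ.finiteDimensional hA S.finite_image_support, hψ.isGradedIsomorphic hA.grading hB.grading⟩
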